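/- Let $k$ be a field, $H$ a Hopf algebra over $k$, and $P$ a right $H$-comodule algebra with coaction $p\mapsto p_{(0)}\otimes p_{(1)}$ (Sweedler notation, sums understood) and coinvariant subalgebra $B=\{b\in P: b_{(0)}\otimes b_{(1)}=b\otimes 1\}$. Assume that $B\subseteq P$ is Hopf–Galois, i.e. $\mathrm{can}:P\otimes_BP\to P\otimes H$, $p\otimes_B q\mapsto pq_{(0)}\otimes q_{(1)}$, is bijective, and that $P$ is faithfully flat as a left $B$-module. Put $\tau(h)=\mathrm{can}^{-1}(1\otimes h)$ for $h\in H$. Let $\mathcal L(P,H)$ be the Ehresmann–Schauenburg left $B$-bialgebroid: as a vector space it is $$(P\otimes P)^{coH}=\{p\otimes q\in P\otimes P:\ p_{(0)}\otimes q_{(0)}\otimes p_{(1)}q_{(1)}=p\otimes q\otimes 1\},$$ with product $(p\otimes q)(r\otimes u)=pr\otimes uq$, source $s(b)=b\otimes 1$, target $t(b)=1\otimes b$, counit $\epsilon(p\otimes q)=pq$ and coproduct $\Delta(p\otimes q)=p_{(0)}\otimes\tau(p_{(1)})\otimes q$ (these data do define, uniquely, a left $B$-bialgebroid; here $\otimes_B$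 on $\mathcal L=\mathcal L(P,H)$ is given by $t(b)X\otimes_BY=X\otimes_Bs(b)Y$, and $\mathcal L\otimes_B\mathcal L$ is mapped into $P\otimes(P\otimes_BP)\otimes P$ by $(p\otimes q)\otimes_B(r\otimes u)\mapsto p\otimes(q\otimes_B r)\otimes u$). Let $H$ be coquasitriangular: there is a convolution-invertible linear map $\mathcal R:H\otimes H\to k$ such that, for all $g,h,f\in H$, $$g_{(1)}h_{(1)}\mathcal R(h_{(2)}\otimes g_{(2)})=\mathcal R(h_{(1)}\otimes g_{(1)})h_{(2)}g_{(2)},$$ $$\mathcal R(h\otimes gf)=\mathcal R(h_{(1)}\otimes f)\mathcal R(h_{(2)}\otimes g),\qquad \mathcal R(hg\otimes f)=\mathcal R(h\otimes f_{(1)})\mathcal R(g\otimes f_{(2)}).$$ Then the braiding $\Psi(p\otimes q)=q_{(0)}\otimes p_{(0)}\,\mathcal R(p_{(1)}\otimes q_{(1)})$ on $P\otimes P$ is invertible, with inverse $\Psi^{-1}(p\otimes q)=q_{(0)}\otimes p_{(0)}\,\mathcal R^{-1}(q_{(1)}\otimes p_{(1)})$, where $\mathcal R^{-1}$ is the convolution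 inverse of $\mathcal R$; and $\Psi^{-1}$ restricts to an invertible linear map $S:\mathcal L\to\mathcal L$ which is a left antipode, that is, writing $\Delta(X)=X_{(1)}\otimes_BX_{(2)}$, for all $X\in\mathcal L$ and $b\in B$: 1. $S(t(b)X)=S(X)s(b)$ and $S^{-1}(s(b)X)=S^{-1}(X)t(b)$; 2. $S^{-1}(X_{(2)})_{(1)}\otimes_BS^{-1}(X_{(2)})_{(2)}X_{(1)}=S^{-1}(X)\otimes_B1$; 3. $S(X_{(1)})_{(1)}X_{(2)}\otimes_BS(X_{(1)})_{(2)}=1\otimes_BS(X)$. -/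

import Mathlib

open scoped TensorProduct

noncomputable section

/-! ## Balanced tensor products over a noncommutative ring

The right action of `B` on `M` and the left action of `B` on `N` are given by families of
`k`-linear endomorphisms, since the algebras below carry several `B`-actions at once. -/

namespace Balanced

variable {k : Type*} [CommRing k] {B M N O : Type*}
  [AddCommGroup M] [Module k M] [AddCommGroup N] [Module k N] [AddCommGroup O] [Module k O]

/-- The relations `m.b ⊗ n = m ⊗ b.n`, as a subspace of `M ⊗[k] N`. -/
def rel (ρ : B → Module.End k M) (l : B → Module.End k N) : Submodule k (M ⊗[k] N) :=
  Submodule.span k {z | ∃ b m n, z = ρ b m ⊗ₜ[k] n - m ⊗ₜ[k] l b n}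

/-- The balanced tensor product `M ⊗_B N`. -/
abbrev Tensor (ρ : B → Module.End k M) (l : B → Module.End k N) : Type _ :=
  (M ⊗[k] N) ⧸ rel ρ l

/-- The projection `M ⊗[k] N → M ⊗_B N`. -/
abbrev proj (ρ : B → Module.End k M) (l : B → Module.End k N) :
    M ⊗[k] N →ₗ[k] Tensor ρ l :=
  (rel ρ l).mkQ

lemma proj_act (ρ : B → Module.End k M) (l : B → Module.End k N) (b : B) (m : M) (n : N) :
    proj ρ l (ρ b m ⊗ₜ n) = proj ρ l (m ⊗ₜ l b n) :=
  (Submodule.Quotient.eq _).2 (Submodule.subset_span ⟨b, m, n, rfl⟩)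

/-- Descent of a balanced `k`-linear map on `M ⊗[k] N` to `M ⊗_B N`. -/
def lift {ρ : B → Module.End k M} {l : B → Module.End k N} (f : M ⊗[k] N →ₗ[k] O)
    (h : ∀ b m n, f (ρ b m ⊗ₜ n) = f (m ⊗ₜ l b n)) : Tensor ρ l →ₗ[k] O :=
  (rel ρ l).liftQ f (by
    refine Submodule.span_le.2 ?_
    rintro _ ⟨b, m, n, rfl⟩
    simp [h])

/-- The relations of the triple product `M ⊗_B N ⊗_B O`, as a subspace of
`M ⊗[k] (N ⊗[k] O)`. -/
def rel₃ (ρ : B → Module.End k M) (l ρ' : B → Module.End k N) (l' : B → Module.End k O) :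
    Submodule k (M ⊗[k] (N ⊗[k] O)) :=
  Submodule.span k
    ({z | ∃ b m n o, z = ρ b m ⊗ₜ[k] (n ⊗ₜ[k] o) - m ⊗ₜ[k] (l b n ⊗ₜ[k] o)} ∪
     {z | ∃ b m n o, z = m ⊗ₜ[k] (ρ' b n ⊗ₜ[k] o) - m ⊗ₜ[k] (n ⊗ₜ[k] l' b o)})

/-- The triple balanced tensor product `M ⊗_B N ⊗_B O`. -/
abbrev Tensor₃ (ρ : B → Module.End k M) (l ρ' : B → Module.End k N) (l' : B → Module.End k O) :
    Type _ :=
  (M ⊗[k] (N ⊗[k] O)) ⧸ rel₃ ρ l ρ' l'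

/-- The map `(M ⊗_B N) ⊗[k] O → M ⊗_B N ⊗_B O`, `(m ⊗ n) ⊗ o ↦ m ⊗ n ⊗ o`. -/
def fromLeft (ρ : B → Module.End k M) (l ρ' : B → Module.End k N) (l' : B → Module.End k O) :
    Tensor ρ l ⊗[k] O →ₗ[k] Tensor₃ ρ l ρ' l' :=
  TensorProduct.lift
    (lift (TensorProduct.curry
        ((rel₃ ρ l ρ' l').mkQ ∘ₗ (TensorProduct.assoc k M N O).toLinearMap)) (by
      intro b m n
      ext o
      exact (Submodule.Quotient.eq _).2 (Submodule.subset_span (Or.inl ⟨b, m, n, o, rfl⟩))))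

/-- The map `M ⊗[k] (N ⊗_B O) → M ⊗_B N ⊗_B O`, `m ⊗ (n ⊗ o) ↦ m ⊗ n ⊗ o`. -/
def fromRight (ρ : B → Module.End k M) (l ρ' : B → Module.End k N) (l' : B → Module.End k O) :
    M ⊗[k] Tensor ρ' l' →ₗ[k] Tensor₃ ρ l ρ' l' :=
  TensorProduct.lift
    (lift (TensorProduct.curry (rel₃ ρ l ρ' l').mkQ).flip (by
      intro b n o
      ext m
      exact (Submodule.Quotient.eq _).2 (Submodule.subset_span (Or.inr ⟨b, m, n, o, rfl⟩)))).flip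

/-- The left action of `B` on a left `B`-module. -/
abbrev leftAct (k : Type*) [CommRing k] {B : Type*} [Ring B] [Algebra k B] (N : Type*)
    [AddCommGroup N] [Module k N] [Module B N] [IsScalarTower k B N] : B → Module.End k N :=
  fun b => Algebra.lsmul k k N b

/-- The right action of `B` on a right `B`-module. -/
abbrev rightAct (k : Type*) [CommRing k] {B : Type*} [Ring B] [Algebra k B] (M : Type*)
    [AddCommGroup M] [Module k M] [Module Bᵐᵒᵖ M] [IsScalarTower k Bᵐᵒᵖ M] :
    B → Module.End k M :=
  fun b => Algebra.lsmul k k M (MulOpposite.op b)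

/-- The map `f ⊗ id : M₁ ⊗_B N → M₂ ⊗_B N` for a map `f` of right `B`-modules. -/
def rTensor {k : Type*} [CommRing k] {B : Type*} [Ring B] [Algebra k B] (N : Type*)
    [AddCommGroup N] [Module k N] [Module B N] [IsScalarTower k B N]
    {M₁ M₂ : Type*} [AddCommGroup M₁] [AddCommGroup M₂] [Module k M₁] [Module k M₂]
    [Module Bᵐᵒᵖ M₁] [Module Bᵐᵒᵖ M₂] [IsScalarTower k Bᵐᵒᵖ M₁] [IsScalarTower k Bᵐᵒᵖ M₂]
    (f : M₁ →ₗ[Bᵐᵒᵖ] M₂) :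
    Tensor (rightAct k (B := B) M₁) (leftAct k N) →ₗ[k]
      Tensor (rightAct k (B := B) M₂) (leftAct k N) :=
  lift (proj _ _ ∘ₗ LinearMap.rTensor N (f.restrictScalars k)) (by
    intro b m n
    simpa using proj_act (rightAct k (B := B) M₂) (leftAct k N) b (f m) n)

end Balanced

/-- The left `B`-module `N` is faithfully flat: a sequence `M₁ → M₂ → M₃` of right `B`-modules is
exact if and only if `M₁ ⊗_B N → M₂ ⊗_B N → M₃ ⊗_B N` is exact. (The `k`-structures on the `Mᵢ`
are the ones induced by `k → B`.) -/
def LeftFaithfullyFlat.{w, u, v, x} (k : Type u) [CommRing k] (B : Type v) [Ring B] [Algebra k B]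
    (N : Type x) [AddCommGroup N] [Module k N] [Module B N] [IsScalarTower k B N] : Prop :=
  ∀ (M₁ M₂ M₃ : Type w) [AddCommGroup M₁] [AddCommGroup M₂] [AddCommGroup M₃]
    [Module k M₁] [Module k M₂] [Module k M₃] [Module Bᵐᵒᵖ M₁] [Module Bᵐᵒᵖ M₂] [Module Bᵐᵒᵖ M₃]
    [IsScalarTower k Bᵐᵒᵖ M₁] [IsScalarTower k Bᵐᵒᵖ M₂] [IsScalarTower k Bᵐᵒᵖ M₃]
    (f : M₁ →ₗ[Bᵐᵒᵖ] M₂) (g : M₂ →ₗ[Bᵐᵒᵖ] M₃),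
    Function.Exact f g ↔
      Function.Exact (Balanced.rTensor (k := k) N f) (Balanced.rTensor (k := k) N g)

/-! ## Left bialgebroids and left antipodes -/

namespace Bialgebroid

variable {k : Type*} [CommRing k] {B L : Type*} [Ring L] [Algebra k L]

/-- `L ⊗_B L` for the `B`-bimodule structure `b.X.c = s b * t c * X`; the relations are
`t b * X ⊗ Y = X ⊗ s b * Y`. -/
abbrev Tensor (k : Type*) [CommRing k] {B L : Type*} [Ring L] [Algebra k L] (s t : B → L) :
    Type _ :=
  Balanced.Tensor (k := k) (fun b => LinearMap.mulLeft k (t b))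
    (fun b => LinearMap.mulLeft k (s b))

/-- The projection `L ⊗[k] L → L ⊗_B L`. -/
abbrev proj (k : Type*) [CommRing k] {B L : Type*} [Ring L] [Algebra k L] (s t : B → L) :
    L ⊗[k] L →ₗ[k] Tensor k s t :=
  Balanced.proj _ _

/-- The right action of the algebra `L ⊗[k] L` on `L ⊗_B L` by factorwise right
multiplication. -/
def rightMul (s t : B → L) : Tensor k s t →ₗ[k] L ⊗[k] L →ₗ[k] Tensor k s t :=
  Balanced.lift ((LinearMap.mul k (L ⊗[k] L)).compr₂ (proj k s t)) (by
    intro b m n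
    ext x y
    simpa [mul_assoc] using
      Balanced.proj_act (fun b => LinearMap.mulLeft k (t b)) (fun b => LinearMap.mulLeft k (s b))
        b (m * x) (n * y))

end Bialgebroid

/-- A left `B`-bialgebroid structure on the `k`-algebra `L`. In the fields, `z` and `w` are
representatives in `L ⊗[k] L` of elements of `L ⊗_B L`. -/
structure LeftBialgebroid (k B L : Type*) [Field k] [Ring B] [Algebra k B] [Ring L]
    [Algebra k L] where
  /-- the source map `s` -/
  source : B →ₐ[k] L
  /-- the target map `t` -/
  target : Bᵐᵒᵖ →ₐ[k] L
  source_target_comm : ∀ b c, Commute (source b) (target c)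
  /-- the coproduct `Δ : L → L ⊗_B L` -/
  comul : L →ₗ[k] Bialgebroid.Tensor k source (fun b => target (MulOpposite.op b))
  /-- the counit `ε : L → B` -/
  counit : L →ₗ[k] B
  -- `Δ` and `ε` are maps of `B`-bimodules
  comul_bimodule : ∀ b c X z, Bialgebroid.proj k _ _ z = comul X →
    comul (source b * target (MulOpposite.op c) * X) =
      Bialgebroid.proj k _ _ ((source b ⊗ₜ target (MulOpposite.op c)) * z)
  counit_bimodule : ∀ b c X,
    counit (source b * target (MulOpposite.op c) * X) = b * counit X * c
  -- coassociativity `(Δ ⊗ id) Δ = (id ⊗ Δ) Δ` in `L ⊗_B L ⊗_B L`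
  coassoc : ∀ X z, Bialgebroid.proj k _ _ z = comul X →
    Balanced.fromLeft _ _ (fun b => LinearMap.mulLeft k (target (MulOpposite.op b)))
        (fun b => LinearMap.mulLeft k (source b)) (LinearMap.rTensor L comul z) =
      Balanced.fromRight _ _ _ _ (LinearMap.lTensor L comul z)
  -- counity: `s(ε(X₁)) X₂ = X` and `t(ε(X₂)) X₁ = X`
  counit_left : ∀ X z, Bialgebroid.proj k _ _ z = comul X →
    LinearMap.mul' k L (TensorProduct.map (source.toLinearMap ∘ₗ counit) LinearMap.id z) = X
  counit_right : ∀ X z, Bialgebroid.proj k _ _ z = comul X →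
    LinearMap.mul' k L (TensorProduct.comm k L L (TensorProduct.map LinearMap.id
      (target.toLinearMap ∘ₗ (MulOpposite.opLinearEquiv k).toLinearMap ∘ₗ counit) z)) = X
  -- `Δ` takes values in the Takeuchi product: `X₁ t(b) ⊗ X₂ = X₁ ⊗ X₂ s(b)`
  takeuchi : ∀ b X,
    Bialgebroid.rightMul _ _ (comul X) (target (MulOpposite.op b) ⊗ₜ 1) =
      Bialgebroid.rightMul _ _ (comul X) (1 ⊗ₜ source b)
  -- `Δ` is an algebra map for the factorwise multiplication
  comul_one : comul 1 = Bialgebroid.proj k _ _ (1 ⊗ₜ 1)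
  comul_mul : ∀ X Y z w, Bialgebroid.proj k _ _ z = comul X → Bialgebroid.proj k _ _ w = comul Y →
    comul (X * Y) = Bialgebroid.proj k _ _ (z * w)
  -- `ε` is a left character
  counit_one : counit 1 = 1
  counit_mul_source : ∀ X Y, counit (X * source (counit Y)) = counit (X * Y)
  counit_mul_target : ∀ X Y,
    counit (X * target (MulOpposite.op (counit Y))) = counit (X * Y)

namespace LeftBialgebroid

variable {k B L : Type*} [Field k] [Ring B] [Algebra k B] [Ring L] [Algebra k L]

/-- An invertible linear map `S : L → L` is a left antipode of the left bialgebroid `L`. -/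
structure IsLeftAntipode (𝓛 : LeftBialgebroid k B L) (S : L ≃ₗ[k] L) : Prop where
  -- `S(t(b) X) = S(X) s(b)`
  map_target_mul : ∀ b X, S (𝓛.target (MulOpposite.op b) * X) = S X * 𝓛.source b
  -- `S⁻¹(s(b) X) = S⁻¹(X) t(b)`
  symm_source_mul : ∀ b X,
    S.symm (𝓛.source b * X) = S.symm X * 𝓛.target (MulOpposite.op b)
  -- `S⁻¹(X₂)₁ ⊗ S⁻¹(X₂)₂ X₁ = S⁻¹(X) ⊗ 1`; the map applied to `z` is
  -- `x ⊗ y ↦ Δ(S⁻¹ y) (1 ⊗ x)`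
  symm_comul : ∀ X z, Bialgebroid.proj k _ _ z = 𝓛.comul X →
    TensorProduct.lift
        ((Bialgebroid.rightMul _ _ ∘ₗ 𝓛.comul ∘ₗ S.symm.toLinearMap).flip ∘ₗ
          Algebra.TensorProduct.includeRight.toLinearMap) z =
      Bialgebroid.proj k _ _ (S.symm X ⊗ₜ 1)
  -- `S(X₁)₁ X₂ ⊗ S(X₁)₂ = 1 ⊗ S(X)`; the map applied to `z` is
  -- `x ⊗ y ↦ Δ(S x) (y ⊗ 1)`
  comul_map : ∀ X z, Bialgebroid.proj k _ _ z = 𝓛.comul X →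
    TensorProduct.lift
        ((Bialgebroid.rightMul _ _ ∘ₗ 𝓛.comul ∘ₗ S.toLinearMap).compl₂
          Algebra.TensorProduct.includeLeft.toLinearMap) z =
      Bialgebroid.proj k _ _ (1 ⊗ₜ S X)

end LeftBialgebroid

/-! ## Coquasitriangular Hopf algebras -/

/-- A coquasitriangular structure `R` on the Hopf algebra `H`, with its (unique) convolution
inverse `Rinv`. -/
structure CoquasitriangularStructure (k H : Type*) [Field k] [Ring H] [HopfAlgebra k H] where
  /-- the universal R-form -/
  R : H ⊗[k] H →ₗ[k] k
  /-- its convolution inverse -/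
  Rinv : H ⊗[k] H →ₗ[k] k
  mul_inv : WithConv.toConv R * WithConv.toConv Rinv = 1
  inv_mul : WithConv.toConv Rinv * WithConv.toConv R = 1
  -- `g₁ h₁ R(h₂ ⊗ g₂) = R(h₁ ⊗ g₁) h₂ g₂`
  quasi_comm : ∀ h g : H,
    TensorProduct.rid k H (TensorProduct.map
        (LinearMap.mul' k H ∘ₗ (TensorProduct.comm k H H).toLinearMap) R
        (Coalgebra.comul (R := k) (h ⊗ₜ[k] g))) =
      TensorProduct.lid k H (TensorProduct.map R (LinearMap.mul' k H)
        (Coalgebra.comul (R := k) (h ⊗ₜ[k] g)))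
  -- `R(h ⊗ g f) = R(h₁ ⊗ f) R(h₂ ⊗ g)`
  map_mul_right : ∀ h g f : H,
    R (h ⊗ₜ (g * f)) = LinearMap.mul' k k (TensorProduct.map
      ((TensorProduct.curry R).flip f) ((TensorProduct.curry R).flip g)
      (Coalgebra.comul (R := k) h))
  -- `R(h g ⊗ f) = R(h ⊗ f₁) R(g ⊗ f₂)`
  map_mul_left : ∀ h g f : H,
    R ((h * g) ⊗ₜ f) = LinearMap.mul' k k (TensorProduct.map
      (TensorProduct.curry R h) (TensorProduct.curry R g) (Coalgebra.comul (R := k) f))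

/-! ## Comodule algebras and Hopf–Galois extensions -/

/-- A right `H`-comodule algebra structure on `P`. -/
structure RightComoduleAlgebra (k H P : Type*) [Field k] [Ring H] [HopfAlgebra k H]
    [Ring P] [Algebra k P] where
  /-- the coaction `p ↦ p₀ ⊗ p₁` -/
  coact : P →ₐ[k] P ⊗[k] H
  coact_coassoc : ∀ p,
    TensorProduct.assoc k P H H (LinearMap.rTensor H coact.toLinearMap (coact p)) =
      LinearMap.lTensor P (Coalgebra.comul (R := k)) (coact p)
  coact_counit : ∀ p,
    TensorProduct.rid k P (LinearMap.lTensor P (Coalgebra.counit (R := k)) (coact p)) = p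

namespace RightComoduleAlgebra

variable {k H P : Type*} [Field k] [Ring H] [HopfAlgebra k H] [Ring P] [Algebra k P]
  (δ : RightComoduleAlgebra k H P)

/-- The coinvariant subalgebra `B = {b ∈ P | coact b = b ⊗ 1}`. -/
def base : Subalgebra k P :=
  AlgHom.equalizer δ.coact Algebra.TensorProduct.includeLeft

lemma coact_base (b : δ.base) : δ.coact (b : P) = (b : P) ⊗ₜ 1 := b.2

/-- `P ⊗_B P`, the balanced tensor product over the coinvariant subalgebra. -/
abbrev TensorBase : Type _ :=
  Balanced.Tensor (k := k) (fun b : δ.base => LinearMap.mulRight k (b : P))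
    (fun b : δ.base => LinearMap.mulLeft k (b : P))

/-- The projection `P ⊗[k] P → P ⊗_B P`. -/
abbrev projBase : P ⊗[k] P →ₗ[k] δ.TensorBase := Balanced.proj _ _

/-- The canonical map `P ⊗_B P → P ⊗ H`, `p ⊗ q ↦ p q₀ ⊗ q₁`. -/
def can : δ.TensorBase →ₗ[k] P ⊗[k] H :=
  Balanced.lift (TensorProduct.lift
      ((LinearMap.mul k (P ⊗[k] H)).compl₁₂
        Algebra.TensorProduct.includeLeft.toLinearMap δ.coact.toLinearMap)) (by
    intro b p q
    simp [coact_base, ← mul_assoc])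

/-- `P` is a Hopf–Galois extension of its coinvariants. -/
def IsHopfGalois : Prop := Function.Bijective δ.can

/-- The translation map `τ : H → P ⊗_B P`, `τ h = can⁻¹ (1 ⊗ h)`. -/
def translation (hG : δ.IsHopfGalois) : H →ₗ[k] δ.TensorBase :=
  (LinearEquiv.ofBijective δ.can hG).symm.toLinearMap ∘ₗ TensorProduct.mk k P H 1

/-- The identification `P ⊗ Pᵐᵒᵖ = P ⊗ P` of vector spaces. -/
def unop : P ⊗[k] Pᵐᵒᵖ ≃ₗ[k] P ⊗[k] P :=
  TensorProduct.congr (LinearEquiv.refl k P) (MulOpposite.opLinearEquiv k).symm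

/-- The diagonal coaction `p ⊗ q ↦ p₀ ⊗ q₀ ⊗ p₁ q₁` on `P ⊗ P`. -/
def coact₂ : P ⊗[k] P →ₗ[k] (P ⊗[k] P) ⊗[k] H :=
  LinearMap.lTensor (P ⊗[k] P) (LinearMap.mul' k H) ∘ₗ
    (TensorProduct.tensorTensorTensorComm k P H P H).toLinearMap ∘ₗ
      TensorProduct.map δ.coact.toLinearMap δ.coact.toLinearMap

lemma coact₂_mul (X w : P ⊗[k] Pᵐᵒᵖ) (hw : δ.coact₂ (unop w) = unop w ⊗ₜ 1) :
    δ.coact₂ (unop (X * w)) =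
      LinearMap.rTensor H (unop.toLinearMap ∘ₗ LinearMap.mulRight k w ∘ₗ unop.symm.toLinearMap)
        (δ.coact₂ (unop X)) := by
  -- `coact₂ ((p ⊗ q) w)` depends on `w` only through `coact₂ w`
  have aux : ∀ a d : P ⊗[k] H, ∃ Φ : (P ⊗[k] P) ⊗[k] H →ₗ[k] (P ⊗[k] P) ⊗[k] H,
      (∀ b c : P ⊗[k] H, LinearMap.lTensor (P ⊗[k] P) (LinearMap.mul' k H)
          (TensorProduct.tensorTensorTensorComm k P H P H ((a * b) ⊗ₜ (c * d))) =
        Φ (LinearMap.lTensor (P ⊗[k] P) (LinearMap.mul' k H)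
          (TensorProduct.tensorTensorTensorComm k P H P H (b ⊗ₜ c)))) ∧
      ∀ w : P ⊗[k] Pᵐᵒᵖ, Φ (unop w ⊗ₜ 1) =
        LinearMap.rTensor H
          (unop.toLinearMap ∘ₗ LinearMap.mulRight k w ∘ₗ unop.symm.toLinearMap)
          (LinearMap.lTensor (P ⊗[k] P) (LinearMap.mul' k H)
            (TensorProduct.tensorTensorTensorComm k P H P H (a ⊗ₜ d))) := by
    intro a d
    induction a with
    | zero => exact ⟨0, by simp, by simp⟩
    | add a₁ a₂ h₁ h₂ =>
      obtain ⟨Φ₁, h₁, h₁'⟩ := h₁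
      obtain ⟨Φ₂, h₂, h₂'⟩ := h₂
      exact ⟨Φ₁ + Φ₂, by simp [add_mul, TensorProduct.add_tmul, h₁, h₂],
        by simp [TensorProduct.add_tmul, h₁', h₂']⟩
    | tmul p h =>
      induction d with
      | zero => exact ⟨0, by simp, by simp⟩
      | add a₁ a₂ h₁ h₂ =>
        obtain ⟨Φ₁, h₁, h₁'⟩ := h₁
        obtain ⟨Φ₂, h₂, h₂'⟩ := h₂
        exact ⟨Φ₁ + Φ₂, by simp [mul_add, TensorProduct.tmul_add, h₁, h₂],
          by simp [TensorProduct.tmul_add, h₁', h₂']⟩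
      | tmul q g =>
        refine ⟨TensorProduct.map (TensorProduct.map (LinearMap.mulLeft k p)
          (LinearMap.mulRight k q)) (LinearMap.mulLeft k h ∘ₗ LinearMap.mulRight k g), ?_, ?_⟩
        · intro b c
          induction b with
          | zero => simp
          | add b₁ b₂ h₁ h₂ => simp only [mul_add, TensorProduct.add_tmul, map_add, h₁, h₂]
          | tmul r m =>
            induction c with
            | zero => simp
            | add b₁ b₂ h₁ h₂ => simp only [add_mul, TensorProduct.tmul_add, map_add, h₁, h₂]
            | tmul u n => simp [mul_assoc]
        · intro w
          induction w with
          | zero => simp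
          | add w₁ w₂ h₁ h₂ =>
            simp only [map_add, TensorProduct.add_tmul, h₁, h₂]
            simp [unop, mul_add, TensorProduct.add_tmul]
          | tmul r u => simp [unop]
  induction X with
  | zero => simp
  | add X₁ X₂ h₁ h₂ => simp only [add_mul, map_add, h₁, h₂]
  | tmul p q =>
    obtain ⟨Φ, h₁, h₂⟩ := aux (δ.coact p) (δ.coact q.unop)
    have h₃ : ∀ w : P ⊗[k] Pᵐᵒᵖ,
        δ.coact₂ (unop ((p ⊗ₜ q) * w)) = Φ (δ.coact₂ (unop w)) := by
      intro w
      induction w with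
      | zero => simp
      | add w₁ w₂ h₁ h₂ => simp only [mul_add, map_add, h₁, h₂]
      | tmul r u => simpa [unop, coact₂] using h₁ (δ.coact r) (δ.coact u.unop)
    rw [h₃, hw, h₂]
    simp [unop, coact₂]

/-- The algebra underlying `L(P, H)`: the coinvariants of the diagonal coaction on `P ⊗ P`, with
the product `(p ⊗ q)(r ⊗ u) = p r ⊗ u q`, as a subalgebra of `P ⊗ Pᵐᵒᵖ`. -/
def esAlgebra : Subalgebra k (P ⊗[k] Pᵐᵒᵖ) where
  carrier := {X | δ.coact₂ (unop X) = unop X ⊗ₜ 1}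
  add_mem' {X Y} hX hY := by
    simp only [Set.mem_ofPred_eq] at hX hY ⊢
    rw [map_add, map_add, hX, hY, TensorProduct.add_tmul]
  mul_mem' {X Y} hX hY := by
    simp only [Set.mem_ofPred_eq] at hX hY ⊢
    rw [coact₂_mul δ X Y hY, hX]
    simp
  algebraMap_mem' r := by
    simp [unop, coact₂, Algebra.algebraMap_eq_smul_one,
      TensorProduct.smul_tmul', Algebra.TensorProduct.one_def]

/-- The space `P ⊗ (P ⊗_B P) ⊗ P`. -/
abbrev Quad : Type _ := P ⊗[k] (δ.TensorBase ⊗[k] P)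

/-- The map `(p ⊗ q) ⊗ (r ⊗ u) ↦ p ⊗ (q ⊗_B r) ⊗ u` from `L(P, H) ⊗ L(P, H)` to
`P ⊗ (P ⊗_B P) ⊗ P`. -/
def quadMap : δ.esAlgebra ⊗[k] δ.esAlgebra →ₗ[k] δ.Quad :=
  LinearMap.lTensor P (LinearMap.rTensor P δ.projBase ∘ₗ
      (TensorProduct.assoc k P P P).symm.toLinearMap) ∘ₗ
    (TensorProduct.assoc k P P (P ⊗[k] P)).toLinearMap ∘ₗ
      TensorProduct.map (unop.toLinearMap ∘ₗ δ.esAlgebra.val.toLinearMap)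
        (unop.toLinearMap ∘ₗ δ.esAlgebra.val.toLinearMap)

/-- The map `p ⊗ q ↦ p₀ ⊗ τ(p₁) ⊗ q`. -/
def quadComul (hG : δ.IsHopfGalois) : P ⊗[k] P →ₗ[k] δ.Quad :=
  LinearMap.lTensor P (LinearMap.rTensor P (δ.translation hG)) ∘ₗ
    (TensorProduct.assoc k P H P).toLinearMap ∘ₗ LinearMap.rTensor P δ.coact.toLinearMap

/-- `𝓛` is the Ehresmann–Schauenburg bialgebroid structure on the coinvariants of `P ⊗ P`:
`s b = b ⊗ 1`, `t b = 1 ⊗ b`, `ε (p ⊗ q) = p q` and `Δ (p ⊗ q) = p₀ ⊗ τ(p₁) ⊗ q`, the latter as an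
identity in `P ⊗ (P ⊗_B P) ⊗ P`. -/
structure IsEhresmannSchauenburg (hG : δ.IsHopfGalois)
    (𝓛 : LeftBialgebroid k δ.base δ.esAlgebra) : Prop where
  source_eq : ∀ b, (𝓛.source b : P ⊗[k] Pᵐᵒᵖ) = (b : P) ⊗ₜ 1
  target_eq : ∀ b : δ.base,
    (𝓛.target (MulOpposite.op b) : P ⊗[k] Pᵐᵒᵖ) = 1 ⊗ₜ MulOpposite.op (b : P)
  counit_eq : ∀ X, (𝓛.counit X : P) = LinearMap.mul' k P (unop (X : P ⊗[k] Pᵐᵒᵖ))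
  comul_eq : ∀ X z, Bialgebroid.proj k _ _ z = 𝓛.comul X →
    δ.quadMap z = δ.quadComul hG (unop (X : P ⊗[k] Pᵐᵒᵖ))

/-- For a bilinear form `f` on `H`, the map `p ⊗ q ↦ q₀ ⊗ p₀ f(p₁ ⊗ q₁)` on `P ⊗ P`. -/
def flipWith (f : H ⊗[k] H →ₗ[k] k) : P ⊗[k] P →ₗ[k] P ⊗[k] P :=
  (TensorProduct.rid k (P ⊗[k] P)).toLinearMap ∘ₗ
    TensorProduct.map (TensorProduct.comm k P P).toLinearMap f ∘ₗ
      (TensorProduct.tensorTensorTensorComm k P H P H).toLinearMap ∘ₗ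
        TensorProduct.map δ.coact.toLinearMap δ.coact.toLinearMap

/-- The braiding `Ψ(p ⊗ q) = q₀ ⊗ p₀ R(p₁ ⊗ q₁)` on `P ⊗ P`. -/
def braiding (𝓡 : CoquasitriangularStructure k H) : P ⊗[k] P →ₗ[k] P ⊗[k] P :=
  δ.flipWith 𝓡.R

/-- The map `p ⊗ q ↦ q₀ ⊗ p₀ R⁻¹(q₁ ⊗ p₁)` on `P ⊗ P`. -/
def braidingInv (𝓡 : CoquasitriangularStructure k H) : P ⊗[k] P →ₗ[k] P ⊗[k] P :=
  δ.flipWith (𝓡.Rinv ∘ₗ (TensorProduct.comm k H H).toLinearMap)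

end RightComoduleAlgebra

end

universe u v w

/-! Identities in L ⊗_B L are tested in P ⊗ P ⊗ P, through the map (p ⊗ q) ⊗ (r ⊗ u) ↦ p ⊗ qr ⊗ u
(`pairMul`). There the coproduct becomes trivial: since τ(h) multiplies to ε(h)1, the element Δ(p ⊗
q) goes to p ⊗ 1 ⊗ q. Once `pairMul` is known to be injective and p ⊗ 1 ⊗ q to lie in its image, Δ
exists, is unique, and its axioms become manipulations of tensors.

Both facts are Galois descent. The coinvariants of W ⊗ P are the kernel of the right B-linear map z
↦ z₀ ⊗ z₁ - z ⊗ 1. After applying - ⊗_B P and the Galois isomorphism (W ⊗ P) ⊗_B P ≅ W ⊗ P ⊗ H, this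
map becomes a cobar differential, and an element of its kernel is the coaction of its own counit
part (`galois_eq_of_coinvDiffBase_eq_zero`). Because exactness is preserved by - ⊗_B P, it follows
that L ⊗_B P ≅ P ⊗ P (`hopfMul_bijective`). Because exactness is reflected, V ⊗_B L is the space of
coinvariants of (V ⊗_B P) ⊗ P (`tensorIncl_injective`, `exact_tensorIncl`). With V = L this embeds L
⊗_B L in (L ⊗_B P) ⊗ P ≅ P ⊗ P ⊗ P; with V = L ⊗_B L it gives the fourfold version needed for
coassociativity.

The braiding is invertible because R is convolution invertible, and colinear by the
quasi-commutativity of R, so Ψ and Ψ⁻¹ preserve L. Axiom 1 says that coinvariants pass through Ψ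
untouched. For axioms 2 and 3, let X = x ⊗ y and let Δ(X) be a sum of terms (p ⊗ q) ⊗ (r ⊗ u). The
product qr hides the separate coactions of q and r, so one uses the finer Galois image p ⊗ q r₀ ⊗ r₁
⊗ u, which sums to x₀ ⊗ 1 ⊗ x₁ ⊗ y. Pairing r₁ with u through R gives axiom 2. For axiom 3 the
coaction of q is recovered from q₀r₀ ⊗ q₁r₁S(r₂) = q₀r ⊗ q₁; the same operation produces S(x₁) on
the other side, and coinvariance of X in the form x₀ ⊗ y ⊗ S(x₁) = x ⊗ y₀ ⊗ y₁ turns this into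
Ψ⁻¹(X). -/

noncomputable section

/-! ### Maps between balanced tensor products. -/

namespace Balanced

variable {k : Type*} [CommRing k] {B M N O M' N' : Type*}
  [AddCommGroup M] [Module k M] [AddCommGroup N] [Module k N] [AddCommGroup O] [Module k O]
  [AddCommGroup M'] [Module k M'] [AddCommGroup N'] [Module k N']

lemma hom_ext {ρ : B → Module.End k M} {l : B → Module.End k N} {f g : Tensor ρ l →ₗ[k] O}
    (h : ∀ m n, f (proj ρ l (m ⊗ₜ n)) = g (proj ρ l (m ⊗ₜ n))) : f = g := by
  refine Submodule.linearMap_qext _ (TensorProduct.ext' h)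

lemma lift_proj {ρ : B → Module.End k M} {l : B → Module.End k N} (f : M ⊗[k] N →ₗ[k] O)
    (h : ∀ b m n, f (ρ b m ⊗ₜ n) = f (m ⊗ₜ l b n)) (z : M ⊗[k] N) :
    lift f h (proj ρ l z) = f z := rfl

lemma proj_surjective (ρ : B → Module.End k M) (l : B → Module.End k N) :
    Function.Surjective (proj ρ l) := Submodule.mkQ_surjective _

/-- The map `f ⊗ g` on balanced tensor products. -/
def map {ρ : B → Module.End k M} {l : B → Module.End k N} {ρ' : B → Module.End k M'}
    {l' : B → Module.End k N'} (f : M →ₗ[k] M') (g : N →ₗ[k] N')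
    (hf : ∀ b m, f (ρ b m) = ρ' b (f m)) (hg : ∀ b n, g (l b n) = l' b (g n)) :
    Tensor ρ l →ₗ[k] Tensor ρ' l' :=
  lift (proj ρ' l' ∘ₗ TensorProduct.map f g) (by
    intro b m n
    simpa [hf, hg] using proj_act ρ' l' b (f m) (g n))

lemma map_proj {ρ : B → Module.End k M} {l : B → Module.End k N} {ρ' : B → Module.End k M'}
    {l' : B → Module.End k N'} (f : M →ₗ[k] M') (g : N →ₗ[k] N')
    (hf : ∀ b m, f (ρ b m) = ρ' b (f m)) (hg : ∀ b n, g (l b n) = l' b (g n)) (z : M ⊗[k] N) :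
    map f g hf hg (proj ρ l z) = proj ρ' l' (TensorProduct.map f g z) := rfl

/-- The map `f ⊗ id` on balanced tensor products. -/
abbrev mapLeft {ρ : B → Module.End k M} {ρ' : B → Module.End k M'} (l : B → Module.End k N)
    (f : M →ₗ[k] M') (hf : ∀ b m, f (ρ b m) = ρ' b (f m)) : Tensor ρ l →ₗ[k] Tensor ρ' l :=
  map f LinearMap.id hf (fun _ _ => rfl)

/-- The identification `(A ⊗ M) ⊗_B N = A ⊗ (M ⊗_B N)` for a `k`-module `A`. -/
def assoc (A : Type*) [AddCommGroup A] [Module k A] (ρ : B → Module.End k M)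
    (l : B → Module.End k N) :
    Tensor (fun b => LinearMap.lTensor A (ρ b)) l ≃ₗ[k] A ⊗[k] Tensor ρ l :=
  LinearEquiv.ofLinearMap
    (lift (LinearMap.lTensor A (proj ρ l) ∘ₗ (TensorProduct.assoc k A M N).toLinearMap) (by
      intro b z n
      induction z with
      | zero => simp
      | add x y hx hy => simp only [map_add, TensorProduct.add_tmul, hx, hy]
      | tmul a m => simpa using congrArg (a ⊗ₜ[k] ·) (proj_act ρ l b m n)))
    (TensorProduct.lift (lift (TensorProduct.curry (proj (fun b => LinearMap.lTensor A (ρ b)) l ∘ₗ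
        (TensorProduct.assoc k A M N).symm.toLinearMap)).flip (by
      intro b m n
      ext a
      simpa using proj_act (fun b => LinearMap.lTensor A (ρ b)) l b (a ⊗ₜ m) n)).flip)
    (by
      refine TensorProduct.ext ?_
      ext a m n
      rfl)
    (by
      refine hom_ext fun z n => ?_
      induction z with
      | zero => simp
      | add x y hx hy => simp only [map_add, TensorProduct.add_tmul, hx, hy]
      | tmul a m => rfl)

/-- The family `ρ` is a right action of the `k`-algebra `B`. -/
structure IsRightAct {k : Type*} [CommRing k] {B M : Type*} [AddCommGroup M] [Module k M]
    [Ring B] [Algebra k B] (ρ : B → Module.End k M) : Prop where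
  map_one : ρ 1 = 1
  map_mul : ∀ b c, ρ (b * c) = ρ c * ρ b
  map_add : ∀ b c, ρ (b + c) = ρ b + ρ c
  map_smul : ∀ (a : k) b, ρ (a • b) = a • ρ b

end Balanced

/-! ### Faithful flatness for actions given by endomorphisms, in arbitrary universes. -/

namespace LeftFaithfullyFlat

open Balanced

section

universe a b

variable {k : Type u} [CommRing k] {B : Type b} [Ring B] [Algebra k B]

/-- The algebra map `Bᵐᵒᵖ → End M` of a right action. -/
def actHom {M : Type*} [AddCommGroup M] [Module k M] {ρ : B → Module.End k M}
    (h : IsRightAct ρ) : Bᵐᵒᵖ →ₐ[k] Module.End k M :=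
  AlgHom.ofLinearMap
    { toFun := fun b => ρ b.unop
      map_add' := fun _ _ => h.map_add _ _
      map_smul' := fun _ _ => h.map_smul _ _ }
    h.map_one (fun _ _ => h.map_mul _ _)

variable {N : Type*} [AddCommGroup N] [Module k N] [Module B N] [IsScalarTower k B N]

lemma exact_iff_aux (hN : LeftFaithfullyFlat.{a} k B N) {l : B → Module.End k N}
    (hl : ∀ b n, l b n = b • n)
    {M₁ M₂ M₃ : Type a} [AddCommGroup M₁] [AddCommGroup M₂] [AddCommGroup M₃]
    [Module k M₁] [Module k M₂] [Module k M₃] {ρ₁ : B → Module.End k M₁}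
    {ρ₂ : B → Module.End k M₂} {ρ₃ : B → Module.End k M₃}
    (h₁ : IsRightAct ρ₁) (h₂ : IsRightAct ρ₂) (h₃ : IsRightAct ρ₃)
    (f : M₁ →ₗ[k] M₂) (g : M₂ →ₗ[k] M₃) (hf : ∀ b m, f (ρ₁ b m) = ρ₂ b (f m))
    (hg : ∀ b m, g (ρ₂ b m) = ρ₃ b (g m)) :
    Function.Exact f g ↔ Function.Exact (mapLeft l f hf) (mapLeft l g hg) := by
  obtain rfl : l = leftAct k N := by
    ext b n
    exact hl b n
  -- The actions become module structures only here, as local instances, so that the same space may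
  -- carry several B-actions elsewhere.
  let _ : Module Bᵐᵒᵖ M₁ := Module.compHom M₁ (actHom h₁).toRingHom
  let _ : Module Bᵐᵒᵖ M₂ := Module.compHom M₂ (actHom h₂).toRingHom
  let _ : Module Bᵐᵒᵖ M₃ := Module.compHom M₃ (actHom h₃).toRingHom
  have : IsScalarTower k Bᵐᵒᵖ M₁ :=
    ⟨fun c b m => congrArg (fun e : Module.End k M₁ => e m) (map_smul (actHom h₁) c b)⟩
  have : IsScalarTower k Bᵐᵒᵖ M₂ :=
    ⟨fun c b m => congrArg (fun e : Module.End k M₂ => e m) (map_smul (actHom h₂) c b)⟩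
  have : IsScalarTower k Bᵐᵒᵖ M₃ :=
    ⟨fun c b m => congrArg (fun e : Module.End k M₃ => e m) (map_smul (actHom h₃) c b)⟩
  exact hN M₁ M₂ M₃
    { toFun := f, map_add' := f.map_add, map_smul' := fun b m => hf b.unop m }
    { toFun := g, map_add' := g.map_add, map_smul' := fun b m => hg b.unop m }

end

section

universe a₁ a₂ a₃ c b

/-- The transport of a family of endomorphisms along `M ≃ ULift M`. -/
abbrev uliftAct {k : Type*} [CommRing k] {B M : Type*} [AddCommGroup M] [Module k M]
    (ρ : B → Module.End k M) : B → Module.End k (ULift.{c} M) :=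
  fun b => ULift.moduleEquiv.symm.toLinearMap ∘ₗ ρ b ∘ₗ ULift.moduleEquiv.toLinearMap

lemma uliftAct_isRightAct {k : Type*} [CommRing k] {B M : Type*} [AddCommGroup M] [Module k M]
    [Ring B] [Algebra k B] {ρ : B → Module.End k M} (h : IsRightAct ρ) :
    IsRightAct (uliftAct.{c} ρ) where
  map_one := by ext m; simp [h.map_one]
  map_mul b c := by ext m; simp [h.map_mul]
  map_add b c := by ext m; simp [h.map_add]
  map_smul a b := by ext m; simp [h.map_smul]

variable {k : Type u} [CommRing k] {B : Type b} [Ring B] [Algebra k B]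
variable {N : Type*} [AddCommGroup N] [Module k N] [Module B N] [IsScalarTower k B N]

/-- The identification `ULift M ⊗_B N = M ⊗_B N`. -/
def uliftTensor {M : Type*} [AddCommGroup M] [Module k M] (ρ : B → Module.End k M)
    (l : B → Module.End k N) : Tensor ρ l ≃ₗ[k] Tensor (uliftAct.{c} ρ) l :=
  LinearEquiv.ofLinearMap
    (mapLeft l ULift.moduleEquiv.symm.toLinearMap (fun _ _ => rfl))
    (mapLeft l ULift.moduleEquiv.toLinearMap (fun _ _ => rfl))
    (hom_ext fun _ _ => rfl) (hom_ext fun _ _ => rfl)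

/-- `LeftFaithfullyFlat` quantifies over three modules in one universe; lifting all three to the
maximum removes this restriction. The extra universe `c` allows the hypothesis to be given in a
larger universe than the modules require. -/
lemma exact_iff (hN : LeftFaithfullyFlat.{max a₁ a₂ a₃ c} k B N) {l : B → Module.End k N}
    (hl : ∀ b n, l b n = b • n)
    {M₁ : Type a₁} {M₂ : Type a₂} {M₃ : Type a₃}
    [AddCommGroup M₁] [AddCommGroup M₂] [AddCommGroup M₃]
    [Module k M₁] [Module k M₂] [Module k M₃] {ρ₁ : B → Module.End k M₁}
    {ρ₂ : B → Module.End k M₂} {ρ₃ : B → Module.End k M₃}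
    (h₁ : IsRightAct ρ₁) (h₂ : IsRightAct ρ₂) (h₃ : IsRightAct ρ₃)
    (f : M₁ →ₗ[k] M₂) (g : M₂ →ₗ[k] M₃) (hf : ∀ b m, f (ρ₁ b m) = ρ₂ b (f m))
    (hg : ∀ b m, g (ρ₂ b m) = ρ₃ b (g m)) :
    Function.Exact f g ↔ Function.Exact (mapLeft l f hf) (mapLeft l g hg) := by
  let f' : ULift.{max a₂ a₃ c} M₁ →ₗ[k] ULift.{max a₁ a₃ c} M₂ :=
    ULift.moduleEquiv.symm.toLinearMap ∘ₗ f ∘ₗ ULift.moduleEquiv.toLinearMap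
  let g' : ULift.{max a₁ a₃ c} M₂ →ₗ[k] ULift.{max a₁ a₂ c} M₃ :=
    ULift.moduleEquiv.symm.toLinearMap ∘ₗ g ∘ₗ ULift.moduleEquiv.toLinearMap
  have hf' : ∀ b m, f' (uliftAct ρ₁ b m) = uliftAct ρ₂ b (f' m) := by
    intro b m; simp [f', hf]
  have hg' : ∀ b m, g' (uliftAct ρ₂ b m) = uliftAct ρ₃ b (g' m) := by
    intro b m; simp [g', hg]
  have key := exact_iff_aux hN hl (uliftAct_isRightAct h₁) (uliftAct_isRightAct h₂)
    (uliftAct_isRightAct h₃) f' g' hf' hg'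
  rw [← Function.Exact.iff_of_ladder_linearEquiv (e₁ := ULift.moduleEquiv.symm)
    (e₂ := ULift.moduleEquiv.symm) (e₃ := ULift.moduleEquiv.symm) (f₁₂ := f) (f₂₃ := g)
    (g₁₂ := f') (g₂₃ := g') rfl rfl, key]
  refine Function.Exact.iff_of_ladder_linearEquiv (e₁ := uliftTensor ρ₁ l)
    (e₂ := uliftTensor ρ₂ l) (e₃ := uliftTensor ρ₃ l) ?_ ?_ <;> exact hom_ext fun _ _ => rfl

end

section

universe a₁ a₂ c b

variable {k : Type u} [CommRing k] {B : Type b} [Ring B] [Algebra k B]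
variable {N : Type*} [AddCommGroup N] [Module k N] [Module B N] [IsScalarTower k B N]

/-- Injectivity is exactness of 0 → M₁ → M₂, with `PUnit` as the zero module. -/
lemma injective_iff (hN : LeftFaithfullyFlat.{max a₁ a₂ c} k B N) {l : B → Module.End k N}
    (hl : ∀ b n, l b n = b • n) {M₁ : Type a₁} {M₂ : Type a₂}
    [AddCommGroup M₁] [AddCommGroup M₂]
    [Module k M₁] [Module k M₂] {ρ₁ : B → Module.End k M₁} {ρ₂ : B → Module.End k M₂}
    (h₁ : IsRightAct ρ₁) (h₂ : IsRightAct ρ₂)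
    (f : M₁ →ₗ[k] M₂) (hf : ∀ b m, f (ρ₁ b m) = ρ₂ b (f m)) :
    Function.Injective f ↔ Function.Injective (mapLeft l f hf) := by
  have h₀ : IsRightAct (fun _ : B => (0 : Module.End k PUnit.{1})) :=
    ⟨Subsingleton.elim _ _, fun _ _ => Subsingleton.elim _ _, fun _ _ => Subsingleton.elim _ _,
      fun _ _ => Subsingleton.elim _ _⟩
  have key := exact_iff.{u, 0, a₁, a₂, c} hN hl h₀ h₁ h₂ (0 : PUnit →ₗ[k] M₁) f
    (fun b m => by simp) hf
  have h : mapLeft l (0 : PUnit →ₗ[k] M₁) (ρ := fun _ : B => (0 : Module.End k PUnit.{1}))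
      (ρ' := ρ₁) (fun b m => by simp) = 0 :=
    hom_ext fun m n => by rw [map_proj]; simp
  rw [h] at key
  exact (LinearMap.exact_zero_iff_injective PUnit.{1} f).symm.trans
    (key.trans (LinearMap.exact_zero_iff_injective _ _))

end

end LeftFaithfullyFlat

/-! ### The Galois isomorphism and the coinvariants of W ⊗ P after base change to P. -/

namespace RightComoduleAlgebra

open Balanced

variable {k H P : Type*} [Field k] [Ring H] [HopfAlgebra k H] [Ring P] [Algebra k P]
  (δ : RightComoduleAlgebra k H P)

/-- The left action of the coinvariants on `P`. -/
abbrev baseLeft : δ.base → Module.End k P := fun b => LinearMap.mulLeft k (b : P)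

/-- The right action of the coinvariants on `A ⊗ P`. -/
abbrev baseRight (A : Type*) [AddCommGroup A] [Module k A] : δ.base → Module.End k (A ⊗[k] P) :=
  fun b => LinearMap.lTensor A (LinearMap.mulRight k (b : P))

lemma baseRight_isRightAct (A : Type*) [AddCommGroup A] [Module k A] :
    IsRightAct (δ.baseRight A) where
  map_one := by ext; simp
  map_mul b c := by ext; simp [mul_assoc]
  map_add b c := by ext; simp [mul_add, TensorProduct.tmul_add]
  map_smul a b := by ext; simp

section Galois

variable (A : Type*) [AddCommGroup A] [Module k A]

/-- The Galois map `(A ⊗ P) ⊗_B P → (A ⊗ P) ⊗ H`, `(a ⊗ q) ⊗ x ↦ a ⊗ q x₀ ⊗ x₁`. -/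
def galois : Tensor (δ.baseRight A) δ.baseLeft →ₗ[k] (A ⊗[k] P) ⊗[k] H :=
  (TensorProduct.assoc k A P H).symm.toLinearMap ∘ₗ LinearMap.lTensor A δ.can ∘ₗ
    (Balanced.assoc A _ δ.baseLeft).toLinearMap

variable {A}

lemma galois_bijective (hG : δ.IsHopfGalois) : Function.Bijective (δ.galois A) :=
  ((TensorProduct.assoc k A P H).symm.bijective.comp
    (LinearEquiv.lTensor A (LinearEquiv.ofBijective δ.can hG)).bijective).comp
      (Balanced.assoc A _ δ.baseLeft).bijective

/-- The map `(a ⊗ q) ⊗ (x ⊗ h) ↦ (a ⊗ q x) ⊗ h`. -/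
def tensorMul (A H : Type*) {k P : Type*} [Field k] [Ring P] [Algebra k P] [AddCommGroup A]
    [Module k A] [AddCommGroup H] [Module k H] :
    (A ⊗[k] P) ⊗[k] (P ⊗[k] H) →ₗ[k] (A ⊗[k] P) ⊗[k] H :=
  LinearMap.rTensor H (LinearMap.lTensor A (LinearMap.mul' k P) ∘ₗ
    (TensorProduct.assoc k A P P).toLinearMap) ∘ₗ
      (TensorProduct.assoc k (A ⊗[k] P) P H).symm.toLinearMap

@[simp]
lemma tensorMul_tmul {A H k P : Type*} [Field k] [Ring P] [Algebra k P] [AddCommGroup A]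
    [Module k A] [AddCommGroup H] [Module k H] (a : A) (q x : P) (h : H) :
    tensorMul A H ((a ⊗ₜ[k] q) ⊗ₜ[k] (x ⊗ₜ[k] h)) = (a ⊗ₜ (q * x)) ⊗ₜ h := rfl

lemma galois_proj (z : A ⊗[k] P) (x : P) :
    δ.galois A (proj _ _ (z ⊗ₜ x)) = tensorMul A H (z ⊗ₜ δ.coact x) := by
  induction z with
  | zero => simp
  | add y z hy hz => simp only [TensorProduct.add_tmul, map_add, hy, hz]
  | tmul a q =>
    have : ∀ t : P ⊗[k] H, (TensorProduct.assoc k A P H).symm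
        (a ⊗ₜ ((q ⊗ₜ[k] (1 : H)) * t)) = tensorMul A H ((a ⊗ₜ q) ⊗ₜ t) := by
      intro t
      induction t with
      | zero => simp
      | add y z hy hz => simp only [mul_add, TensorProduct.tmul_add, map_add, hy, hz]
      | tmul x h => simp
    exact this _

variable (A) in
/-- The multiplication `(A ⊗ P) ⊗_B P → A ⊗ P`, `(a ⊗ q) ⊗ x ↦ a ⊗ q x`. -/
def actMul : Tensor (δ.baseRight A) δ.baseLeft →ₗ[k] A ⊗[k] P :=
  (TensorProduct.rid k (A ⊗[k] P)).toLinearMap ∘ₗ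
    LinearMap.lTensor (A ⊗[k] P) (Coalgebra.counit (R := k) (A := H)) ∘ₗ δ.galois A

/-- The counit applied to q x₀ ⊗ x₁ gives back q x. Defining `actMul` through `galois` makes it
balanced for free and shows it as the counit part of the Galois image. -/
lemma actMul_proj (z : A ⊗[k] P) (x : P) :
    δ.actMul A (proj _ _ (z ⊗ₜ x)) = LinearMap.lTensor A (LinearMap.mulRight k x) z := by
  rw [actMul, LinearMap.comp_apply, LinearMap.comp_apply, galois_proj]
  conv_rhs => rw [← δ.coact_counit x]
  generalize δ.coact x = t
  induction z with
  | zero => simp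
  | add y z hy hz => simp only [TensorProduct.add_tmul, map_add, hy, hz]
  | tmul a q =>
    induction t with
    | zero => simp
    | add y t hy ht =>
      simp only [LinearMap.lTensor_tmul, LinearMap.mulRight_apply] at hy ht ⊢
      simp only [TensorProduct.tmul_add, map_add, mul_add, hy, ht]
    | tmul x h => simp

end Galois

section Comodule

variable {W : Type*} [AddCommGroup W] [Module k W] (γ : W →ₗ[k] W ⊗[k] H)

/-- The diagonal multiplication `(w ⊗ h) ⊗ (q ⊗ g) ↦ (w ⊗ q) ⊗ h g`. -/
def diagMul (k H W P : Type*) [Field k] [Ring H] [Algebra k H] [AddCommGroup W] [Module k W]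
    [AddCommGroup P] [Module k P] :
    (W ⊗[k] H) ⊗[k] (P ⊗[k] H) →ₗ[k] (W ⊗[k] P) ⊗[k] H :=
  LinearMap.lTensor (W ⊗[k] P) (LinearMap.mul' k H) ∘ₗ
    (TensorProduct.tensorTensorTensorComm k W H P H).toLinearMap

@[simp]
lemma diagMul_tmul (w : W) (h g : H) (q : P) :
    diagMul k H W P ((w ⊗ₜ h) ⊗ₜ (q ⊗ₜ g)) = (w ⊗ₜ q) ⊗ₜ (h * g) := rfl

/-- The diagonal coaction `w ⊗ q ↦ w₀ ⊗ q₀ ⊗ w₁ q₁` on `W ⊗ P`. -/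
def diagCoact : W ⊗[k] P →ₗ[k] (W ⊗[k] P) ⊗[k] H :=
  diagMul k H W P ∘ₗ TensorProduct.map γ δ.coact.toLinearMap

lemma coact₂_eq : δ.coact₂ = δ.diagCoact δ.coact.toLinearMap := rfl

@[simp]
lemma diagCoact_tmul (w : W) (q : P) :
    δ.diagCoact γ (w ⊗ₜ q) = diagMul k H W P (γ w ⊗ₜ δ.coact q) := rfl

lemma diagCoact_natural {W' : Type*} [AddCommGroup W'] [Module k W'] {γ : W →ₗ[k] W ⊗[k] H}
    {γ' : W' →ₗ[k] W' ⊗[k] H} (f : W →ₗ[k] W')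
    (hf : ∀ w, γ' (f w) = LinearMap.rTensor H f (γ w)) (z : W ⊗[k] P) :
    δ.diagCoact γ' (LinearMap.rTensor P f z) =
      LinearMap.rTensor H (LinearMap.rTensor P f) (δ.diagCoact γ z) := by
  induction z with
  | zero => simp
  | add y z hy hz => simp only [map_add, hy, hz]
  | tmul w q =>
    simp only [LinearMap.rTensor_tmul, diagCoact_tmul, hf]
    generalize γ w = s
    generalize δ.coact q = t
    induction s with
    | zero => simp
    | add y z hy hz => simp only [map_add, TensorProduct.add_tmul, hy, hz]
    | tmul w h =>
      induction t with
      | zero => simp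
      | add y z hy hz => simp only [map_add, TensorProduct.tmul_add, hy, hz]
      | tmul q g => simp

/-- The map `z ↦ z₀ ⊗ z₁ - z ⊗ 1` on `W ⊗ P`, whose kernel is the space of coinvariants. -/
def coinvDiff : W ⊗[k] P →ₗ[k] (W ⊗[k] H) ⊗[k] P :=
  (TensorProduct.rightComm k W P H).toLinearMap ∘ₗ
    (δ.diagCoact γ - (TensorProduct.mk k (W ⊗[k] P) H).flip 1)

lemma coinvDiff_eq_zero_iff (z : W ⊗[k] P) :
    δ.coinvDiff γ z = 0 ↔ δ.diagCoact γ z = z ⊗ₜ 1 := by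
  rw [coinvDiff, LinearMap.comp_apply, LinearEquiv.coe_coe, LinearEquiv.map_eq_zero_iff,
    LinearMap.sub_apply, sub_eq_zero]
  rfl

/-- A coinvariant b has coaction b ⊗ 1, so right multiplication by b leaves the H-factor alone. The
target of `coinvDiff` is ordered as (W ⊗ H) ⊗ P so that it is again of the form A ⊗ P, and `galois`
applies to it. -/
lemma coinvDiff_baseRight (b : δ.base) (z : W ⊗[k] P) :
    δ.coinvDiff γ (δ.baseRight W b z) = δ.baseRight (W ⊗[k] H) b (δ.coinvDiff γ z) := by
  induction z with
  | zero => simp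
  | add y z hy hz => simp only [map_add, hy, hz]
  | tmul w q =>
    simp only [coinvDiff, LinearMap.lTensor_tmul, LinearMap.mulRight_apply, LinearMap.comp_apply,
      LinearMap.sub_apply, map_sub, LinearEquiv.coe_coe, diagCoact_tmul, map_mul, coact_base]
    congr 1
    generalize γ w = s
    generalize δ.coact q = t
    induction s with
    | zero => simp
    | add y z hy hz => simp only [map_add, TensorProduct.add_tmul, hy, hz]
    | tmul w h =>
      induction t with
      | zero => simp
      | add y z hy hz => simp only [map_add, TensorProduct.tmul_add, add_mul, hy, hz]
      | tmul q g => simp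

variable (k H W P) in
/-- The map `((w ⊗ h) ⊗ a) ⊗ g ↦ ((w ⊗ a) ⊗ h g₁) ⊗ g₂`. -/
def comulTwist : ((W ⊗[k] H) ⊗[k] P) ⊗[k] H →ₗ[k] ((W ⊗[k] P) ⊗[k] H) ⊗[k] H :=
  LinearMap.rTensor H (LinearMap.lTensor (W ⊗[k] P) (LinearMap.mul' k H)) ∘ₗ
  LinearMap.rTensor H (TensorProduct.assoc k (W ⊗[k] P) H H).toLinearMap ∘ₗ
  (TensorProduct.assoc k ((W ⊗[k] P) ⊗[k] H) H H).symm.toLinearMap ∘ₗ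
  TensorProduct.map (TensorProduct.rightComm k W H P).toLinearMap (Coalgebra.comul (R := k))

variable (k H W P) in
/-- The map `((w ⊗ a) ⊗ h) ⊗ g ↦ ((w ⊗ h S(g₁)) ⊗ a) ⊗ g₂`. -/
def comulUntwist : ((W ⊗[k] P) ⊗[k] H) ⊗[k] H →ₗ[k] ((W ⊗[k] H) ⊗[k] P) ⊗[k] H :=
  LinearMap.rTensor H (TensorProduct.rightComm k W P H).toLinearMap ∘ₗ
  LinearMap.rTensor H (LinearMap.lTensor (W ⊗[k] P) (LinearMap.mul' k H)) ∘ₗ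
  LinearMap.rTensor H (TensorProduct.assoc k (W ⊗[k] P) H H).toLinearMap ∘ₗ
  (TensorProduct.assoc k ((W ⊗[k] P) ⊗[k] H) H H).symm.toLinearMap ∘ₗ
  LinearMap.lTensor ((W ⊗[k] P) ⊗[k] H)
    (LinearMap.rTensor H (HopfAlgebra.antipode k) ∘ₗ Coalgebra.comul (R := k))

lemma comulTwist_tmul (w : W) (h g : H) (a : P) :
    comulTwist k H P W (((w ⊗ₜ h) ⊗ₜ a) ⊗ₜ g) =
      TensorProduct.map (TensorProduct.mk k (W ⊗[k] P) H (w ⊗ₜ a) ∘ₗ LinearMap.mulLeft k h)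
        LinearMap.id (Coalgebra.comul (R := k) g) := by
  simp only [comulTwist, LinearMap.comp_apply, TensorProduct.map_tmul, LinearEquiv.coe_coe]
  generalize (Coalgebra.comul (R := k) g) = t
  induction t with
  | zero => simp
  | add y z hy hz => simp only [map_add, TensorProduct.tmul_add, hy, hz]
  | tmul q g => simp

lemma comulUntwist_tmul (w : W) (h g : H) (a : P) :
    comulUntwist k H P W (((w ⊗ₜ a) ⊗ₜ h) ⊗ₜ g) =
      TensorProduct.map ((TensorProduct.mk k (W ⊗[k] H) P).flip a ∘ₗ TensorProduct.mk k W H w ∘ₗ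
          LinearMap.mulLeft k h ∘ₗ HopfAlgebra.antipode k)
        LinearMap.id (Coalgebra.comul (R := k) g) := by
  simp only [comulUntwist, LinearMap.comp_apply, LinearMap.lTensor_tmul, LinearEquiv.coe_coe]
  generalize (Coalgebra.comul (R := k) g) = t
  induction t with
  | zero => simp
  | add y z hy hz => simp only [map_add, TensorProduct.tmul_add, hy, hz]
  | tmul q g => simp

/-- `comulUntwist` is a left inverse, since h g₁ S(g₂) ⊗ g₃ = h ⊗ g. -/
lemma comulTwist_injective : Function.Injective (comulTwist k H P W) := by
  refine Function.LeftInverse.injective (g := comulUntwist k H P W) fun x => ?_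
  rw [← LinearMap.comp_apply]
  refine LinearMap.congr_fun (g := LinearMap.id) ?_ x
  ext w h a g
  simp only [TensorProduct.AlgebraTensorModule.curry_apply, TensorProduct.curry_apply,
    LinearMap.coe_restrictScalars, LinearMap.comp_apply, comulTwist_tmul, LinearMap.id_apply]
  -- `F` sends (g₁ ⊗ g₂) ⊗ g₃ to ((w ⊗ h g₁ S(g₂)) ⊗ a) ⊗ g₃. Coassociativity regroups its argument
  -- so that the antipode identity applies to the first two legs.
  let F : (H ⊗[k] H) ⊗[k] H →ₗ[k] ((W ⊗[k] H) ⊗[k] P) ⊗[k] H :=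
    LinearMap.rTensor H ((TensorProduct.mk k (W ⊗[k] H) P).flip a ∘ₗ TensorProduct.mk k W H w ∘ₗ
      LinearMap.mulLeft k h ∘ₗ LinearMap.mul' k H ∘ₗ LinearMap.lTensor H (HopfAlgebra.antipode k))
  have h₁ : ∀ t : H ⊗[k] H, comulUntwist k H P W (TensorProduct.map
      (TensorProduct.mk k (W ⊗[k] P) H (w ⊗ₜ a) ∘ₗ LinearMap.mulLeft k h) LinearMap.id t) =
        F ((TensorProduct.assoc k H H H).symm
          (LinearMap.lTensor H (Coalgebra.comul (R := k)) t)) := by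
    intro t
    induction t with
    | zero => simp
    | add y z hy hz => simp only [map_add, hy, hz]
    | tmul g₁ g₂ =>
      simp only [TensorProduct.map_tmul, LinearMap.comp_apply, TensorProduct.mk_apply,
        LinearMap.mulLeft_apply, LinearMap.id_apply, comulUntwist_tmul, LinearMap.lTensor_tmul]
      generalize (Coalgebra.comul (R := k) g₂) = t
      induction t with
      | zero => simp
      | add y z hy hz => simp only [map_add, TensorProduct.tmul_add, hy, hz]
      | tmul q g => simp [F]
  rw [h₁, Coalgebra.coassoc_symm_apply]
  have h₂ : ∀ t : H ⊗[k] H, F (LinearMap.rTensor H (Coalgebra.comul (R := k)) t) =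
      ((w ⊗ₜ h) ⊗ₜ a) ⊗ₜ TensorProduct.lid k H
        (LinearMap.rTensor H (Coalgebra.counit (R := k)) t) := by
    intro t
    induction t with
    | zero => simp
    | add y z hy hz => simp only [map_add, TensorProduct.tmul_add, hy, hz]
    | tmul g₁ g₂ =>
      simp [F, HopfAlgebra.mul_antipode_lTensor_comul_apply, Algebra.algebraMap_eq_smul_one,
        TensorProduct.smul_tmul']
  rw [h₂, Coalgebra.rTensor_counit_comul]
  simp

/-- The map induced by `coinvDiff` on the balanced tensor product with `P`. -/
abbrev coinvDiffBase :
    Tensor (δ.baseRight W) δ.baseLeft →ₗ[k] Tensor (δ.baseRight (W ⊗[k] H)) δ.baseLeft :=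
  mapLeft δ.baseLeft (δ.coinvDiff γ) (δ.coinvDiff_baseRight γ)

/-- Under the Galois maps, `coinvDiff ⊗_B P` becomes the cobar differential of `W ⊗ P`. -/
lemma comulTwist_galois_coinvDiffBase (y : Tensor (δ.baseRight W) δ.baseLeft) :
    comulTwist k H P W (δ.galois (W ⊗[k] H) (δ.coinvDiffBase γ y)) =
      LinearMap.rTensor H (δ.diagCoact γ) (δ.galois W y) -
        (TensorProduct.assoc k (W ⊗[k] P) H H).symm
          (LinearMap.lTensor (W ⊗[k] P) (Coalgebra.comul (R := k)) (δ.galois W y)) := by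
  have hadd : ∀ a b c d : ((W ⊗[k] P) ⊗[k] H) ⊗[k] H, a - b + (c - d) = a + c - (b + d) :=
    fun _ _ _ _ => by abel
  obtain ⟨z, rfl⟩ := proj_surjective _ _ y
  induction z with
  | zero => simp
  | add y z hy hz => simp only [map_add, hy, hz, hadd]
  | tmul z x =>
  induction z with
  | zero => simp
  | add y z hy hz => simp only [TensorProduct.add_tmul, map_add, hy, hz, hadd]
  | tmul w q =>
    simp only [LinearMap.comp_apply, LinearMap.sub_apply, map_proj, TensorProduct.map_tmul,
      LinearMap.id_apply, galois_proj, LinearEquiv.coe_coe, coinvDiff, diagCoact_tmul, map_sub,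
      TensorProduct.sub_tmul]
    congr 1
    -- With s, t, r the coactions of w, q, x, both sides read w₀ ⊗ q₀x₀ ⊗ w₁q₁x₁ ⊗ x₂. Stating this
    -- for arbitrary s, t, r lets each be reduced to a pure tensor.
    · have h₁ : ∀ (s : W ⊗[k] H) (t r : P ⊗[k] H),
          comulTwist k H P W (tensorMul (W ⊗[k] H) H
            (TensorProduct.rightComm k W P H (diagMul k H W P (s ⊗ₜ t)) ⊗ₜ r)) =
          LinearMap.rTensor H (diagMul k H W P ∘ₗ TensorProduct.mk k _ _ s ∘ₗ
            LinearMap.mul k _ t) ((TensorProduct.assoc k P H H).symm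
              (LinearMap.lTensor P (Coalgebra.comul (R := k)) r)) := by
        intro s t r
        induction r with
        | zero => simp
        | add y z hy hz => simp only [map_add, TensorProduct.tmul_add, hy, hz]
        | tmul x f =>
          induction s with
          | zero => simp
          | add y z hy hz =>
            simp only [map_add, TensorProduct.add_tmul, hy, hz, LinearMap.add_comp,
              LinearMap.comp_add, LinearMap.rTensor_add, LinearMap.add_apply]
          | tmul w h =>
            induction t with
            | zero => simp
            | add y z hy hz =>
              simp only [map_add, TensorProduct.add_tmul, TensorProduct.tmul_add, hy, hz,
                LinearMap.comp_add, LinearMap.rTensor_add, LinearMap.add_apply]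
            | tmul q g =>
              simp only [diagMul_tmul, TensorProduct.rightComm_tmul, tensorMul_tmul,
                comulTwist_tmul, LinearMap.lTensor_tmul]
              generalize (Coalgebra.comul (R := k) f) = t
              induction t with
              | zero => simp
              | add y z hy hz => simp only [map_add, TensorProduct.tmul_add, hy, hz]
              | tmul m n => simp
      rw [h₁, ← δ.coact_coassoc, LinearEquiv.symm_apply_apply]
      generalize δ.coact x = r
      induction r with
      | zero => simp
      | add y z hy hz => simp only [map_add, TensorProduct.tmul_add, hy, hz]
      | tmul x f => simp
    · generalize δ.coact x = r
      induction r with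
      | zero => simp
      | add y z hy hz => simp only [map_add, TensorProduct.tmul_add, hy, hz]
      | tmul x f =>
        simp only [LinearMap.flip_apply, TensorProduct.mk_apply, TensorProduct.rightComm_tmul,
          tensorMul_tmul, comulTwist_tmul, LinearMap.lTensor_tmul]
        generalize (Coalgebra.comul (R := k) f) = t
        induction t with
        | zero => simp
        | add y z hy hz => simp only [map_add, TensorProduct.tmul_add, hy, hz]
        | tmul m n => simp

/-- The cobar differential of t = `galois y` vanishes, that is, coacting on the first factor of t
agrees with comultiplying its H-factor. The counit on the last leg turns the second expression into
t and the first into the coaction of (id ⊗ ε)(t), which is `actMul y`. -/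
lemma galois_eq_of_coinvDiffBase_eq_zero {y : Tensor (δ.baseRight W) δ.baseLeft}
    (hy : δ.coinvDiffBase γ y = 0) : δ.galois W y = δ.diagCoact γ (δ.actMul W y) := by
  have h := δ.comulTwist_galois_coinvDiffBase γ y
  rw [hy, map_zero, map_zero, eq_comm, sub_eq_zero] at h
  rw [actMul, LinearMap.comp_apply, LinearMap.comp_apply]
  generalize δ.galois W y = t at h
  have h₁ : ∀ t : (W ⊗[k] P) ⊗[k] H, TensorProduct.rid k _ (LinearMap.lTensor _
      (Coalgebra.counit (R := k) (A := H)) (LinearMap.rTensor H (δ.diagCoact γ) t)) =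
      δ.diagCoact γ (TensorProduct.rid k _ (LinearMap.lTensor _ Coalgebra.counit t)) := by
    intro t
    induction t with
    | zero => simp
    | add y z hy hz => simp only [map_add, hy, hz]
    | tmul x f => simp [-diagCoact_tmul]
  have h₂ : ∀ t : (W ⊗[k] P) ⊗[k] H, TensorProduct.rid k _ (LinearMap.lTensor _
      (Coalgebra.counit (R := k) (A := H)) ((TensorProduct.assoc k (W ⊗[k] P) H H).symm
          (LinearMap.lTensor (W ⊗[k] P) (Coalgebra.comul (R := k)) t))) = t := by
    intro t
    induction t with
    | zero => simp
    | add y z hy hz => simp only [map_add, hy, hz]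
    | tmul x f =>
      have h₃ : ∀ s : H ⊗[k] H, TensorProduct.rid k _ (LinearMap.lTensor _
          (Coalgebra.counit (R := k) (A := H)) ((TensorProduct.assoc k (W ⊗[k] P) H H).symm
            (x ⊗ₜ s))) = x ⊗ₜ TensorProduct.rid k _ (LinearMap.lTensor _ Coalgebra.counit s) := by
        intro s
        induction s with
        | zero => simp
        | add y z hy hz => simp only [map_add, TensorProduct.tmul_add, hy, hz]
        | tmul m n => simp
      rw [LinearMap.lTensor_tmul, h₃, Coalgebra.lTensor_counit_comul]
      simp
  rw [LinearEquiv.coe_coe, ← h₁, h, h₂]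

end Comodule

end RightComoduleAlgebra

/-! ### The algebra L of coinvariants of P ⊗ P, and the isomorphism L ⊗_B P ≅ P ⊗ P. -/

namespace RightComoduleAlgebra

open Balanced MulOpposite

section

variable {k H P : Type*} [Field k] [Ring H] [HopfAlgebra k H] [Ring P] [Algebra k P]
  (δ : RightComoduleAlgebra k H P)

@[simp]
lemma unop_tmul (p : P) (q : Pᵐᵒᵖ) : unop (k := k) (p ⊗ₜ q) = p ⊗ₜ q.unop := rfl

lemma diagCoact_tmul_one {W : Type*} [AddCommGroup W] [Module k W] (γ : W →ₗ[k] W ⊗[k] H) (w : W) :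
    δ.diagCoact γ (w ⊗ₜ 1) = LinearMap.rTensor H ((TensorProduct.mk k W P).flip 1) (γ w) := by
  rw [diagCoact_tmul, map_one, Algebra.TensorProduct.one_def]
  generalize γ w = s
  induction s with
  | zero => simp
  | add y z hy hz => simp only [map_add, TensorProduct.add_tmul, hy, hz]
  | tmul w h => simp

/-- The coaction `X ⊗ x ↦ X ⊗ x₀ ⊗ x₁` on `V ⊗_B P`. -/
def baseCoact {V : Type*} [AddCommGroup V] [Module k V] (ρ : δ.base → Module.End k V) :
    Tensor ρ δ.baseLeft →ₗ[k] Tensor ρ δ.baseLeft ⊗[k] H :=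
  lift (LinearMap.rTensor H (proj ρ δ.baseLeft) ∘ₗ (TensorProduct.assoc k V P H).symm.toLinearMap ∘ₗ
      LinearMap.lTensor V δ.coact.toLinearMap) (by
    intro b v x
    simp only [LinearMap.comp_apply, LinearMap.lTensor_tmul, AlgHom.toLinearMap_apply,
      LinearMap.mulLeft_apply, map_mul, coact_base, LinearEquiv.coe_coe]
    generalize δ.coact x = t
    induction t with
    | zero => simp
    | add y z hy hz => simp only [map_add, TensorProduct.tmul_add, mul_add, hy, hz]
    | tmul x h =>
      simpa using congrArg (· ⊗ₜ[k] h) (proj_act ρ δ.baseLeft b v x))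

lemma baseCoact_proj {V : Type*} [AddCommGroup V] [Module k V] (ρ : δ.base → Module.End k V)
    (v : V) (x : P) : δ.baseCoact ρ (proj _ _ (v ⊗ₜ x)) =
      LinearMap.rTensor H (proj ρ δ.baseLeft ∘ₗ TensorProduct.mk k V P v) (δ.coact x) := by
  rw [baseCoact, lift_proj, LinearMap.comp_apply, LinearMap.comp_apply, LinearMap.lTensor_tmul,
    AlgHom.toLinearMap_apply, LinearEquiv.coe_coe]
  generalize δ.coact x = t
  induction t with
  | zero => simp
  | add y z hy hz => simp only [map_add, TensorProduct.tmul_add, hy, hz]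
  | tmul x h => simp

/-- A `k`-algebra `L` identified with the algebra of coinvariants of `P ⊗ Pᵐᵒᵖ`, with its source
and target maps. -/
structure EhresmannSchauenburg (δ : RightComoduleAlgebra k H P) (L : Type*) [Ring L]
    [Algebra k L] where
  /-- the inclusion of `L` into `P ⊗ Pᵐᵒᵖ` -/
  val : L →ₐ[k] P ⊗[k] Pᵐᵒᵖ
  val_injective : Function.Injective val
  mem_range_val : ∀ z : P ⊗[k] Pᵐᵒᵖ, z ∈ Set.range val ↔ δ.coact₂ (unop z) = unop z ⊗ₜ 1
  /-- the source map `b ↦ b ⊗ 1` -/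
  source : δ.base →ₐ[k] L
  /-- the target map `b ↦ 1 ⊗ b` -/
  target : δ.baseᵐᵒᵖ →ₐ[k] L
  val_source : ∀ b, val (source b) = (b : P) ⊗ₜ 1
  val_target : ∀ b, val (target (op b)) = 1 ⊗ₜ op (b : P)

variable {δ} {L : Type*} [Ring L] [Algebra k L] (E : δ.EhresmannSchauenburg L)

namespace EhresmannSchauenburg

attribute [simp] val_source val_target

/-- The inclusion of `L` into `P ⊗ P`. -/
def incl : L →ₗ[k] P ⊗[k] P := unop.toLinearMap ∘ₗ E.val.toLinearMap

lemma incl_apply (X : L) : E.incl X = unop (E.val X) := rfl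

lemma incl_injective : Function.Injective E.incl :=
  unop.injective.comp E.val_injective

lemma coact₂_incl (X : L) : δ.coact₂ (E.incl X) = E.incl X ⊗ₜ 1 :=
  (E.mem_range_val _).1 ⟨X, rfl⟩

lemma exists_incl_eq {z : P ⊗[k] P} (hz : δ.coact₂ z = z ⊗ₜ 1) : ∃ X, E.incl X = z := by
  obtain ⟨X, hX⟩ := (E.mem_range_val (unop.symm z)).2 (by simpa using hz)
  exact ⟨X, by simp [incl_apply, hX]⟩

/-- The left `B`-action `b.X = s(b) X` on `L`. -/
abbrev left : δ.base → Module.End k L := fun b => LinearMap.mulLeft k (E.source b)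

/-- The right `B`-action `X.b = t(b) X` on `L`. -/
abbrev right : δ.base → Module.End k L := fun b => LinearMap.mulLeft k (E.target (op b))

lemma source_target_comm (b c : δ.base) : Commute (E.source b) (E.target (op c)) :=
  E.val_injective (by simp)

lemma right_isRightAct : IsRightAct E.right where
  map_one := by ext; simp
  map_mul b c := by ext; simp [mul_assoc]
  map_add b c := by ext; simp [add_mul]
  map_smul a b := by ext; simp

lemma incl_right (b : δ.base) (X : L) :
    E.incl (E.right b X) = δ.baseRight P b (E.incl X) := by
  simp only [incl_apply, LinearMap.mulLeft_apply, map_mul, val_target]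
  generalize E.val X = z
  induction z with
  | zero => simp
  | add y z hy hz => simp only [mul_add, map_add, hy, hz]
  | tmul p q => simp

lemma incl_left (b : δ.base) (X : L) :
    E.incl (E.left b X) = LinearMap.rTensor P (LinearMap.mulLeft k (b : P)) (E.incl X) := by
  simp only [incl_apply, LinearMap.mulLeft_apply, map_mul, val_source]
  generalize E.val X = z
  induction z with
  | zero => simp
  | add y z hy hz => simp only [mul_add, map_add, hy, hz]
  | tmul p q => simp

lemma exact_incl : Function.Exact E.incl (δ.coinvDiff δ.coact.toLinearMap) := by
  intro z
  rw [coinvDiff_eq_zero_iff]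
  refine ⟨fun h => E.exists_incl_eq h, ?_⟩
  rintro ⟨X, rfl⟩
  exact E.coact₂_incl X

/-- The map `L ⊗_B P → (P ⊗ P) ⊗_B P` induced by the inclusion of `L`. -/
abbrev inclBase : Tensor E.right δ.baseLeft →ₗ[k] Tensor (δ.baseRight P) δ.baseLeft :=
  mapLeft δ.baseLeft E.incl E.incl_right

/-- The map `L ⊗_B P → P ⊗ P`, `(p ⊗ q) ⊗ x ↦ p ⊗ q x`. -/
def hopfMul : Tensor E.right δ.baseLeft →ₗ[k] P ⊗[k] P := δ.actMul P ∘ₗ E.inclBase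

lemma hopfMul_proj (X : L) (x : P) :
    E.hopfMul (proj _ _ (X ⊗ₜ x)) = LinearMap.lTensor P (LinearMap.mulRight k x) (E.incl X) := by
  rw [hopfMul, LinearMap.comp_apply, map_proj, TensorProduct.map_tmul, LinearMap.id_apply,
    actMul_proj]

/-- L is killed by `coinvDiff`, so the descent lemma applies to the image of L ⊗_B P. -/
lemma galois_inclBase (n : Tensor E.right δ.baseLeft) :
    δ.galois P (E.inclBase n) = δ.coact₂ (E.hopfMul n) := by
  refine δ.galois_eq_of_coinvDiffBase_eq_zero δ.coact.toLinearMap ?_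
  suffices h : δ.coinvDiffBase δ.coact.toLinearMap ∘ₗ E.inclBase = 0 from
    LinearMap.congr_fun h n
  refine hom_ext fun X x => ?_
  rw [LinearMap.comp_apply, map_proj, map_proj, TensorProduct.map_tmul, TensorProduct.map_tmul,
    E.exact_incl.apply_apply_eq_zero]
  simp

/-- Two computations of one Galois image are compared: by descent it is the diagonal coaction of the
product, and directly it is (p ⊗ q x₀) ⊗ x₁. Thus `hopfMul` is colinear when L ⊗_B P coacts through
its factor P. -/
lemma coact₂_hopfMul (n : Tensor E.right δ.baseLeft) :
    δ.coact₂ (E.hopfMul n) = LinearMap.rTensor H E.hopfMul (δ.baseCoact E.right n) := by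
  rw [← galois_inclBase]
  suffices h : δ.galois P ∘ₗ E.inclBase = LinearMap.rTensor H E.hopfMul ∘ₗ δ.baseCoact E.right
    from LinearMap.congr_fun h n
  refine hom_ext fun X x => ?_
  rw [LinearMap.comp_apply, LinearMap.comp_apply, baseCoact_proj, map_proj, TensorProduct.map_tmul,
    LinearMap.id_apply, galois_proj]
  generalize δ.coact x = t
  induction t with
  | zero => simp
  | add y z hy hz => simp only [map_add, TensorProduct.tmul_add, hy, hz]
  | tmul x h =>
    rw [LinearMap.rTensor_tmul, LinearMap.rTensor_tmul, LinearMap.comp_apply,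
      TensorProduct.mk_apply, hopfMul_proj]
    generalize E.incl X = z
    induction z with
    | zero => simp
    | add y z hy hz => simp only [map_add, TensorProduct.add_tmul, hy, hz]
    | tmul p q => simp

/-- The right multiplication by `x` on `L ⊗_B P`. -/
def mulRightBase (x : P) : Tensor E.right δ.baseLeft →ₗ[k] Tensor E.right δ.baseLeft :=
  Balanced.map LinearMap.id (LinearMap.mulRight k x) (fun _ _ => rfl)
    (fun b y => mul_assoc (b : P) y x)

lemma mulRightBase_proj (x y : P) (X : L) :
    E.mulRightBase x (proj _ _ (X ⊗ₜ y)) = proj _ _ (X ⊗ₜ (y * x)) := rfl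

lemma hopfMul_mulRightBase (n : Tensor E.right δ.baseLeft) (x : P) :
    E.hopfMul (E.mulRightBase x n) = LinearMap.lTensor P (LinearMap.mulRight k x)
        (E.hopfMul n) := by
  suffices h : E.hopfMul ∘ₗ E.mulRightBase x =
      LinearMap.lTensor P (LinearMap.mulRight k x) ∘ₗ E.hopfMul from LinearMap.congr_fun h n
  refine hom_ext fun X y => ?_
  rw [LinearMap.comp_apply, LinearMap.comp_apply, mulRightBase_proj,
    hopfMul_proj, hopfMul_proj, ← LinearMap.lTensor_comp_apply]
  congr 2
  ext z
  simp [mul_assoc]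

end EhresmannSchauenburg

end

namespace EhresmannSchauenburg

variable {k : Type u} {H : Type v} {P : Type w} [Field k] [Ring H] [HopfAlgebra k H] [Ring P]
  [Algebra k P] {δ : RightComoduleAlgebra k H P} {L : Type w} [Ring L] [Algebra k L]
  (E : δ.EhresmannSchauenburg L)

/-- By flatness L ⊗_B P is the kernel of `coinvDiffBase`. On this kernel the Galois isomorphism is
the coaction of `hopfMul`, which gives injectivity; surjectivity comes from exhibiting the kernel
element that corresponds to p ⊗ 1. -/
lemma hopfMul_bijective (hG : δ.IsHopfGalois) (hP : LeftFaithfullyFlat.{max u v w} k δ.base P) :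
    Function.Bijective E.hopfMul := by
  have hex := (LeftFaithfullyFlat.exact_iff.{u, w, w, max v w, max u v w} hP (l := δ.baseLeft)
    (fun _ _ => rfl) E.right_isRightAct (δ.baseRight_isRightAct P)
    (δ.baseRight_isRightAct (P ⊗[k] H)) E.incl (δ.coinvDiff δ.coact.toLinearMap)
    E.incl_right (δ.coinvDiff_baseRight _)).1 E.exact_incl
  have hinj := (LeftFaithfullyFlat.injective_iff.{u, w, w, max u v w} hP (l := δ.baseLeft)
    (fun _ _ => rfl) E.right_isRightAct (δ.baseRight_isRightAct P) E.incl
    E.incl_right).1 E.incl_injective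
  constructor
  · rw [injective_iff_map_eq_zero]
    intro n hn
    refine (injective_iff_map_eq_zero _).1 hinj n ((injective_iff_map_eq_zero _).1
      (δ.galois_bijective hG).1 _ ?_)
    rw [galois_inclBase, hn, map_zero]
  · rw [← LinearMap.range_eq_top, eq_top_iff, ← TensorProduct.span_tmul_eq_top,
      Submodule.span_le]
    rintro _ ⟨p, x, rfl⟩
    -- A preimage of p ⊗ 1 must have Galois image equal to the diagonal coaction of p ⊗ 1, namely p₀
    -- ⊗ 1 ⊗ p₁. This determines `y`, and its differential vanishes by coassociativity of the
    -- coaction.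
    obtain ⟨y, hy⟩ := (δ.galois_bijective hG).2
      (LinearMap.rTensor H ((TensorProduct.mk k P P).flip 1) (δ.coact p))
    have h₀ : δ.coinvDiffBase δ.coact.toLinearMap y = 0 := by
      refine (injective_iff_map_eq_zero _).1 (δ.galois_bijective hG).1 _
        ((injective_iff_map_eq_zero _).1 comulTwist_injective _ ?_)
      rw [comulTwist_galois_coinvDiffBase, hy, sub_eq_zero, ← LinearMap.comp_apply,
        ← LinearMap.rTensor_comp]
      have h₁ : δ.diagCoact δ.coact.toLinearMap ∘ₗ (TensorProduct.mk k P P).flip 1 =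
          LinearMap.rTensor H ((TensorProduct.mk k P P).flip 1) ∘ₗ δ.coact.toLinearMap := by
        ext q
        exact δ.diagCoact_tmul_one _ q
      have h₂ : ∀ t : P ⊗[k] H, (TensorProduct.assoc k (P ⊗[k] P) H H).symm
          (LinearMap.lTensor (P ⊗[k] P) (Coalgebra.comul (R := k))
            (LinearMap.rTensor H ((TensorProduct.mk k P P).flip 1) t)) =
          LinearMap.rTensor H (LinearMap.rTensor H ((TensorProduct.mk k P P).flip 1))
            ((TensorProduct.assoc k P H H).symm
              (LinearMap.lTensor P (Coalgebra.comul (R := k)) t)) := by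
        intro t
        induction t with
        | zero => simp
        | add y z hy hz => simp only [map_add, hy, hz]
        | tmul q h =>
          simp only [LinearMap.rTensor_tmul, LinearMap.lTensor_tmul]
          generalize (Coalgebra.comul (R := k) h) = t
          induction t with
          | zero => simp
          | add y z hy hz => simp only [map_add, TensorProduct.tmul_add, hy, hz]
          | tmul g h => simp
      rw [h₁, h₂, ← δ.coact_coassoc, LinearEquiv.symm_apply_apply, LinearMap.rTensor_comp,
        LinearMap.comp_apply]
    obtain ⟨n, rfl⟩ := (hex y).1 h₀
    have hn : E.hopfMul n = p ⊗ₜ 1 := by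
      rw [hopfMul, LinearMap.comp_apply, actMul, LinearMap.comp_apply, LinearMap.comp_apply, hy]
      conv_rhs => rw [← δ.coact_counit p]
      generalize δ.coact p = t
      induction t with
      | zero => simp
      | add y z hy hz => simp only [map_add, TensorProduct.add_tmul, hy, hz]
      | tmul q h => simp [TensorProduct.smul_tmul']
    -- `hopfMul` commutes with right multiplication by x, so p ⊗ x is reached from p ⊗ 1.
    exact ⟨_, (E.hopfMul_mulRightBase n x).trans (by simp [hn])⟩

/-- The isomorphism `L ⊗_B P ≃ P ⊗ P`, `(p ⊗ q) ⊗ x ↦ p ⊗ q x`. -/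
def hopfMulEquiv (hG : δ.IsHopfGalois) (hP : LeftFaithfullyFlat.{max u v w} k δ.base P) :
    Tensor E.right δ.baseLeft ≃ₗ[k] P ⊗[k] P :=
  LinearEquiv.ofBijective E.hopfMul (E.hopfMul_bijective hG hP)

end EhresmannSchauenburg

end RightComoduleAlgebra

/-! ### V ⊗_B L as the coinvariants of (V ⊗_B P) ⊗ P. -/

namespace RightComoduleAlgebra.EhresmannSchauenburg

open Balanced MulOpposite

section

variable {k H P : Type*} [Field k] [Ring H] [HopfAlgebra k H] [Ring P] [Algebra k P]
  {δ : RightComoduleAlgebra k H P} {L : Type*} [Ring L] [Algebra k L]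
  (E : δ.EhresmannSchauenburg L) {V : Type*} [AddCommGroup V] [Module k V]
  (ρ : δ.base → Module.End k V)

/-- The right `B`-action on `V ⊗_B L` given by the target map. -/
def tensorRight : δ.base → Module.End k (Tensor ρ E.left) :=
  fun b => Balanced.map LinearMap.id (E.right b) (fun _ _ => rfl) (fun c X => by
    simp only [LinearMap.mulLeft_apply, ← mul_assoc, (E.source_target_comm c b).eq])

lemma tensorRight_proj (b : δ.base) (v : V) (X : L) :
    E.tensorRight ρ b (proj _ _ (v ⊗ₜ X)) = proj _ _ (v ⊗ₜ (E.target (op b) * X)) := rfl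

lemma tensorRight_isRightAct : IsRightAct (E.tensorRight ρ) where
  map_one := hom_ext fun v X => by
    rw [tensorRight_proj, op_one, map_one, one_mul, Module.End.one_apply]
  map_mul b c := hom_ext fun v X => by
    rw [Module.End.mul_apply, tensorRight_proj, tensorRight_proj, tensorRight_proj, op_mul,
      map_mul, mul_assoc]
  map_add b c := hom_ext fun v X => by
    rw [LinearMap.add_apply, tensorRight_proj, tensorRight_proj, tensorRight_proj, op_add,
      map_add, add_mul, TensorProduct.tmul_add, map_add]
  map_smul a b := hom_ext fun v X => by
    rw [LinearMap.smul_apply, tensorRight_proj, tensorRight_proj, op_smul, map_smul,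
      smul_mul_assoc, TensorProduct.tmul_smul, map_smul]

/-- The map `P ⊗ P → (V ⊗_B P) ⊗ P`, `p ⊗ q ↦ (v ⊗ p) ⊗ q`. -/
abbrev insert (v : V) : P ⊗[k] P →ₗ[k] Tensor ρ δ.baseLeft ⊗[k] P :=
  LinearMap.rTensor P (proj ρ δ.baseLeft ∘ₗ TensorProduct.mk k V P v)

/-- The map `V ⊗_B L → (V ⊗_B P) ⊗ P`, `v ⊗ (p ⊗ q) ↦ (v ⊗ p) ⊗ q`. -/
def tensorIncl : Tensor ρ E.left →ₗ[k] Tensor ρ δ.baseLeft ⊗[k] P :=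
  lift (LinearMap.rTensor P (proj ρ δ.baseLeft) ∘ₗ (TensorProduct.assoc k V P P).symm.toLinearMap ∘ₗ
      LinearMap.lTensor V E.incl) (by
    intro b v X
    simp only [LinearMap.comp_apply, LinearMap.lTensor_tmul, LinearEquiv.coe_coe, incl_left]
    generalize E.incl X = z
    induction z with
    | zero => simp
    | add y z hy hz => simp only [map_add, TensorProduct.tmul_add, hy, hz]
    | tmul p q => simpa using congrArg (· ⊗ₜ[k] q) (proj_act ρ δ.baseLeft b v p))

lemma tensorIncl_proj (v : V) (X : L) :
    E.tensorIncl ρ (proj _ _ (v ⊗ₜ X)) = insert ρ v (E.incl X) := by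
  rw [tensorIncl, lift_proj, LinearMap.comp_apply, LinearMap.comp_apply, LinearMap.lTensor_tmul,
    LinearEquiv.coe_coe]
  generalize E.incl X = z
  induction z with
  | zero => simp
  | add y z hy hz => simp only [map_add, TensorProduct.tmul_add, hy, hz]
  | tmul p q => simp

lemma tensorIncl_tensorRight (b : δ.base) (n : Tensor ρ E.left) :
    E.tensorIncl ρ (E.tensorRight ρ b n) = δ.baseRight _ b (E.tensorIncl ρ n) := by
  suffices h : E.tensorIncl ρ ∘ₗ E.tensorRight ρ b = δ.baseRight _ b ∘ₗ E.tensorIncl ρ from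
    LinearMap.congr_fun h n
  refine hom_ext fun v X => ?_
  rw [LinearMap.comp_apply, LinearMap.comp_apply, tensorRight_proj, tensorIncl_proj,
    tensorIncl_proj]
  have h := E.incl_right b X
  rw [LinearMap.mulLeft_apply] at h
  rw [h]
  generalize E.incl X = z
  induction z with
  | zero => simp
  | add y z hy hz => simp only [map_add, hy, hz]
  | tmul p q => simp

lemma diagCoact_insert (v : V) (z : P ⊗[k] P) :
    δ.diagCoact (δ.baseCoact ρ) (insert ρ v z) =
      LinearMap.rTensor H (insert ρ v) (δ.coact₂ z) :=
  δ.diagCoact_natural (γ := δ.coact.toLinearMap) (proj ρ δ.baseLeft ∘ₗ TensorProduct.mk k V P v)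
    (fun w => δ.baseCoact_proj ρ v w) z

lemma diagCoact_tensorIncl (n : Tensor ρ E.left) :
    δ.diagCoact (δ.baseCoact ρ) (E.tensorIncl ρ n) = E.tensorIncl ρ n ⊗ₜ 1 := by
  obtain ⟨z, rfl⟩ := proj_surjective _ _ n
  induction z with
  | zero => simp only [map_zero, TensorProduct.zero_tmul]
  | add y z hy hz => simp only [map_add, TensorProduct.add_tmul, hy, hz]
  | tmul v X =>
    rw [tensorIncl_proj, diagCoact_insert, coact₂_incl]
    rfl

/-- The map `(V ⊗_B L) ⊗_B P → ((V ⊗_B P) ⊗ P) ⊗_B P` induced by `tensorIncl`. -/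
abbrev tensorInclBase : Tensor (E.tensorRight ρ) δ.baseLeft →ₗ[k]
    Tensor (δ.baseRight (Tensor ρ δ.baseLeft)) δ.baseLeft :=
  mapLeft δ.baseLeft (E.tensorIncl ρ) (E.tensorIncl_tensorRight ρ)

/-- The map `(V ⊗_B L) ⊗_B P → (V ⊗_B P) ⊗ P`, `(v ⊗ (p ⊗ q)) ⊗ x ↦ (v ⊗ p) ⊗ q x`. -/
def tensorHopfMul : Tensor (E.tensorRight ρ) δ.baseLeft →ₗ[k] Tensor ρ δ.baseLeft ⊗[k] P :=
  δ.actMul _ ∘ₗ E.tensorInclBase ρ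

/-- The map `V ⊗ (L ⊗_B P) → (V ⊗_B L) ⊗_B P`. -/
def tensorAssoc : V ⊗[k] Tensor E.right δ.baseLeft →ₗ[k] Tensor (E.tensorRight ρ) δ.baseLeft :=
  mapLeft δ.baseLeft (proj ρ E.left) (by
    intro b z
    suffices h : proj ρ E.left ∘ₗ LinearMap.lTensor V (E.right b) =
        E.tensorRight ρ b ∘ₗ proj ρ E.left from LinearMap.congr_fun h z
    exact TensorProduct.ext' fun _ _ => rfl) ∘ₗ
  (Balanced.assoc V E.right δ.baseLeft).symm.toLinearMap

lemma tensorAssoc_tmul (v : V) (X : L) (x : P) :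
    E.tensorAssoc ρ (v ⊗ₜ proj _ _ (X ⊗ₜ x)) = proj _ _ (proj ρ E.left (v ⊗ₜ X) ⊗ₜ x) := rfl

lemma tensorHopfMul_proj (v : V) (X : L) (x : P) :
    E.tensorHopfMul ρ (proj _ _ (proj ρ E.left (v ⊗ₜ X) ⊗ₜ x)) =
      insert ρ v (E.hopfMul (proj _ _ (X ⊗ₜ x))) := by
  rw [tensorHopfMul, LinearMap.comp_apply, map_proj, TensorProduct.map_tmul, tensorIncl_proj,
    actMul_proj, hopfMul_proj, LinearMap.id_apply]
  generalize E.incl X = z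
  induction z with
  | zero => simp
  | add y z hy hz => simp only [map_add, hy, hz]
  | tmul p q => simp

lemma tensorHopfMul_tensorAssoc (v : V) (n : Tensor E.right δ.baseLeft) :
    E.tensorHopfMul ρ (E.tensorAssoc ρ (v ⊗ₜ n)) = insert ρ v (E.hopfMul n) := by
  suffices h : E.tensorHopfMul ρ ∘ₗ E.tensorAssoc ρ ∘ₗ TensorProduct.mk k _ _ v =
      insert ρ v ∘ₗ E.hopfMul from LinearMap.congr_fun h n
  exact hom_ext fun X x => E.tensorHopfMul_proj ρ v X x

/-- The left `B`-action on `L ⊗_B P`. -/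
def leftBase (b : δ.base) : Tensor E.right δ.baseLeft →ₗ[k] Tensor E.right δ.baseLeft :=
  mapLeft δ.baseLeft (E.left b) (fun c X => by
    simp only [LinearMap.mulLeft_apply, ← mul_assoc, (E.source_target_comm b c).eq])

lemma leftBase_proj (b : δ.base) (X : L) (x : P) :
    E.leftBase b (proj _ _ (X ⊗ₜ x)) = proj _ _ ((E.source b * X) ⊗ₜ x) := rfl

/-- Left B-linearity of `hopfMul` passes to its inverse, which can then be applied inside V ⊗_B -;
this makes `tensorHopfMulInv` well defined. -/
lemma hopfMul_leftBase (b : δ.base) (n : Tensor E.right δ.baseLeft) :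
    E.hopfMul (E.leftBase b n) =
      LinearMap.rTensor P (LinearMap.mulLeft k (b : P)) (E.hopfMul n) := by
  suffices h : E.hopfMul ∘ₗ E.leftBase b =
      LinearMap.rTensor P (LinearMap.mulLeft k (b : P)) ∘ₗ E.hopfMul from LinearMap.congr_fun h n
  refine hom_ext fun X x => ?_
  rw [LinearMap.comp_apply, LinearMap.comp_apply, leftBase_proj, hopfMul_proj, hopfMul_proj]
  have h := E.incl_left b X
  rw [LinearMap.mulLeft_apply] at h
  rw [h]
  generalize E.incl X = z
  induction z with
  | zero => simp
  | add y z hy hz => simp only [map_add, hy, hz]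
  | tmul p q => simp

lemma tensorAssoc_leftBase (b : δ.base) (v : V) (n : Tensor E.right δ.baseLeft) :
    E.tensorAssoc ρ (v ⊗ₜ E.leftBase b n) = E.tensorAssoc ρ (ρ b v ⊗ₜ n) := by
  suffices h : E.tensorAssoc ρ ∘ₗ TensorProduct.mk k _ _ v ∘ₗ E.leftBase b =
      E.tensorAssoc ρ ∘ₗ TensorProduct.mk k _ _ (ρ b v) from LinearMap.congr_fun h n
  refine hom_ext fun X x => ?_
  simp only [LinearMap.comp_apply, TensorProduct.mk_apply, leftBase_proj, tensorAssoc_tmul]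
  have h := proj_act ρ E.left b v X
  rw [LinearMap.mulLeft_apply] at h
  rw [h]

end

variable {k : Type u} {H : Type v} {P : Type w} [Field k] [Ring H] [HopfAlgebra k H] [Ring P]
  [Algebra k P] {δ : RightComoduleAlgebra k H P} {L : Type w} [Ring L] [Algebra k L]
  (E : δ.EhresmannSchauenburg L)

section

variable {V : Type*} [AddCommGroup V] [Module k V] (ρ : δ.base → Module.End k V)

/-- The inverse of `tensorHopfMul`. -/
def tensorHopfMulInv (hG : δ.IsHopfGalois) (hP : LeftFaithfullyFlat.{max u v w} k δ.base P) :
    Tensor ρ δ.baseLeft ⊗[k] P →ₗ[k] Tensor (E.tensorRight ρ) δ.baseLeft :=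
  TensorProduct.lift (lift (TensorProduct.curry (E.tensorAssoc ρ ∘ₗ
      LinearMap.lTensor V (E.hopfMulEquiv hG hP).symm.toLinearMap ∘ₗ
        (TensorProduct.assoc k V P P).toLinearMap)) (by
    intro b v p
    ext x
    simp only [TensorProduct.curry_apply, LinearMap.comp_apply, LinearEquiv.coe_coe,
      TensorProduct.assoc_tmul, LinearMap.lTensor_tmul]
    rw [← tensorAssoc_leftBase]
    congr 2
    refine (E.hopfMulEquiv hG hP).injective ?_
    rw [LinearEquiv.apply_symm_apply]
    refine (E.hopfMul_leftBase b _).trans ?_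
    change LinearMap.rTensor P _ (E.hopfMulEquiv hG hP ((E.hopfMulEquiv hG hP).symm _)) = _
    rw [LinearEquiv.apply_symm_apply]
    simp))

lemma tensorHopfMulInv_insert (hG : δ.IsHopfGalois)
    (hP : LeftFaithfullyFlat.{max u v w} k δ.base P) (v : V) (z : P ⊗[k] P) :
    E.tensorHopfMulInv ρ hG hP (insert ρ v z) =
      E.tensorAssoc ρ (v ⊗ₜ (E.hopfMulEquiv hG hP).symm z) := by
  induction z with
  | zero => simp
  | add y z hy hz => simp only [map_add, TensorProduct.tmul_add, hy, hz]
  | tmul p q => rfl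

/-- The chain (V ⊗_B L) ⊗_B P = V ⊗_B (L ⊗_B P) ≅ V ⊗_B (P ⊗ P) = (V ⊗_B P) ⊗ P, with `hopfMul` in
the middle. No flatness of V enters. -/
lemma tensorHopfMul_bijective (hG : δ.IsHopfGalois)
    (hP : LeftFaithfullyFlat.{max u v w} k δ.base P) :
    Function.Bijective (E.tensorHopfMul ρ) := by
  refine Function.bijective_iff_has_inverse.2 ⟨E.tensorHopfMulInv ρ hG hP, fun n => ?_, fun z => ?_⟩
  · suffices h : E.tensorHopfMulInv ρ hG hP ∘ₗ E.tensorHopfMul ρ = LinearMap.id from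
      LinearMap.congr_fun h n
    refine hom_ext fun n x => ?_
    obtain ⟨n, rfl⟩ := proj_surjective _ _ n
    induction n with
    | zero => simp
    | add y z hy hz => simp only [map_add, TensorProduct.add_tmul, hy, hz]
    | tmul v X =>
      rw [LinearMap.comp_apply, tensorHopfMul_proj, tensorHopfMulInv_insert]
      change E.tensorAssoc ρ (v ⊗ₜ (E.hopfMulEquiv hG hP).symm (E.hopfMulEquiv hG hP _)) = _
      rw [LinearEquiv.symm_apply_apply]
      rfl
  · induction z with
    | zero => simp
    | add y z hy hz => simp only [map_add, hy, hz]
    | tmul z x =>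
      obtain ⟨z, rfl⟩ := proj_surjective _ _ z
      induction z with
      | zero => simp
      | add y z hy hz => simp only [map_add, TensorProduct.add_tmul, hy, hz]
      | tmul v p =>
        have h := E.tensorHopfMulInv_insert ρ hG hP v (p ⊗ₜ x)
        have h' := E.tensorHopfMul_tensorAssoc ρ v ((E.hopfMulEquiv hG hP).symm (p ⊗ₜ x))
        rw [← h] at h'
        refine h'.trans ?_
        change insert ρ v (E.hopfMulEquiv hG hP _) = _
        rw [LinearEquiv.apply_symm_apply]
        rfl

end

section

variable {V : Type w} [AddCommGroup V] [Module k V] (ρ : δ.base → Module.End k V)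

/-- After - ⊗_B P the map becomes the first factor of the bijection `tensorHopfMul`, hence
injective; faithful flatness reflects this. -/
lemma tensorIncl_injective (hG : δ.IsHopfGalois)
    (hP : LeftFaithfullyFlat.{max u v w} k δ.base P) :
    Function.Injective (E.tensorIncl ρ) := by
  refine (LeftFaithfullyFlat.injective_iff.{u, w, w, max u v w} hP (l := δ.baseLeft)
    (fun _ _ => rfl) (E.tensorRight_isRightAct ρ) (δ.baseRight_isRightAct _) (E.tensorIncl ρ)
    (E.tensorIncl_tensorRight ρ)).2 ?_
  have h := (E.tensorHopfMul_bijective ρ hG hP).1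
  rw [tensorHopfMul, LinearMap.coe_comp] at h
  exact h.of_comp

/-- Exactness is checked after - ⊗_B P. There, elements of the kernel of `coinvDiffBase` are
determined by their image under `actMul`, and `tensorHopfMul` makes every such image come from (V
⊗_B L) ⊗_B P. -/
lemma exact_tensorIncl (hG : δ.IsHopfGalois) (hP : LeftFaithfullyFlat.{max u v w} k δ.base P) :
    Function.Exact (E.tensorIncl ρ) (δ.coinvDiff (δ.baseCoact ρ)) := by
  have h₀ : ∀ n, δ.coinvDiff (δ.baseCoact ρ) (E.tensorIncl ρ n) = 0 := fun n =>
    (δ.coinvDiff_eq_zero_iff _ _).2 (E.diagCoact_tensorIncl ρ n)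
  have h₁ : ∀ n, δ.coinvDiffBase (δ.baseCoact ρ) (E.tensorInclBase ρ n) = 0 := by
    intro n
    suffices h : δ.coinvDiffBase (δ.baseCoact ρ) ∘ₗ E.tensorInclBase ρ = 0 from
      LinearMap.congr_fun h n
    refine hom_ext fun n x => ?_
    rw [LinearMap.comp_apply, map_proj, map_proj, TensorProduct.map_tmul, TensorProduct.map_tmul,
      h₀]
    simp
  refine (LeftFaithfullyFlat.exact_iff.{u, w, w, max v w, max u v w} hP (l := δ.baseLeft)
    (fun _ _ => rfl) (E.tensorRight_isRightAct ρ) (δ.baseRight_isRightAct _)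
    (δ.baseRight_isRightAct _) (E.tensorIncl ρ) (δ.coinvDiff (δ.baseCoact ρ))
    (E.tensorIncl_tensorRight ρ) (δ.coinvDiff_baseRight _)).2 ?_
  refine fun y => ⟨fun hy => ?_, ?_⟩
  · obtain ⟨n, hn⟩ := (E.tensorHopfMul_bijective ρ hG hP).2 (δ.actMul _ y)
    refine ⟨n, (δ.galois_bijective hG).1 ?_⟩
    rw [δ.galois_eq_of_coinvDiffBase_eq_zero _ hy, δ.galois_eq_of_coinvDiffBase_eq_zero _ (h₁ n),
      ← hn]
    rfl
  · rintro ⟨n, rfl⟩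
    exact h₁ n

lemma exists_tensorIncl_eq (hG : δ.IsHopfGalois)
    (hP : LeftFaithfullyFlat.{max u v w} k δ.base P) {z : Tensor ρ δ.baseLeft ⊗[k] P}
    (hz : δ.diagCoact (δ.baseCoact ρ) z = z ⊗ₜ 1) : ∃ n, E.tensorIncl ρ n = z :=
  (E.exact_tensorIncl ρ hG hP z).1 ((δ.coinvDiff_eq_zero_iff _ _).2 hz)

end

end RightComoduleAlgebra.EhresmannSchauenburg

/-! ### L ⊗_B L inside P ⊗ P ⊗ P: the coproduct and its coassociativity. -/

namespace RightComoduleAlgebra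

open Balanced MulOpposite

section

variable {k P : Type*} [Field k] [Ring P] [Algebra k P]

/-- The map `p ⊗ q ↦ (p ⊗ 1) ⊗ q`. -/
def insertOne (k P : Type*) [Field k] [Ring P] [Algebra k P] :
    P ⊗[k] P →ₗ[k] (P ⊗[k] P) ⊗[k] P :=
  LinearMap.rTensor P ((TensorProduct.mk k P P).flip 1)

@[simp]
lemma insertOne_tmul (p q : P) : insertOne k P (p ⊗ₜ q) = (p ⊗ₜ 1) ⊗ₜ q := rfl

/-- For `x = p ⊗ q`, the map `(a ⊗ m) ⊗ b ↦ (p a ⊗ m) ⊗ b q`. -/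
def outerMul (x : P ⊗[k] Pᵐᵒᵖ) : (P ⊗[k] P) ⊗[k] P →ₗ[k] (P ⊗[k] P) ⊗[k] P :=
  (TensorProduct.rightComm k P P P).toLinearMap ∘ₗ
    LinearMap.rTensor P (unop.toLinearMap ∘ₗ LinearMap.mulLeft k x ∘ₗ unop.symm.toLinearMap) ∘ₗ
      (TensorProduct.rightComm k P P P).toLinearMap

lemma outerMul_tmul (x : P ⊗[k] Pᵐᵒᵖ) (a m b : P) :
    outerMul x ((a ⊗ₜ m) ⊗ₜ b) =
      TensorProduct.rightComm k P P P (unop (x * (a ⊗ₜ op b)) ⊗ₜ m) := rfl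

lemma outerMul_insertOne (x y : P ⊗[k] Pᵐᵒᵖ) :
    outerMul x (insertOne k P (unop y)) = insertOne k P (unop (x * y)) := by
  have h : ∀ z, insertOne k P z = TensorProduct.rightComm k P P P (z ⊗ₜ 1) := by
    intro z
    induction z with
    | zero => simp
    | add y z hy hz => simp only [map_add, TensorProduct.add_tmul, hy, hz]
    | tmul p q => simp
  have h' : ∀ z, TensorProduct.rightComm k P P P (TensorProduct.rightComm k P P P z) = z :=
    (TensorProduct.rightComm k P P P).symm_apply_apply
  rw [h, h, outerMul, LinearMap.comp_apply, LinearMap.comp_apply, LinearEquiv.coe_coe, h']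
  simp

/-- For α = p ⊗ q and β = r ⊗ u, the map is (a ⊗ m) ⊗ c ↦ (a p ⊗ q m r) ⊗ u c. Right multiplication
on L ⊗ L thus depends on the left factor only through its image in P ⊗ P ⊗ P, although that image
has forgotten how the middle leg was factored. -/
lemma exists_tensorMul_mul (α β : P ⊗[k] Pᵐᵒᵖ) :
    ∃ Φ : (P ⊗[k] P) ⊗[k] P →ₗ[k] (P ⊗[k] P) ⊗[k] P,
      (∀ x y : P ⊗[k] Pᵐᵒᵖ, Φ (tensorMul P P (unop x ⊗ₜ unop y)) =
        tensorMul P P (unop (x * α) ⊗ₜ unop (y * β))) ∧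
      ∀ x : P ⊗[k] Pᵐᵒᵖ, Φ (insertOne k P (unop x)) =
        outerMul x (tensorMul P P (unop α ⊗ₜ unop β)) := by
  induction α with
  | zero => exact ⟨0, by simp, by simp⟩
  | add α₁ α₂ h₁ h₂ =>
    obtain ⟨Φ₁, h₁, h₁'⟩ := h₁
    obtain ⟨Φ₂, h₂, h₂'⟩ := h₂
    exact ⟨Φ₁ + Φ₂, by simp [mul_add, TensorProduct.add_tmul, h₁, h₂],
      by simp [TensorProduct.add_tmul, h₁', h₂']⟩
  | tmul p q =>
    induction β with
    | zero => exact ⟨0, by simp, by simp⟩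
    | add α₁ α₂ h₁ h₂ =>
      obtain ⟨Φ₁, h₁, h₁'⟩ := h₁
      obtain ⟨Φ₂, h₂, h₂'⟩ := h₂
      exact ⟨Φ₁ + Φ₂, by simp [mul_add, TensorProduct.tmul_add, h₁, h₂],
        by simp [TensorProduct.tmul_add, h₁', h₂']⟩
    | tmul r u =>
      refine ⟨TensorProduct.map (TensorProduct.map (LinearMap.mulRight k p)
        (LinearMap.mulLeft k q.unop ∘ₗ LinearMap.mulRight k r)) (LinearMap.mulLeft k u.unop),
        fun x y => ?_, fun x => ?_⟩
      · induction x with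
        | zero => simp
        | add x₁ x₂ h₁ h₂ => simp only [add_mul, map_add, TensorProduct.add_tmul, h₁, h₂]
        | tmul a b =>
          induction y with
          | zero => simp
          | add x₁ x₂ h₁ h₂ => simp only [add_mul, map_add, TensorProduct.tmul_add, h₁, h₂]
          | tmul c d => simp [unop, mul_assoc]
      · rw [unop_tmul, unop_tmul, tensorMul_tmul, outerMul_tmul]
        induction x with
        | zero => simp
        | add x₁ x₂ h₁ h₂ => simp only [add_mul, map_add, TensorProduct.add_tmul, h₁, h₂]
        | tmul a b => simp

end

namespace EhresmannSchauenburg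

section

variable {k H P : Type*} [Field k] [Ring H] [HopfAlgebra k H] [Ring P] [Algebra k P]
  {δ : RightComoduleAlgebra k H P} {L : Type*} [Ring L] [Algebra k L]
  (E : δ.EhresmannSchauenburg L)

/-- The map `L ⊗_B L → (P ⊗ P) ⊗ P`, `(p ⊗ q) ⊗ (r ⊗ u) ↦ (p ⊗ q r) ⊗ u`. -/
def pairMul : Tensor E.right E.left →ₗ[k] (P ⊗[k] P) ⊗[k] P :=
  LinearMap.rTensor P E.hopfMul ∘ₗ E.tensorIncl E.right

lemma pairMul_tmul (X Y : L) :
    E.pairMul (proj _ _ (X ⊗ₜ Y)) = tensorMul P P (E.incl X ⊗ₜ E.incl Y) := by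
  rw [pairMul, LinearMap.comp_apply, tensorIncl_proj]
  generalize E.incl Y = z
  induction z with
  | zero => simp
  | add y z hy hz => simp only [map_add, TensorProduct.tmul_add, hy, hz]
  | tmul p q =>
    rw [LinearMap.rTensor_tmul, LinearMap.rTensor_tmul, LinearMap.comp_apply,
      TensorProduct.mk_apply, hopfMul_proj]
    generalize E.incl X = z
    induction z with
    | zero => simp
    | add y z hy hz => simp only [map_add, TensorProduct.add_tmul, hy, hz]
    | tmul p q => simp

lemma pairMul_proj (z : L ⊗[k] L) :
    E.pairMul (proj _ _ z) = tensorMul P P (TensorProduct.map E.incl E.incl z) := by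
  suffices h : E.pairMul ∘ₗ proj _ _ = tensorMul P P ∘ₗ TensorProduct.map E.incl E.incl from
    LinearMap.congr_fun h z
  exact TensorProduct.ext' fun X Y => E.pairMul_tmul X Y

/-- The hypothesis says that z represents Δ(X); then multiplying by z acts only on the two outer
legs. Multiplicativity of Δ, the Takeuchi condition and the left sides of the antipode axioms all
rest on this. -/
lemma pairMul_proj_mul (X : L) (z w : L ⊗[k] L)
    (hz : E.pairMul (proj _ _ z) = insertOne k P (E.incl X)) :
    E.pairMul (proj _ _ (z * w)) = outerMul (E.val X) (E.pairMul (proj _ _ w)) := by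
  induction w with
  | zero => rw [mul_zero, map_zero, map_zero, map_zero]
  | add y z hy hz => simp only [mul_add, map_add, hy, hz]
  | tmul Y₁ Y₂ =>
    obtain ⟨Φ, h₁, h₂⟩ := exists_tensorMul_mul (E.val Y₁) (E.val Y₂)
    rw [pairMul_tmul, incl_apply, incl_apply, ← h₂, ← incl_apply, ← hz]
    clear hz
    induction z with
    | zero => rw [zero_mul, map_zero, map_zero, map_zero]
    | add y z hy hz => simp only [add_mul, map_add, hy, hz]
    | tmul X₁ X₂ =>
      rw [Algebra.TensorProduct.tmul_mul_tmul, pairMul_tmul, pairMul_tmul, incl_apply,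
        incl_apply, incl_apply, incl_apply, h₁, map_mul E.val, map_mul E.val]

/-- The map `L ⊗_B L ⊗_B L → (L ⊗_B L) ⊗_B L`. -/
def tripleToPair : Tensor₃ E.right E.left E.right E.left →ₗ[k]
    Tensor (E.tensorRight E.right) E.left :=
  (rel₃ E.right E.left E.right E.left).liftQ
    (proj (E.tensorRight E.right) E.left ∘ₗ LinearMap.rTensor L (proj E.right E.left) ∘ₗ
      (TensorProduct.assoc k L L L).symm.toLinearMap) (by
    refine Submodule.span_le.2 ?_
    rintro _ (⟨b, m, n, o, rfl⟩ | ⟨b, m, n, o, rfl⟩)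
    · exact LinearMap.mem_ker.2 ((map_sub _ _ _).trans (sub_eq_zero.2
        (congrArg (fun y => proj (E.tensorRight E.right) E.left (y ⊗ₜ o))
          (proj_act E.right E.left b m n))))
    · exact LinearMap.mem_ker.2 ((map_sub _ _ _).trans (sub_eq_zero.2
        (proj_act (E.tensorRight E.right) E.left b (proj _ _ (m ⊗ₜ n)) o))))

lemma tripleToPair_fromLeft (n : Tensor E.right E.left) (o : L) :
    E.tripleToPair (fromLeft _ _ _ _ (n ⊗ₜ o)) = proj _ _ (n ⊗ₜ o) := by
  suffices h : E.tripleToPair ∘ₗ fromLeft _ _ _ _ ∘ₗ (TensorProduct.mk k _ _).flip o =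
      proj _ _ ∘ₗ (TensorProduct.mk k _ _).flip o from LinearMap.congr_fun h n
  exact hom_ext fun _ _ => rfl

lemma tripleToPair_fromRight (m n o : L) :
    E.tripleToPair (fromRight _ _ _ _ (m ⊗ₜ proj _ _ (n ⊗ₜ o))) =
      proj _ _ (proj E.right E.left (m ⊗ₜ n) ⊗ₜ o) := rfl

lemma tripleToPair_injective : Function.Injective E.tripleToPair := by
  let g : Tensor (E.tensorRight E.right) E.left →ₗ[k] Tensor₃ E.right E.left E.right E.left :=
    lift (fromLeft _ _ _ _) (by
      intro b n o
      suffices h : fromLeft E.right E.left E.right E.left ∘ₗ (TensorProduct.mk k _ _).flip o ∘ₗ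
          E.tensorRight E.right b = fromLeft _ _ _ _ ∘ₗ
            (TensorProduct.mk k _ _).flip (E.left b o) from LinearMap.congr_fun h n
      exact hom_ext fun m n =>
        (Submodule.Quotient.eq _).2 (Submodule.subset_span (Or.inr ⟨b, m, n, o, rfl⟩)))
  refine Function.LeftInverse.injective (g := g) fun x => ?_
  suffices h : g ∘ₗ E.tripleToPair = LinearMap.id from LinearMap.congr_fun h x
  refine Submodule.linearMap_qext _ ?_
  ext m n o
  rfl

/-- The map `L ⊗_B L ⊗_B L → ((P ⊗ P) ⊗ P) ⊗ P`,
`(p ⊗ q) ⊗ (r ⊗ u) ⊗ (x ⊗ y) ↦ ((p ⊗ q r) ⊗ u x) ⊗ y`. -/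
def tripleMul : Tensor₃ E.right E.left E.right E.left →ₗ[k] ((P ⊗[k] P) ⊗[k] P) ⊗[k] P :=
  LinearMap.rTensor P (LinearMap.rTensor P E.hopfMul ∘ₗ E.tensorHopfMul E.right) ∘ₗ
    E.tensorIncl (E.tensorRight E.right) ∘ₗ E.tripleToPair

lemma tensorIncl_tripleToPair_proj (n : Tensor E.right E.left) (o : L) :
    LinearMap.rTensor P (LinearMap.rTensor P E.hopfMul ∘ₗ E.tensorHopfMul E.right)
      (E.tensorIncl (E.tensorRight E.right) (proj _ _ (n ⊗ₜ o))) =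
      tensorMul (P ⊗[k] P) P (E.pairMul n ⊗ₜ E.incl o) := by
  rw [tensorIncl_proj]
  generalize E.incl o = z
  induction z with
  | zero => simp
  | add y z hy hz => simp only [map_add, TensorProduct.tmul_add, hy, hz]
  | tmul p q =>
    rw [LinearMap.rTensor_tmul, LinearMap.rTensor_tmul, LinearMap.comp_apply,
      LinearMap.comp_apply, TensorProduct.mk_apply, tensorHopfMul, LinearMap.comp_apply, map_proj,
      TensorProduct.map_tmul, actMul_proj, LinearMap.id_apply, pairMul, LinearMap.comp_apply]
    generalize E.tensorIncl E.right n = y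
    induction y with
    | zero => simp
    | add y z hy hz => simp only [map_add, TensorProduct.add_tmul, hy, hz]
    | tmul a b => simp

lemma tripleMul_fromLeft (n : Tensor E.right E.left) (o : L) :
    E.tripleMul (fromLeft _ _ _ _ (n ⊗ₜ o)) =
      tensorMul (P ⊗[k] P) P (E.pairMul n ⊗ₜ E.incl o) := by
  rw [tripleMul, LinearMap.comp_apply, LinearMap.comp_apply, tripleToPair_fromLeft,
    tensorIncl_tripleToPair_proj]

lemma tripleMul_fromRight (m : L) (n : Tensor E.right E.left) :
    E.tripleMul (fromRight _ _ _ _ (m ⊗ₜ n)) =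
      LinearMap.rTensor P (tensorMul P P ∘ₗ TensorProduct.mk k _ _ (E.incl m))
        (E.pairMul n) := by
  obtain ⟨n, rfl⟩ := proj_surjective _ _ n
  induction n with
  | zero => simp only [map_zero, TensorProduct.tmul_zero]
  | add y z hy hz => simp only [map_add, TensorProduct.tmul_add, hy, hz]
  | tmul n o =>
  rw [tripleMul, LinearMap.comp_apply, LinearMap.comp_apply, tripleToPair_fromRight,
    tensorIncl_tripleToPair_proj, pairMul_tmul, pairMul_tmul]
  generalize E.incl m = x
  generalize E.incl n = y
  generalize E.incl o = z
  induction x with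
  | zero =>
    simp only [TensorProduct.zero_tmul, map_zero, LinearMap.comp_zero, LinearMap.rTensor_zero,
      LinearMap.zero_apply]
  | add y z hy hz =>
    simp only [map_add, TensorProduct.add_tmul, hy, hz, LinearMap.comp_add, LinearMap.rTensor_add,
      LinearMap.add_apply]
  | tmul p q =>
    induction y with
    | zero => simp
    | add y z hy hz => simp only [map_add, TensorProduct.add_tmul, TensorProduct.tmul_add, hy, hz]
    | tmul r u =>
      induction z with
      | zero => simp
      | add y z hy hz => simp only [map_add, TensorProduct.tmul_add, hy, hz]
      | tmul x y => simp

/-- Applying f to the left or to the right factor inserts a 1 in the second or third place of the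
`pairMul` image. As that image is already p ⊗ 1 ⊗ q, both results are p ⊗ 1 ⊗ 1 ⊗ q. -/
lemma tripleMul_fromLeft_eq_fromRight {f : L →ₗ[k] Tensor E.right E.left}
    (hf : ∀ X, E.pairMul (f X) = insertOne k P (E.incl X)) (X : L) (z : L ⊗[k] L)
    (hz : proj _ _ z = f X) :
    E.tripleMul (fromLeft _ _ _ _ (LinearMap.rTensor L f z)) =
      E.tripleMul (fromRight _ _ _ _ (LinearMap.lTensor L f z)) := by
  have h₁ : E.tripleMul (fromLeft _ _ _ _ (LinearMap.rTensor L f z)) =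
      LinearMap.rTensor P (insertOne k P) (E.pairMul (proj _ _ z)) := by
    clear hz
    induction z with
    | zero => simp only [map_zero]
    | add y z hy hz => simp only [map_add, hy, hz]
    | tmul m o =>
      rw [LinearMap.rTensor_tmul, tripleMul_fromLeft, hf, pairMul_tmul]
      generalize E.incl m = x
      generalize E.incl o = y
      induction x with
      | zero => simp
      | add y z hy hz => simp only [map_add, TensorProduct.add_tmul, hy, hz]
      | tmul p q =>
        induction y with
        | zero => simp
        | add y z hy hz => simp only [map_add, TensorProduct.tmul_add, hy, hz]
        | tmul r u => simp
  have h₂ : E.tripleMul (fromRight _ _ _ _ (LinearMap.lTensor L f z)) =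
      LinearMap.rTensor P ((TensorProduct.mk k (P ⊗[k] P) P).flip 1)
        (E.pairMul (proj _ _ z)) := by
    clear hz h₁
    induction z with
    | zero => simp only [map_zero]
    | add y z hy hz => simp only [map_add, hy, hz]
    | tmul m o =>
      rw [LinearMap.lTensor_tmul, tripleMul_fromRight, hf, pairMul_tmul]
      generalize E.incl m = x
      generalize E.incl o = y
      induction y with
      | zero => simp
      | add y z hy hz => simp only [map_add, TensorProduct.tmul_add, hy, hz]
      | tmul r u =>
        simp only [insertOne_tmul, LinearMap.rTensor_tmul, LinearMap.comp_apply,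
          TensorProduct.mk_apply]
        induction x with
        | zero => simp
        | add y z hy hz => simp only [map_add, TensorProduct.add_tmul, hy, hz]
        | tmul p q => simp
  rw [h₁, h₂, hz, hf]
  generalize E.incl X = x
  induction x with
  | zero => simp
  | add y z hy hz => simp only [map_add, hy, hz]
  | tmul p q => simp

lemma coact_mul' (z : P ⊗[k] P) :
    δ.coact (LinearMap.mul' k P z) = LinearMap.rTensor H (LinearMap.mul' k P) (δ.coact₂ z) := by
  induction z with
  | zero => simp
  | add y z hy hz => simp only [map_add, hy, hz]
  | tmul p q =>
    rw [LinearMap.mul'_apply, map_mul, coact₂_eq, diagCoact_tmul, AlgHom.toLinearMap_apply]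
    generalize δ.coact p = s
    generalize δ.coact q = t
    induction s with
    | zero => simp
    | add y z hy hz => simp only [map_add, TensorProduct.add_tmul, add_mul, hy, hz]
    | tmul p q =>
      induction t with
      | zero => simp
      | add y z hy hz => simp only [map_add, TensorProduct.tmul_add, mul_add, hy, hz]
      | tmul r u => simp

/-- The counit `p ⊗ q ↦ p q`. -/
def counit : L →ₗ[k] δ.base :=
  (LinearMap.mul' k P ∘ₗ E.incl).codRestrict (Subalgebra.toSubmodule δ.base) (fun X => by
    refine (AlgHom.mem_equalizer _ _ _).2 ?_
    rw [LinearMap.comp_apply, coact_mul', coact₂_incl, LinearMap.rTensor_tmul]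
    rfl)

lemma coe_counit (X : L) : (E.counit X : P) = LinearMap.mul' k P (E.incl X) := rfl

lemma incl_source_mul (b : δ.base) (X : L) : E.incl (E.source b * X) =
    LinearMap.rTensor P (LinearMap.mulLeft k (b : P)) (E.incl X) := E.incl_left b X

lemma incl_target_mul (b : δ.base) (X : L) : E.incl (E.target (op b) * X) =
    LinearMap.lTensor P (LinearMap.mulRight k (b : P)) (E.incl X) := E.incl_right b X

end

variable {k : Type u} {H : Type v} {P : Type w} [Field k] [Ring H] [HopfAlgebra k H] [Ring P]
  [Algebra k P] {δ : RightComoduleAlgebra k H P} {L : Type w} [Ring L] [Algebra k L]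
  (E : δ.EhresmannSchauenburg L)

lemma pairMul_injective (hG : δ.IsHopfGalois) (hP : LeftFaithfullyFlat.{max u v w} k δ.base P) :
    Function.Injective E.pairMul :=
  ((E.hopfMulEquiv hG hP).rTensor P).injective.comp (E.tensorIncl_injective E.right hG hP)

lemma tripleMul_injective (hG : δ.IsHopfGalois)
    (hP : LeftFaithfullyFlat.{max u v w} k δ.base P) : Function.Injective E.tripleMul := by
  let e := LinearEquiv.ofBijective _ (E.tensorHopfMul_bijective E.right hG hP) ≪≫ₗ
    (E.hopfMulEquiv hG hP).rTensor P
  exact (e.rTensor P).injective.comp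
    ((E.tensorIncl_injective (E.tensorRight E.right) hG hP).comp E.tripleToPair_injective)

/-- Inserting 1 is colinear, so p ⊗ 1 ⊗ q is coinvariant. Transported along the colinear isomorphism
L ⊗_B P ≅ P ⊗ P, it becomes a coinvariant of (L ⊗_B P) ⊗ P, hence an element of L ⊗_B L. -/
lemma exists_pairMul_eq (hG : δ.IsHopfGalois) (hP : LeftFaithfullyFlat.{max u v w} k δ.base P)
    (X : L) : ∃ n, E.pairMul n = insertOne k P (E.incl X) := by
  let θ := E.hopfMulEquiv hG hP
  have hθ : ∀ z, δ.baseCoact E.right (θ.symm z) =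
      LinearMap.rTensor H θ.symm.toLinearMap (δ.coact₂ z) := by
    intro z
    obtain ⟨n, rfl⟩ := θ.surjective z
    rw [LinearEquiv.symm_apply_apply]
    refine ((θ.rTensor H).symm_apply_apply _).symm.trans ?_
    exact congrArg (θ.rTensor H).symm (E.coact₂_hopfMul n).symm
  have h₁ : δ.diagCoact δ.coact₂ (insertOne k P (E.incl X)) =
      insertOne k P (E.incl X) ⊗ₜ 1 := by
    rw [insertOne, δ.diagCoact_natural (γ := δ.coact.toLinearMap) _
      (fun q => δ.diagCoact_tmul_one _ q), ← coact₂_eq, coact₂_incl]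
    rfl
  have h₂ : δ.diagCoact (δ.baseCoact E.right)
      (LinearMap.rTensor P θ.symm.toLinearMap (insertOne k P (E.incl X))) =
      LinearMap.rTensor P θ.symm.toLinearMap (insertOne k P (E.incl X)) ⊗ₜ 1 := by
    rw [δ.diagCoact_natural (γ := δ.coact₂) θ.symm.toLinearMap hθ, h₁]
    rfl
  obtain ⟨n, hn⟩ := E.exists_tensorIncl_eq E.right hG hP h₂
  exact ⟨n, (congrArg (θ.rTensor P) hn).trans ((θ.rTensor P).apply_symm_apply _)⟩

/-- The coproduct of `L`, characterized by `pairMul (Δ (p ⊗ q)) = (p ⊗ 1) ⊗ q`. -/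
def comul (hG : δ.IsHopfGalois) (hP : LeftFaithfullyFlat.{max u v w} k δ.base P) :
    L →ₗ[k] Tensor E.right E.left :=
  (LinearEquiv.ofInjective E.pairMul (E.pairMul_injective hG hP)).symm.toLinearMap ∘ₗ
    (insertOne k P ∘ₗ E.incl).codRestrict (LinearMap.range E.pairMul)
      (fun X => LinearMap.mem_range.2 (E.exists_pairMul_eq hG hP X))

lemma pairMul_comul (hG : δ.IsHopfGalois) (hP : LeftFaithfullyFlat.{max u v w} k δ.base P)
    (X : L) : E.pairMul (E.comul hG hP X) = insertOne k P (E.incl X) :=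
  congrArg Subtype.val ((LinearEquiv.ofInjective E.pairMul
    (E.pairMul_injective hG hP)).apply_symm_apply _)

lemma pairMul_proj_of_eq (hG : δ.IsHopfGalois) (hP : LeftFaithfullyFlat.{max u v w} k δ.base P)
    {X : L} {z : L ⊗[k] L} (hz : proj _ _ z = E.comul hG hP X) :
    E.pairMul (proj _ _ z) = insertOne k P (E.incl X) := by
  rw [hz, pairMul_comul]

lemma pairMul_rightMul_comul (hG : δ.IsHopfGalois)
    (hP : LeftFaithfullyFlat.{max u v w} k δ.base P) (X : L) (w : L ⊗[k] L) :
    E.pairMul (Bialgebroid.rightMul E.source (fun b => E.target (op b)) (E.comul hG hP X) w) =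
      outerMul (E.val X) (E.pairMul (proj _ _ w)) := by
  obtain ⟨z, hz⟩ := proj_surjective _ _ (E.comul hG hP X)
  rw [← E.pairMul_proj_mul X z w (E.pairMul_proj_of_eq hG hP hz), ← hz]
  rfl

end EhresmannSchauenburg

end RightComoduleAlgebra

/-! ### The bialgebroid structure on L. -/

namespace RightComoduleAlgebra

open Balanced MulOpposite

namespace EhresmannSchauenburg

variable {k : Type u} {H : Type v} {P : Type w} [Field k] [Ring H] [HopfAlgebra k H] [Ring P]
  [Algebra k P] {δ : RightComoduleAlgebra k H P} {L : Type w} [Ring L] [Algebra k L]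
  (E : δ.EhresmannSchauenburg L)

lemma incl_one : E.incl 1 = 1 ⊗ₜ 1 := by
  rw [incl_apply, map_one, Algebra.TensorProduct.one_def, unop_tmul]
  rfl

lemma incl_source (b : δ.base) : E.incl (E.source b) = (b : P) ⊗ₜ 1 := by
  rw [incl_apply, val_source, unop_tmul]
  rfl

lemma incl_target (b : δ.base) : E.incl (E.target (op b)) = 1 ⊗ₜ (b : P) := by
  rw [incl_apply, val_target, unop_tmul]
  rfl

lemma rTensor_mul'_insertOne (x : P ⊗[k] P) :
    LinearMap.rTensor P (LinearMap.mul' k P) (insertOne k P x) = x := by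
  induction x with
  | zero => simp
  | add y z hy hz => simp only [map_add, hy, hz]
  | tmul p q => simp

lemma lTensor_mul'_insertOne (x : P ⊗[k] P) :
    LinearMap.lTensor P (LinearMap.mul' k P) (TensorProduct.assoc k P P P (insertOne k P x)) =
      x := by
  induction x with
  | zero => simp
  | add y z hy hz => simp only [map_add, hy, hz]
  | tmul p q => simp

/-- The expression in the left counit law is p ⊗ qr ⊗ u with its first two legs multiplied; on p ⊗ 1
⊗ q this returns p ⊗ q. The right law multiplies the last two legs instead. -/
lemma incl_source_counit_mul (X Y : L) : E.incl (E.source (E.counit X) * Y) =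
    LinearMap.rTensor P (LinearMap.mul' k P) (tensorMul P P (E.incl X ⊗ₜ E.incl Y)) := by
  rw [incl_source_mul, coe_counit]
  generalize E.incl X = x
  generalize E.incl Y = y
  induction y with
  | zero => simp
  | add y z hy hz => simp only [map_add, TensorProduct.tmul_add, hy, hz]
  | tmul r u =>
    rw [LinearMap.rTensor_tmul, LinearMap.mulLeft_apply]
    induction x with
    | zero => simp
    | add y z hy hz => simp only [map_add, TensorProduct.add_tmul, add_mul, hy, hz]
    | tmul p q => simp [mul_assoc]

lemma incl_target_counit_mul (X Y : L) : E.incl (E.target (op (E.counit Y)) * X) =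
    LinearMap.lTensor P (LinearMap.mul' k P) (TensorProduct.assoc k P P P
      (tensorMul P P (E.incl X ⊗ₜ E.incl Y))) := by
  rw [incl_target_mul, coe_counit]
  generalize E.incl X = x
  generalize E.incl Y = y
  induction x with
  | zero => simp
  | add y z hy hz => simp only [map_add, TensorProduct.add_tmul, hy, hz]
  | tmul r u =>
    rw [LinearMap.lTensor_tmul, LinearMap.mulRight_apply]
    induction y with
    | zero => simp
    | add y z hy hz => simp only [map_add, TensorProduct.tmul_add, mul_add, hy, hz]
    | tmul p q => simp [mul_assoc]

lemma pairMul_source_target_mul (b c : δ.base) (z : L ⊗[k] L) :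
    E.pairMul (proj _ _ ((E.source b ⊗ₜ E.target (op c)) * z)) =
      TensorProduct.map (LinearMap.rTensor P (LinearMap.mulLeft k (b : P)))
        (LinearMap.mulRight k (c : P)) (E.pairMul (proj _ _ z)) := by
  induction z with
  | zero => simp only [mul_zero, map_zero]
  | add y z hy hz => simp only [mul_add, map_add, hy, hz]
  | tmul X Y =>
    rw [Algebra.TensorProduct.tmul_mul_tmul, pairMul_tmul, pairMul_tmul, incl_source_mul,
      incl_target_mul]
    generalize E.incl X = x
    generalize E.incl Y = y
    induction x with
    | zero => simp
    | add y z hy hz => simp only [map_add, TensorProduct.add_tmul, hy, hz]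
    | tmul p q =>
      induction y with
      | zero => simp
      | add y z hy hz => simp only [map_add, TensorProduct.tmul_add, hy, hz]
      | tmul r u => simp

lemma incl_source_target_mul (b c : δ.base) (X : L) :
    E.incl (E.source b * E.target (op c) * X) =
      TensorProduct.map (LinearMap.mulLeft k (b : P)) (LinearMap.mulRight k (c : P))
        (E.incl X) := by
  rw [mul_assoc, incl_source_mul, incl_target_mul, ← LinearMap.comp_apply,
    LinearMap.rTensor_comp_lTensor]

/-- With X = p ⊗ q the counit of XY is p ε(Y) q, so it sees Y only through ε(Y). This yields both
character laws. -/
lemma mul'_incl_mul (X Y : L) : LinearMap.mul' k P (E.incl (X * Y)) =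
    LinearMap.mul' k P (LinearMap.rTensor P (LinearMap.mulRight k (LinearMap.mul' k P (E.incl Y)))
      (E.incl X)) := by
  rw [incl_apply, incl_apply, incl_apply, map_mul E.val]
  generalize E.val X = x
  generalize E.val Y = y
  induction x with
  | zero => simp
  | add y z hy hz => simp only [map_add, add_mul, hy, hz]
  | tmul p q =>
    simp only [unop_tmul, LinearMap.rTensor_tmul, LinearMap.mulRight_apply, LinearMap.mul'_apply]
    induction y with
    | zero => simp
    | add y z hy hz => simp only [map_add, add_mul, mul_add, hy, hz]
    | tmul r u => simp [mul_assoc]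

/-- The Ehresmann–Schauenburg bialgebroid. -/
def bialgebroid (hG : δ.IsHopfGalois) (hP : LeftFaithfullyFlat.{max u v w} k δ.base P) :
    LeftBialgebroid k δ.base L where
  source := E.source
  target := E.target
  source_target_comm b c := E.source_target_comm b c.unop
  comul := E.comul hG hP
  counit := E.counit
  comul_bimodule b c X z hz := by
    refine E.pairMul_injective hG hP ?_
    have h := E.pairMul_source_target_mul b c z
    rw [E.pairMul_proj_of_eq hG hP hz] at h
    refine Eq.trans ?_ h.symm
    rw [pairMul_comul, incl_source_target_mul]
    generalize E.incl X = x
    induction x with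
    | zero => simp
    | add y z hy hz => simp only [map_add, hy, hz]
    | tmul p q => simp
  counit_bimodule b c X := by
    refine Subtype.val_injective ?_
    rw [coe_counit, incl_source_target_mul, Subalgebra.coe_mul, Subalgebra.coe_mul, coe_counit]
    generalize E.incl X = x
    induction x with
    | zero => simp
    | add y z hy hz => simp only [map_add, mul_add, add_mul, hy, hz]
    | tmul p q => simp [mul_assoc]
  coassoc X z hz := E.tripleMul_injective hG hP
    (E.tripleMul_fromLeft_eq_fromRight (E.pairMul_comul hG hP) X z hz)
  counit_left X z hz := by
    refine E.incl_injective ?_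
    rw [← rTensor_mul'_insertOne (E.incl X), ← E.pairMul_proj_of_eq hG hP hz]
    clear hz
    induction z with
    | zero => simp only [map_zero]
    | add y z hy hz => simp only [map_add, hy, hz]
    | tmul Y Z => rw [pairMul_tmul, ← incl_source_counit_mul]; rfl
  counit_right X z hz := by
    refine E.incl_injective ?_
    rw [← lTensor_mul'_insertOne (E.incl X), ← E.pairMul_proj_of_eq hG hP hz]
    clear hz
    induction z with
    | zero => simp only [map_zero]
    | add y z hy hz => simp only [map_add, hy, hz]
    | tmul Y Z => rw [pairMul_tmul, ← incl_target_counit_mul]; rfl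
  takeuchi b X := by
    refine E.pairMul_injective hG hP ?_
    refine (E.pairMul_rightMul_comul hG hP X _).trans
      (Eq.trans ?_ (E.pairMul_rightMul_comul hG hP X _).symm)
    -- Both t(b) ⊗ 1 and 1 ⊗ s(b) have image 1 ⊗ b ⊗ 1.
    rw [pairMul_tmul, pairMul_tmul, incl_target, incl_source, incl_one]
    simp
  comul_one := by
    refine E.pairMul_injective hG hP ?_
    refine (E.pairMul_comul hG hP 1).trans (Eq.trans ?_ (E.pairMul_tmul 1 1).symm)
    rw [incl_one]
    simp
  comul_mul X Y z w hz hw := by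
    refine E.pairMul_injective hG hP ?_
    refine Eq.trans ?_
      (E.pairMul_proj_mul X z w (E.pairMul_proj_of_eq hG hP hz)).symm
    rw [E.pairMul_proj_of_eq hG hP hw, pairMul_comul, incl_apply, incl_apply, outerMul_insertOne,
      map_mul E.val]
  counit_one := by
    refine Subtype.val_injective ?_
    rw [coe_counit, incl_one]
    simp
  counit_mul_source X Y := by
    refine Subtype.val_injective ?_
    rw [coe_counit, coe_counit, mul'_incl_mul, mul'_incl_mul, incl_source, coe_counit]
    simp
  counit_mul_target X Y := by
    refine Subtype.val_injective ?_
    rw [coe_counit, coe_counit, mul'_incl_mul, mul'_incl_mul, incl_target, coe_counit]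
    simp

end EhresmannSchauenburg

/-! ### Comparison with the translation map, and uniqueness of the bialgebroid. -/

section

variable {k H P : Type*} [Field k] [Ring H] [HopfAlgebra k H] [Ring P] [Algebra k P]
  (δ : RightComoduleAlgebra k H P)

/-- The map `(p ⊗ q) ⊗ (r ⊗ u) ↦ p ⊗ (q ⊗_B r) ⊗ u`. -/
def quad : (P ⊗[k] P) ⊗[k] (P ⊗[k] P) →ₗ[k] δ.Quad :=
  LinearMap.lTensor P (LinearMap.rTensor P δ.projBase ∘ₗ
      (TensorProduct.assoc k P P P).symm.toLinearMap) ∘ₗ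
    (TensorProduct.assoc k P P (P ⊗[k] P)).toLinearMap

/-- The multiplication `P ⊗_B P → P`. -/
def mulBase : δ.TensorBase →ₗ[k] P :=
  lift (LinearMap.mul' k P) (fun b p q => by simp [mul_assoc])

/-- Since pq = (id ⊗ ε)(p q₀ ⊗ q₁), multiplication factors through `can`; hence τ(h) multiplies to
ε(h)1. -/
lemma mulBase_eq (x : δ.TensorBase) :
    δ.mulBase x = TensorProduct.rid k P (LinearMap.lTensor P Coalgebra.counit (δ.can x)) := by
  obtain ⟨z, rfl⟩ := proj_surjective _ _ x
  induction z with
  | zero => simp only [map_zero]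
  | add y z hy hz => simp only [map_add, hy, hz]
  | tmul p q =>
    have h : ∀ t : P ⊗[k] H, TensorProduct.rid k P (LinearMap.lTensor P Coalgebra.counit
        ((p ⊗ₜ[k] (1 : H)) * t)) =
          p * TensorProduct.rid k P (LinearMap.lTensor P Coalgebra.counit t) := by
      intro t
      induction t with
      | zero => simp
      | add y z hy hz => simp only [map_add, mul_add, hy, hz]
      | tmul r g => simp
    refine Eq.trans ?_ (h (δ.coact q)).symm
    rw [δ.coact_counit]
    rfl

lemma can_translation (hG : δ.IsHopfGalois) (h : H) : δ.can (δ.translation hG h) = 1 ⊗ₜ h :=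
  (LinearEquiv.ofBijective δ.can hG).apply_symm_apply _

lemma mulBase_translation (hG : δ.IsHopfGalois) (h : H) :
    δ.mulBase (δ.translation hG h) = Coalgebra.counit (R := k) h • (1 : P) := by
  rw [mulBase_eq, can_translation]
  simp

/-- The map `p ⊗ x ⊗ u ↦ (p ⊗ x) ⊗ u` followed by the multiplication of `P ⊗_B P`. -/
def quadMul : δ.Quad →ₗ[k] (P ⊗[k] P) ⊗[k] P :=
  (TensorProduct.assoc k P P P).symm.toLinearMap ∘ₗ
    LinearMap.lTensor P (LinearMap.rTensor P δ.mulBase)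

lemma quadMul_quad (x : (P ⊗[k] P) ⊗[k] (P ⊗[k] P)) :
    δ.quadMul (δ.quad x) = tensorMul P P x := by
  suffices h : δ.quadMul ∘ₗ δ.quad = tensorMul P P from LinearMap.congr_fun h x
  ext p q r u
  rfl

lemma quadMul_quadComul (hG : δ.IsHopfGalois) (x : P ⊗[k] P) :
    δ.quadMul (δ.quadComul hG x) = insertOne k P x := by
  induction x with
  | zero => simp only [map_zero]
  | add y z hy hz => simp only [map_add, hy, hz]
  | tmul p q =>
    rw [insertOne_tmul]
    conv_rhs => rw [← δ.coact_counit p]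
    simp only [quadComul, LinearMap.comp_apply, LinearMap.rTensor_tmul, AlgHom.toLinearMap_apply]
    generalize δ.coact p = t
    induction t with
    | zero => simp
    | add y z hy hz => simp only [map_add, TensorProduct.add_tmul, hy, hz]
    | tmul p h => simp [quadMul, mulBase_translation, TensorProduct.smul_tmul']

lemma lTensor_can_quadComul (hG : δ.IsHopfGalois) (x : P ⊗[k] P) :
    LinearMap.lTensor P (LinearMap.rTensor P δ.can) (δ.quadComul hG x) =
      TensorProduct.assoc k P (P ⊗[k] H) P (LinearMap.rTensor P
        ((TensorProduct.assoc k P P H).toLinearMap ∘ₗ δ.coact₂) (insertOne k P x)) := by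
  induction x with
  | zero => simp only [map_zero]
  | add y z hy hz => simp only [map_add, hy, hz]
  | tmul p q =>
    rw [insertOne_tmul, LinearMap.rTensor_tmul, LinearMap.comp_apply, coact₂_eq,
      diagCoact_tmul_one]
    simp only [quadComul, LinearMap.comp_apply, LinearMap.rTensor_tmul, AlgHom.toLinearMap_apply]
    generalize δ.coact p = t
    induction t with
    | zero => simp
    | add y z hy hz => simp only [map_add, TensorProduct.add_tmul, hy, hz]
    | tmul p h => simp [can_translation]

namespace EhresmannSchauenburg

variable {δ} {L : Type*} [Ring L] [Algebra k L] (E : δ.EhresmannSchauenburg L)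

lemma rTensor_galois_tensorIncl (z : L ⊗[k] L) :
    LinearMap.rTensor P (δ.galois P ∘ₗ E.inclBase) (E.tensorIncl E.right (proj _ _ z)) =
      LinearMap.rTensor P δ.coact₂ (E.pairMul (proj _ _ z)) := by
  have h : δ.galois P ∘ₗ E.inclBase = δ.coact₂ ∘ₗ E.hopfMul :=
    LinearMap.ext E.galois_inclBase
  rw [h, pairMul, LinearMap.comp_apply, LinearMap.rTensor_comp, LinearMap.comp_apply]

lemma lTensor_can_quad (z : L ⊗[k] L) :
    LinearMap.lTensor P (LinearMap.rTensor P δ.can)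
        (δ.quad (TensorProduct.map E.incl E.incl z)) =
      TensorProduct.assoc k P (P ⊗[k] H) P (LinearMap.rTensor P
        ((TensorProduct.assoc k P P H).toLinearMap ∘ₗ δ.coact₂) (E.pairMul (proj _ _ z))) := by
  rw [LinearMap.rTensor_comp, LinearMap.comp_apply, ← rTensor_galois_tensorIncl]
  induction z with
  | zero => simp only [map_zero]
  | add y z hy hz => simp only [map_add, hy, hz]
  | tmul X Y =>
    rw [tensorIncl_proj, TensorProduct.map_tmul]
    generalize E.incl Y = y
    induction y with
    | zero => simp
    | add y z hy hz => simp only [map_add, TensorProduct.tmul_add, hy, hz]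
    | tmul r u =>
      rw [LinearMap.rTensor_tmul, LinearMap.rTensor_tmul, LinearMap.rTensor_tmul,
        LinearMap.comp_apply, LinearMap.comp_apply, TensorProduct.mk_apply, map_proj,
        TensorProduct.map_tmul, LinearMap.id_apply, galois, LinearMap.comp_apply,
        LinearEquiv.coe_coe, LinearEquiv.coe_coe, LinearEquiv.apply_symm_apply,
        LinearMap.comp_apply]
      generalize E.incl X = x
      induction x with
      | zero => simp
      | add y z hy hz => simp only [map_add, TensorProduct.add_tmul, hy, hz]
      | tmul p q => rfl

/-- This matches the formula p₀ ⊗ τ(p₁) ⊗ q with the description p ⊗ 1 ⊗ q. Multiplying the middle P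
⊗_B P gives one direction. For the other, apply the injective map `can` to the middle: on elements
from L ⊗ L the result is the coaction on the first two legs of `pairMul`, so nothing was lost by
multiplying. -/
lemma quad_eq_quadComul_iff (hG : δ.IsHopfGalois) (z : L ⊗[k] L) (x : P ⊗[k] P) :
    δ.quad (TensorProduct.map E.incl E.incl z) = δ.quadComul hG x ↔
      E.pairMul (proj _ _ z) = insertOne k P x := by
  constructor
  · intro h
    rw [pairMul_proj, ← δ.quadMul_quad, h, δ.quadMul_quadComul]
  · intro h
    refine (((LinearEquiv.ofBijective δ.can hG).rTensor P).lTensor P).injective ?_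
    change LinearMap.lTensor P (LinearMap.rTensor P δ.can) _ =
      LinearMap.lTensor P (LinearMap.rTensor P δ.can) _
    rw [lTensor_can_quad, lTensor_can_quadComul, h]

end EhresmannSchauenburg

end

section

variable {k : Type u} {H : Type v} {P : Type w} [Field k] [Ring H] [HopfAlgebra k H] [Ring P]
  [Algebra k P] (δ : RightComoduleAlgebra k H P)

/-- The algebra `esAlgebra` with its source and target maps. -/
def ehresmannSchauenburg : δ.EhresmannSchauenburg δ.esAlgebra where
  val := δ.esAlgebra.val
  val_injective := Subtype.val_injective
  mem_range_val z := by
    refine ⟨?_, fun h => ⟨⟨z, h⟩, rfl⟩⟩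
    rintro ⟨X, rfl⟩
    exact X.2
  source := (Algebra.TensorProduct.includeLeft.comp δ.base.val).codRestrict δ.esAlgebra (by
    intro b
    simp [esAlgebra, coact₂, coact_base, Algebra.TensorProduct.one_def])
  target := (Algebra.TensorProduct.includeRight.comp (AlgHom.op δ.base.val)).codRestrict
    δ.esAlgebra (by
      intro b
      simp [esAlgebra, coact₂, coact_base, Algebra.TensorProduct.one_def])
  val_source b := rfl
  val_target b := rfl

lemma isEhresmannSchauenburg_bialgebroid (hG : δ.IsHopfGalois)
    (hP : LeftFaithfullyFlat.{max u v w} k δ.base P) :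
    δ.IsEhresmannSchauenburg hG (δ.ehresmannSchauenburg.bialgebroid hG hP) where
  source_eq _ := rfl
  target_eq _ := rfl
  counit_eq _ := rfl
  comul_eq _ z hz := (δ.ehresmannSchauenburg.quad_eq_quadComul_iff hG z _).2
    (δ.ehresmannSchauenburg.pairMul_proj_of_eq hG hP hz)

lemma IsEhresmannSchauenburg.eq_bialgebroid {δ : RightComoduleAlgebra k H P} {hG : δ.IsHopfGalois}
    (hP : LeftFaithfullyFlat.{max u v w} k δ.base P)
    {𝓛 : LeftBialgebroid k δ.base δ.esAlgebra} (h : δ.IsEhresmannSchauenburg hG 𝓛) :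
    𝓛 = δ.ehresmannSchauenburg.bialgebroid hG hP := by
  obtain ⟨h₁, h₂, h₃, h₄⟩ := h
  obtain ⟨source, target, _, comul, counit, _⟩ := 𝓛
  obtain rfl : source = δ.ehresmannSchauenburg.source :=
    AlgHom.ext fun b => Subtype.val_injective (h₁ b)
  obtain rfl : target = δ.ehresmannSchauenburg.target :=
    AlgHom.ext fun b => Subtype.val_injective (h₂ b.unop)
  obtain rfl : counit = δ.ehresmannSchauenburg.counit :=
    LinearMap.ext fun b => Subtype.val_injective (h₃ b)
  obtain rfl : comul = δ.ehresmannSchauenburg.comul hG hP := by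
    refine LinearMap.ext fun X => δ.ehresmannSchauenburg.pairMul_injective hG hP ?_
    obtain ⟨z, hz⟩ := proj_surjective _ _ (comul X)
    rw [EhresmannSchauenburg.pairMul_comul]
    exact (congrArg _ hz.symm).trans
      ((δ.ehresmannSchauenburg.quad_eq_quadComul_iff hG z _).1 (h₄ X z hz))
  rfl

end

end RightComoduleAlgebra

/-! ### The braiding: invertibility, colinearity, and coactions rewritten by the antipode. -/

namespace RightComoduleAlgebra

open Balanced MulOpposite

section

variable {k H P : Type*} [Field k] [Ring H] [HopfAlgebra k H] [Ring P] [Algebra k P]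
  (δ : RightComoduleAlgebra k H P)

/-- For `K` on `(H ⊗ H) ⊗ (H ⊗ H)`, the map
`(p ⊗ (h₁ ⊗ h₂)) ⊗ (q ⊗ (g₁ ⊗ g₂)) ↦ (p ⊗ q) ⊗ K((h₁ ⊗ g₁) ⊗ (h₂ ⊗ g₂))`. -/
def pairApply {N : Type*} [AddCommGroup N] [Module k N]
    (K : (H ⊗[k] H) ⊗[k] (H ⊗[k] H) →ₗ[k] N) :
    (P ⊗[k] (H ⊗[k] H)) ⊗[k] (P ⊗[k] (H ⊗[k] H)) →ₗ[k] (P ⊗[k] P) ⊗[k] N :=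
  LinearMap.lTensor (P ⊗[k] P)
      (K ∘ₗ (TensorProduct.tensorTensorTensorComm k H H H H).toLinearMap) ∘ₗ
    (TensorProduct.tensorTensorTensorComm k P (H ⊗[k] H) P (H ⊗[k] H)).toLinearMap

@[simp]
lemma pairApply_tmul {N : Type*} [AddCommGroup N] [Module k N]
    (K : (H ⊗[k] H) ⊗[k] (H ⊗[k] H) →ₗ[k] N) (p q : P) (h₁ h₂ g₁ g₂ : H) :
    pairApply K ((p ⊗ₜ (h₁ ⊗ₜ h₂)) ⊗ₜ (q ⊗ₜ (g₁ ⊗ₜ g₂))) =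
      (p ⊗ₜ q) ⊗ₜ K ((h₁ ⊗ₜ g₁) ⊗ₜ (h₂ ⊗ₜ g₂)) := rfl

/-- The iterated coaction `p ↦ p₀ ⊗ (p₁ ⊗ p₂)`. -/
def iterCoact : P ⊗[k] H →ₗ[k] P ⊗[k] (H ⊗[k] H) :=
  (TensorProduct.assoc k P H H).toLinearMap ∘ₗ LinearMap.rTensor H δ.coact.toLinearMap

/-- By coassociativity, an operation on the doubly coacted pair depends on K only through its
composite with the coproduct of H ⊗ H. Identities between such composites, like the axioms of R,
therefore transfer to P ⊗ P. -/
lemma pairApply_iterCoact {N : Type*} [AddCommGroup N] [Module k N]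
    (K : (H ⊗[k] H) ⊗[k] (H ⊗[k] H) →ₗ[k] N) (p q : P) :
    pairApply K (δ.iterCoact (δ.coact p) ⊗ₜ δ.iterCoact (δ.coact q)) =
      LinearMap.lTensor (P ⊗[k] P) (K ∘ₗ Coalgebra.comul (R := k))
        (TensorProduct.tensorTensorTensorComm k P H P H (δ.coact p ⊗ₜ δ.coact q)) := by
  simp only [iterCoact, LinearMap.comp_apply, LinearEquiv.coe_coe, δ.coact_coassoc]
  generalize δ.coact p = r
  generalize δ.coact q = s
  induction r with
  | zero => simp
  | add y z hy hz => simp only [map_add, TensorProduct.add_tmul, hy, hz]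
  | tmul p h =>
    induction s with
    | zero => simp
    | add y z hy hz => simp only [map_add, TensorProduct.tmul_add, hy, hz]
    | tmul q g => rfl

/-- The map `(p ⊗ h) ⊗ (q ⊗ g) ↦ q ⊗ p f(h ⊗ g)`. -/
def flipMul (f : H ⊗[k] H →ₗ[k] k) : (P ⊗[k] H) ⊗[k] (P ⊗[k] H) →ₗ[k] P ⊗[k] P :=
  (TensorProduct.rid k (P ⊗[k] P)).toLinearMap ∘ₗ
    TensorProduct.map (TensorProduct.comm k P P).toLinearMap f ∘ₗ
      (TensorProduct.tensorTensorTensorComm k P H P H).toLinearMap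

@[simp]
lemma flipMul_tmul (f : H ⊗[k] H →ₗ[k] k) (p q : P) (h g : H) :
    flipMul f ((p ⊗ₜ h) ⊗ₜ (q ⊗ₜ g)) = f (h ⊗ₜ g) • (q ⊗ₜ p) := rfl

lemma flipWith_tmul (f : H ⊗[k] H →ₗ[k] k) (p q : P) :
    δ.flipWith f (p ⊗ₜ q) = flipMul f (δ.coact p ⊗ₜ δ.coact q) := rfl

/-- The composite of two flips acts by the convolution product of the forms; g is precomposed with
the swap because the first flip has exchanged the factors. -/
lemma flipWith_flipWith (f g : H ⊗[k] H →ₗ[k] k)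
    (hfg : LinearMap.mul' k k ∘ₗ TensorProduct.map
      (g ∘ₗ (TensorProduct.comm k H H).toLinearMap) f ∘ₗ Coalgebra.comul (R := k) =
        Coalgebra.counit (R := k)) :
    δ.flipWith g ∘ₗ δ.flipWith f = LinearMap.id := by
  ext p q
  simp only [TensorProduct.AlgebraTensorModule.curry_apply, TensorProduct.curry_apply,
    LinearMap.coe_restrictScalars, LinearMap.comp_apply, LinearMap.id_apply, flipWith_tmul]
  have h₁ : ∀ r s : P ⊗[k] H, δ.flipWith g (flipMul f (r ⊗ₜ s)) =
      TensorProduct.rid k (P ⊗[k] P) (pairApply (LinearMap.mul' k k ∘ₗ TensorProduct.map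
        (g ∘ₗ (TensorProduct.comm k H H).toLinearMap) f) (δ.iterCoact r ⊗ₜ δ.iterCoact s)) := by
    intro r s
    induction r with
    | zero => simp
    | add y z hy hz => simp only [map_add, TensorProduct.add_tmul, hy, hz]
    | tmul p h =>
      induction s with
      | zero => simp
      | add y z hy hz => simp only [map_add, TensorProduct.tmul_add, hy, hz]
      | tmul q g =>
        simp only [flipMul_tmul, map_smul, flipWith_tmul, iterCoact, LinearMap.comp_apply,
          LinearMap.rTensor_tmul, AlgHom.toLinearMap_apply]
        generalize δ.coact p = r
        generalize δ.coact q = s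
        induction r with
        | zero => simp
        | add y z hy hz =>
          simp only [map_add, TensorProduct.add_tmul, TensorProduct.tmul_add, smul_add, hy, hz]
        | tmul p h =>
          induction s with
          | zero => simp
          | add y z hy hz =>
            simp only [map_add, TensorProduct.add_tmul, TensorProduct.tmul_add, smul_add, hy, hz]
          | tmul q g => simp [smul_smul, mul_comm]
  rw [h₁, pairApply_iterCoact, LinearMap.comp_assoc, hfg]
  conv_rhs => rw [← δ.coact_counit p, ← δ.coact_counit q]
  generalize δ.coact p = r
  generalize δ.coact q = s
  induction r with
  | zero => simp
  | add y z hy hz => simp only [map_add, TensorProduct.add_tmul, hy, hz]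
  | tmul p h =>
    induction s with
    | zero => simp
    | add y z hy hz => simp only [map_add, TensorProduct.tmul_add, hy, hz]
    | tmul q g => simp [TensorProduct.smul_tmul', TensorProduct.tmul_smul, smul_smul, mul_comm]

lemma comul_comm_tmul (x : H ⊗[k] H) :
    Coalgebra.comul (R := k) (TensorProduct.comm k H H x) =
      TensorProduct.map (TensorProduct.comm k H H).toLinearMap
        (TensorProduct.comm k H H).toLinearMap (Coalgebra.comul (R := k) x) := by
  induction x with
  | zero => simp
  | add y z hy hz => simp only [map_add, hy, hz]
  | tmul h g =>
    rw [TensorProduct.comm_tmul, TensorProduct.comul_tmul, TensorProduct.comul_tmul]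
    generalize (Coalgebra.comul (R := k) h) = s
    generalize (Coalgebra.comul (R := k) g) = t
    induction s with
    | zero => simp
    | add y z hy hz => simp only [map_add, TensorProduct.add_tmul, TensorProduct.tmul_add, hy, hz]
    | tmul a b =>
      induction t with
      | zero => simp
      | add y z hy hz =>
        simp only [map_add, TensorProduct.add_tmul, TensorProduct.tmul_add, hy, hz]
      | tmul c d => rfl

lemma counit_comm_tmul (x : H ⊗[k] H) :
    Coalgebra.counit (R := k) (TensorProduct.comm k H H x) = Coalgebra.counit (R := k) x := by
  induction x with
  | zero => simp
  | add y z hy hz => simp only [map_add, hy, hz]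
  | tmul h g => simp [mul_comm]

lemma braidingInv_comp_braiding (𝓡 : CoquasitriangularStructure k H) :
    δ.braidingInv 𝓡 ∘ₗ δ.braiding 𝓡 = LinearMap.id := by
  refine δ.flipWith_flipWith _ _ (LinearMap.ext fun x => ?_)
  have h := congrArg (fun F => F.ofConv x) 𝓡.inv_mul
  have hc : (𝓡.Rinv ∘ₗ (TensorProduct.comm k H H).toLinearMap) ∘ₗ
      (TensorProduct.comm k H H).toLinearMap = 𝓡.Rinv := by
    ext; rfl
  rw [hc]
  exact h

lemma braiding_comp_braidingInv (𝓡 : CoquasitriangularStructure k H) :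
    δ.braiding 𝓡 ∘ₗ δ.braidingInv 𝓡 = LinearMap.id := by
  refine δ.flipWith_flipWith _ _ (LinearMap.ext fun x => ?_)
  -- In this order both forms carry the swap, so R * R⁻¹ = 1 is evaluated at the swapped tensor; the
  -- swap is a coalgebra map.
  have h := congrArg (fun F => F.ofConv (TensorProduct.comm k H H x)) 𝓡.mul_inv
  rw [LinearMap.comp_apply, LinearMap.comp_apply, TensorProduct.map_comp, LinearMap.comp_apply,
    ← comul_comm_tmul, ← counit_comm_tmul]
  exact h

/-- Coacting after Ψ gives the H-part g₁h₁R(h₂ ⊗ g₂), and coacting before it gives R(h₁ ⊗ g₁)h₂g₂;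
these are the two sides `K₁`, `K₂` of quasi-commutativity. -/
lemma coact₂_braiding (𝓡 : CoquasitriangularStructure k H) (z : P ⊗[k] P) :
    δ.coact₂ (δ.braiding 𝓡 z) = LinearMap.rTensor H (δ.braiding 𝓡) (δ.coact₂ z) := by
  let K₁ : (H ⊗[k] H) ⊗[k] (H ⊗[k] H) →ₗ[k] H := (TensorProduct.rid k H).toLinearMap ∘ₗ
    TensorProduct.map (LinearMap.mul' k H ∘ₗ (TensorProduct.comm k H H).toLinearMap) 𝓡.R
  let K₂ : (H ⊗[k] H) ⊗[k] (H ⊗[k] H) →ₗ[k] H := (TensorProduct.lid k H).toLinearMap ∘ₗ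
    TensorProduct.map 𝓡.R (LinearMap.mul' k H)
  have hK : K₁ ∘ₗ Coalgebra.comul (R := k) = K₂ ∘ₗ Coalgebra.comul (R := k) :=
    TensorProduct.ext' 𝓡.quasi_comm
  let c := LinearMap.rTensor H (TensorProduct.comm k P P).toLinearMap
  have h₁ : ∀ r s : P ⊗[k] H, δ.coact₂ (flipMul 𝓡.R (r ⊗ₜ s)) =
      c (pairApply K₁ (δ.iterCoact r ⊗ₜ δ.iterCoact s)) := by
    intro r s
    induction r with
    | zero => simp
    | add y z hy hz => simp only [map_add, TensorProduct.add_tmul, hy, hz]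
    | tmul p h =>
      induction s with
      | zero => simp
      | add y z hy hz => simp only [map_add, TensorProduct.tmul_add, hy, hz]
      | tmul q g =>
        simp only [flipMul_tmul, map_smul, coact₂_eq, diagCoact_tmul, iterCoact,
          LinearMap.comp_apply, LinearMap.rTensor_tmul, AlgHom.toLinearMap_apply]
        generalize δ.coact p = r
        generalize δ.coact q = s
        induction r with
        | zero => simp
        | add y z hy hz =>
          simp only [map_add, TensorProduct.add_tmul, TensorProduct.tmul_add, smul_add, hy, hz]
        | tmul p h =>
          induction s with
          | zero => simp
          | add y z hy hz =>
            simp only [map_add, TensorProduct.add_tmul, TensorProduct.tmul_add, smul_add, hy, hz]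
          | tmul q g => simp [c, K₁]
  have h₂ : ∀ r s : P ⊗[k] H, LinearMap.rTensor H (δ.braiding 𝓡) (diagMul k H P P (r ⊗ₜ s)) =
      c (pairApply K₂ (δ.iterCoact r ⊗ₜ δ.iterCoact s)) := by
    intro r s
    induction r with
    | zero => simp
    | add y z hy hz => simp only [map_add, TensorProduct.add_tmul, hy, hz]
    | tmul p h =>
      induction s with
      | zero => simp
      | add y z hy hz => simp only [map_add, TensorProduct.tmul_add, hy, hz]
      | tmul q g =>
        simp only [diagMul_tmul, braiding, flipWith_tmul, iterCoact,
          LinearMap.comp_apply, LinearMap.rTensor_tmul, AlgHom.toLinearMap_apply]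
        generalize δ.coact p = r
        generalize δ.coact q = s
        induction r with
        | zero => simp
        | add y z hy hz => simp only [map_add, TensorProduct.add_tmul, hy, hz]
        | tmul p h =>
          induction s with
          | zero => simp
          | add y z hy hz => simp only [map_add, TensorProduct.add_tmul, TensorProduct.tmul_add,
              hy, hz]
          | tmul q g => simp [c, K₂, TensorProduct.smul_tmul']
  induction z with
  | zero => simp
  | add y z hy hz => simp only [map_add, hy, hz]
  | tmul p q =>
    rw [braiding, flipWith_tmul, h₁, ← braiding, coact₂_eq, diagCoact_tmul]
    refine Eq.trans ?_ (h₂ (δ.coact p) (δ.coact q)).symm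
    rw [pairApply_iterCoact, pairApply_iterCoact, hK]

lemma coact₂_braidingInv (𝓡 : CoquasitriangularStructure k H) (z : P ⊗[k] P) :
    δ.coact₂ (δ.braidingInv 𝓡 z) = LinearMap.rTensor H (δ.braidingInv 𝓡) (δ.coact₂ z) := by
  have h : ∀ z, δ.braiding 𝓡 (δ.braidingInv 𝓡 z) = z :=
    LinearMap.congr_fun (δ.braiding_comp_braidingInv 𝓡)
  conv_rhs => rw [← h z, coact₂_braiding, ← LinearMap.comp_apply, ← LinearMap.rTensor_comp,
    braidingInv_comp_braiding, LinearMap.rTensor_id, LinearMap.id_apply]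

lemma flipWith_lTensor_mulRight (f : H ⊗[k] H →ₗ[k] k) (b : δ.base) (z : P ⊗[k] P) :
    δ.flipWith f (LinearMap.lTensor P (LinearMap.mulRight k (b : P)) z) =
      LinearMap.rTensor P (LinearMap.mulRight k (b : P)) (δ.flipWith f z) := by
  induction z with
  | zero => simp
  | add y z hy hz => simp only [map_add, hy, hz]
  | tmul p q =>
    rw [LinearMap.lTensor_tmul, LinearMap.mulRight_apply, flipWith_tmul, flipWith_tmul, map_mul,
      coact_base]
    generalize δ.coact p = r
    generalize δ.coact q = s
    induction r with
    | zero => simp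
    | add y z hy hz => simp only [map_add, TensorProduct.add_tmul, hy, hz]
    | tmul p h =>
      induction s with
      | zero => simp
      | add y z hy hz => simp only [map_add, TensorProduct.tmul_add, add_mul, hy, hz]
      | tmul q g => simp

lemma flipWith_rTensor_mulLeft (f : H ⊗[k] H →ₗ[k] k) (b : δ.base) (z : P ⊗[k] P) :
    δ.flipWith f (LinearMap.rTensor P (LinearMap.mulLeft k (b : P)) z) =
      LinearMap.lTensor P (LinearMap.mulLeft k (b : P)) (δ.flipWith f z) := by
  induction z with
  | zero => simp
  | add y z hy hz => simp only [map_add, hy, hz]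
  | tmul p q =>
    rw [LinearMap.rTensor_tmul, LinearMap.mulLeft_apply, flipWith_tmul, flipWith_tmul, map_mul,
      coact_base]
    generalize δ.coact p = r
    generalize δ.coact q = s
    induction r with
    | zero => simp
    | add y z hy hz => simp only [map_add, TensorProduct.add_tmul, mul_add, hy, hz]
    | tmul p h =>
      induction s with
      | zero => simp
      | add y z hy hz => simp only [map_add, TensorProduct.tmul_add, hy, hz]
      | tmul q g => simp

/-- The map `h ⊗ u ↦ u₀ f(h ⊗ u₁)`. -/
def formAct (f : H ⊗[k] H →ₗ[k] k) : H ⊗[k] P →ₗ[k] P :=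
  (TensorProduct.rid k P).toLinearMap ∘ₗ LinearMap.lTensor P f ∘ₗ
    (TensorProduct.leftComm k H P H).toLinearMap ∘ₗ LinearMap.lTensor H δ.coact.toLinearMap

lemma flipWith_eq_formAct (f : H ⊗[k] H →ₗ[k] k) (p q : P) :
    δ.flipWith f (p ⊗ₜ q) = TensorProduct.comm k P P (LinearMap.lTensor P (δ.formAct f)
      (TensorProduct.assoc k P H P (δ.coact p ⊗ₜ q))) := by
  rw [flipWith_tmul]
  generalize δ.coact p = r
  induction r with
  | zero => simp
  | add y z hy hz => simp only [map_add, TensorProduct.add_tmul, hy, hz]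
  | tmul p h =>
    simp only [formAct, TensorProduct.assoc_tmul, LinearMap.lTensor_tmul, LinearMap.comp_apply,
      AlgHom.toLinearMap_apply]
    generalize δ.coact q = s
    induction s with
    | zero => simp
    | add y z hy hz => simp only [map_add, TensorProduct.tmul_add, hy, hz]
    | tmul q g => simp

/-- The map `(p ⊗ m) ⊗ h ↦ m ⊗ p₀ f(h ⊗ p₁)`. -/
def formFlip (f : H ⊗[k] H →ₗ[k] k) : (P ⊗[k] P) ⊗[k] H →ₗ[k] P ⊗[k] P :=
  LinearMap.lTensor P (δ.formAct f ∘ₗ (TensorProduct.comm k P H).toLinearMap) ∘ₗ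
    (TensorProduct.assoc k P P H).toLinearMap ∘ₗ
      LinearMap.rTensor H (TensorProduct.comm k P P).toLinearMap

@[simp]
lemma formFlip_tmul (f : H ⊗[k] H →ₗ[k] k) (p m : P) (h : H) :
    δ.formFlip f ((p ⊗ₜ m) ⊗ₜ h) = m ⊗ₜ δ.formAct f (h ⊗ₜ p) := rfl

/-- The coaction on the second factor of `P ⊗ P`. -/
def coactRight : P ⊗[k] P →ₗ[k] (P ⊗[k] P) ⊗[k] H :=
  (TensorProduct.assoc k P P H).symm.toLinearMap ∘ₗ LinearMap.lTensor P δ.coact.toLinearMap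

lemma flipWith_comm_eq_formFlip (f : H ⊗[k] H →ₗ[k] k) (z : P ⊗[k] P) :
    δ.flipWith (f ∘ₗ (TensorProduct.comm k H H).toLinearMap) z =
      δ.formFlip f (δ.coactRight z) := by
  induction z with
  | zero => simp
  | add y z hy hz => simp only [map_add, hy, hz]
  | tmul p q =>
    simp only [flipWith_tmul, coactRight, LinearMap.comp_apply, LinearMap.lTensor_tmul,
      AlgHom.toLinearMap_apply, LinearEquiv.coe_coe]
    generalize δ.coact q = s
    induction s with
    | zero => simp
    | add y z hy hz => simp only [map_add, TensorProduct.tmul_add, hy, hz]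
    | tmul q g =>
      simp only [TensorProduct.assoc_symm_tmul, formFlip_tmul, formAct, LinearMap.comp_apply,
        LinearMap.lTensor_tmul, AlgHom.toLinearMap_apply]
      generalize δ.coact p = s
      induction s with
      | zero => simp
      | add y z hy hz => simp only [map_add, TensorProduct.tmul_add, TensorProduct.add_tmul, hy, hz]
      | tmul q g => simp

/-- The map `p ↦ p₀ ⊗ S(p₁)`. -/
def antiCoact : P →ₗ[k] P ⊗[k] H :=
  LinearMap.lTensor P (HopfAlgebra.antipode k) ∘ₗ δ.coact.toLinearMap

lemma antiCoact_mul_coact (p : P) :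
    LinearMap.lTensor P (LinearMap.mul' k H) (TensorProduct.assoc k P H H
      (LinearMap.rTensor H δ.antiCoact (δ.coact p))) = p ⊗ₜ 1 := by
  have h₁ : ∀ t : P ⊗[k] H, LinearMap.lTensor P (LinearMap.mul' k H) (TensorProduct.assoc k P H H
      (LinearMap.rTensor H δ.antiCoact t)) = LinearMap.lTensor P (LinearMap.mul' k H ∘ₗ
        LinearMap.rTensor H (HopfAlgebra.antipode k)) (TensorProduct.assoc k P H H
          (LinearMap.rTensor H δ.coact.toLinearMap t)) := by
    intro t
    induction t with
    | zero => simp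
    | add y z hy hz => simp only [map_add, hy, hz]
    | tmul p h =>
      simp only [antiCoact, LinearMap.rTensor_tmul, LinearMap.comp_apply, AlgHom.toLinearMap_apply]
      generalize δ.coact p = s
      induction s with
      | zero => simp
      | add y z hy hz => simp only [map_add, TensorProduct.add_tmul, hy, hz]
      | tmul q g => simp
  rw [h₁, δ.coact_coassoc, ← LinearMap.lTensor_comp_apply]
  conv_rhs => rw [← δ.coact_counit p]
  generalize δ.coact p = s
  induction s with
  | zero => simp
  | add y z hy hz => simp only [map_add, TensorProduct.add_tmul, hy, hz]
  | tmul q g =>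
    simp [HopfAlgebra.mul_antipode_rTensor_comul_apply, Algebra.algebraMap_eq_smul_one,
      TensorProduct.smul_tmul']

/-- The map `p ⊗ h ↦ p₀ ⊗ p₁ S(h)`. -/
def coactAntipode : P ⊗[k] H →ₗ[k] P ⊗[k] H :=
  LinearMap.mul' k (P ⊗[k] H) ∘ₗ TensorProduct.map δ.coact.toLinearMap
    (Algebra.TensorProduct.includeRight.toLinearMap ∘ₗ HopfAlgebra.antipode k)

@[simp]
lemma coactAntipode_tmul (p : P) (h : H) :
    δ.coactAntipode (p ⊗ₜ h) = δ.coact p * (1 ⊗ₜ HopfAlgebra.antipode k h) := rfl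

/-- q₀r₀ ⊗ q₁r₁S(r₂) = q₀r ⊗ q₁: the coaction of q is recovered from q r₀ ⊗ r₁, where q and r are
already multiplied. -/
lemma coactAntipode_mul_coact (q r : P) :
    δ.coactAntipode ((q ⊗ₜ 1) * δ.coact r) = δ.coact q * (r ⊗ₜ 1) := by
  have h₁ : ∀ t : P ⊗[k] H, δ.coactAntipode ((q ⊗ₜ 1) * t) =
      δ.coact q * LinearMap.lTensor P (LinearMap.mul' k H ∘ₗ
        LinearMap.lTensor H (HopfAlgebra.antipode k)) (TensorProduct.assoc k P H H
          (LinearMap.rTensor H δ.coact.toLinearMap t)) := by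
    intro t
    induction t with
    | zero => simp
    | add y z hy hz => simp only [map_add, mul_add, hy, hz]
    | tmul p h =>
      simp only [Algebra.TensorProduct.tmul_mul_tmul, coactAntipode_tmul, map_mul, mul_assoc,
        one_mul, LinearMap.rTensor_tmul, AlgHom.toLinearMap_apply]
      congr 1
      generalize δ.coact p = s
      induction s with
      | zero => simp
      | add y z hy hz => simp only [map_add, TensorProduct.add_tmul, add_mul, hy, hz]
      | tmul q g => simp
  rw [h₁, δ.coact_coassoc, ← LinearMap.lTensor_comp_apply]
  conv_rhs => rw [← δ.coact_counit r]
  congr 1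
  generalize δ.coact r = s
  induction s with
  | zero => simp
  | add y z hy hz => simp only [map_add, TensorProduct.add_tmul, hy, hz]
  | tmul q g =>
    simp [HopfAlgebra.mul_antipode_lTensor_comul_apply, Algebra.algebraMap_eq_smul_one,
      TensorProduct.smul_tmul']

/-- The map `p ⊗ q ↦ p₀ ⊗ q ⊗ S(p₁)`. -/
def antiCoactLeft : P ⊗[k] P →ₗ[k] (P ⊗[k] P) ⊗[k] H :=
  (TensorProduct.rightComm k P H P).toLinearMap ∘ₗ LinearMap.rTensor P δ.antiCoact

/-- Apply `χ`, which coacts once more on the first leg and multiplies H on the left by the antipode,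
to both sides of the coinvariance equation. From z ⊗ 1 it gives p₀ ⊗ q ⊗ S(p₁); from the diagonal
coaction it gives p₀ ⊗ q₀ ⊗ S(p₁)p₂q₁ = p ⊗ q₀ ⊗ q₁. -/
lemma antiCoactLeft_eq_coactRight {z : P ⊗[k] P} (hz : δ.coact₂ z = z ⊗ₜ 1) :
    δ.antiCoactLeft z = δ.coactRight z := by
  let χ : (P ⊗[k] P) ⊗[k] H →ₗ[k] (P ⊗[k] P) ⊗[k] H :=
    diagMul k H P P ∘ₗ LinearMap.rTensor (P ⊗[k] H) δ.antiCoact ∘ₗ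
      (TensorProduct.assoc k P P H).toLinearMap
  have h₁ : ∀ z, χ (z ⊗ₜ 1) = δ.antiCoactLeft z := by
    intro z
    induction z with
    | zero => simp
    | add y z hy hz => simp only [map_add, TensorProduct.add_tmul, hy, hz]
    | tmul p q =>
      simp only [χ, LinearMap.comp_apply, LinearEquiv.coe_coe, TensorProduct.assoc_tmul,
        LinearMap.rTensor_tmul, antiCoactLeft]
      generalize δ.antiCoact p = s
      induction s with
      | zero => simp
      | add y z hy hz => simp only [map_add, TensorProduct.add_tmul, hy, hz]
      | tmul p h => simp
  have h₂ : ∀ s t : P ⊗[k] H, χ (diagMul k H P P (s ⊗ₜ t)) = diagMul k H P P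
      (LinearMap.lTensor P (LinearMap.mul' k H) (TensorProduct.assoc k P H H
        (LinearMap.rTensor H δ.antiCoact s)) ⊗ₜ t) := by
    intro s t
    induction s with
    | zero => simp
    | add y z hy hz => simp only [map_add, TensorProduct.add_tmul, hy, hz]
    | tmul p h =>
      induction t with
      | zero => simp
      | add y z hy hz => simp only [map_add, TensorProduct.tmul_add, hy, hz]
      | tmul q g =>
        simp only [χ, LinearMap.comp_apply, LinearEquiv.coe_coe, TensorProduct.assoc_tmul,
          LinearMap.rTensor_tmul, diagMul_tmul]
        generalize δ.antiCoact p = s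
        induction s with
        | zero => simp
        | add y z hy hz => simp only [map_add, TensorProduct.add_tmul, hy, hz]
        | tmul p h => simp [mul_assoc]
  have h₃ : ∀ z, χ (δ.coact₂ z) = δ.coactRight z := by
    intro z
    induction z with
    | zero => simp
    | add y z hy hz => simp only [map_add, hy, hz]
    | tmul p q =>
      rw [coact₂_eq, diagCoact_tmul, AlgHom.toLinearMap_apply, h₂, antiCoact_mul_coact]
      simp only [coactRight, LinearMap.comp_apply, LinearMap.lTensor_tmul,
        AlgHom.toLinearMap_apply]
      generalize δ.coact q = s
      induction s with
      | zero => simp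
      | add y z hy hz => simp only [map_add, TensorProduct.tmul_add, hy, hz]
      | tmul p h => simp
  rw [← h₁, ← h₃, hz]

end

end RightComoduleAlgebra

/-! ### The antipode of L. -/

namespace RightComoduleAlgebra

open Balanced MulOpposite

namespace EhresmannSchauenburg

section

variable {k H P : Type*} [Field k] [Ring H] [HopfAlgebra k H] [Ring P] [Algebra k P]
  {δ : RightComoduleAlgebra k H P} {L : Type*} [Ring L] [Algebra k L]
  (E : δ.EhresmannSchauenburg L)

/-- The endomorphism of `L` induced by an endomorphism of `P ⊗ P` preserving coinvariants. -/
def restrict (f : P ⊗[k] P →ₗ[k] P ⊗[k] P)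
    (hf : ∀ z, δ.coact₂ (f z) = LinearMap.rTensor H f (δ.coact₂ z)) : L →ₗ[k] L :=
  (LinearEquiv.ofInjective E.incl E.incl_injective).symm.toLinearMap ∘ₗ
    (f ∘ₗ E.incl).codRestrict (LinearMap.range E.incl) (fun X => LinearMap.mem_range.2
      (E.exists_incl_eq (by
        rw [LinearMap.comp_apply, hf, coact₂_incl, LinearMap.rTensor_tmul])))

lemma incl_restrict (f : P ⊗[k] P →ₗ[k] P ⊗[k] P)
    (hf : ∀ z, δ.coact₂ (f z) = LinearMap.rTensor H f (δ.coact₂ z)) (X : L) :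
    E.incl (E.restrict f hf X) = f (E.incl X) :=
  congrArg Subtype.val ((LinearEquiv.ofInjective E.incl E.incl_injective).apply_symm_apply _)

/-- The restriction of the inverse braiding to `L`. -/
def antipode (𝓡 : CoquasitriangularStructure k H) : L ≃ₗ[k] L :=
  LinearEquiv.ofLinearMap (E.restrict (δ.braidingInv 𝓡) (δ.coact₂_braidingInv 𝓡))
    (E.restrict (δ.braiding 𝓡) (δ.coact₂_braiding 𝓡))
    (LinearMap.ext fun X => E.incl_injective (by
      rw [LinearMap.comp_apply, incl_restrict, incl_restrict, ← LinearMap.comp_apply,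
        braidingInv_comp_braiding]
      rfl))
    (LinearMap.ext fun X => E.incl_injective (by
      rw [LinearMap.comp_apply, incl_restrict, incl_restrict, ← LinearMap.comp_apply,
        braiding_comp_braidingInv]
      rfl))

lemma incl_antipode (𝓡 : CoquasitriangularStructure k H) (X : L) :
    E.incl (E.antipode 𝓡 X) = δ.braidingInv 𝓡 (E.incl X) :=
  E.incl_restrict (δ.braidingInv 𝓡) (δ.coact₂_braidingInv 𝓡) X

lemma incl_antipode_symm (𝓡 : CoquasitriangularStructure k H) (X : L) :
    E.incl ((E.antipode 𝓡).symm X) = δ.braiding 𝓡 (E.incl X) :=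
  E.incl_restrict (δ.braiding 𝓡) (δ.coact₂_braiding 𝓡) X

lemma unop_mul_tmul (c : P ⊗[k] Pᵐᵒᵖ) (a b : P) : unop (c * (a ⊗ₜ[k] op b)) =
    TensorProduct.map (LinearMap.mulRight k a) (LinearMap.mulLeft k b) (unop c) := by
  induction c with
  | zero => simp
  | add y z hy hz => simp only [map_add, add_mul, hy, hz]
  | tmul p q => simp

lemma incl_mul_source (b : δ.base) (X : L) : E.incl (X * E.source b) =
    LinearMap.rTensor P (LinearMap.mulRight k (b : P)) (E.incl X) := by
  rw [incl_apply, map_mul E.val, val_source, ← op_one, unop_mul_tmul, LinearMap.mulLeft_one]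
  rfl

lemma incl_mul_target (b : δ.base) (X : L) : E.incl (X * E.target (op b)) =
    LinearMap.lTensor P (LinearMap.mulLeft k (b : P)) (E.incl X) := by
  rw [incl_apply, map_mul E.val, val_target, unop_mul_tmul, LinearMap.mulRight_one]
  rfl

lemma rTensor_galois_tensorIncl_tmul (X Y : L) :
    LinearMap.rTensor P (δ.galois P ∘ₗ E.inclBase) (E.tensorIncl E.right (proj _ _ (X ⊗ₜ Y))) =
      LinearMap.rTensor P (tensorMul P H ∘ₗ TensorProduct.mk k _ _ (E.incl X) ∘ₗ
        δ.coact.toLinearMap) (E.incl Y) := by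
  rw [tensorIncl_proj]
  generalize E.incl Y = y
  induction y with
  | zero => simp
  | add y z hy hz => simp only [map_add, hy, hz]
  | tmul r u =>
    rw [LinearMap.rTensor_tmul, LinearMap.rTensor_tmul, LinearMap.rTensor_tmul,
      LinearMap.comp_apply, LinearMap.comp_apply, TensorProduct.mk_apply, map_proj,
      TensorProduct.map_tmul, LinearMap.id_apply, galois_proj]
    rfl

/-- The map `((p ⊗ m) ⊗ h) ⊗ u ↦ (u₀ ⊗ p) ⊗ m f(h ⊗ u₁)`. -/
def formCycle (δ : RightComoduleAlgebra k H P) (f : H ⊗[k] H →ₗ[k] k) :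
    ((P ⊗[k] P) ⊗[k] H) ⊗[k] P →ₗ[k] (P ⊗[k] P) ⊗[k] P :=
  (TensorProduct.assoc k P P P).symm.toLinearMap ∘ₗ
    (TensorProduct.comm k (P ⊗[k] P) P).toLinearMap ∘ₗ
      LinearMap.lTensor (P ⊗[k] P) (δ.formAct f) ∘ₗ
        (TensorProduct.assoc k (P ⊗[k] P) H P).toLinearMap

@[simp]
lemma formCycle_tmul (f : H ⊗[k] H →ₗ[k] k) (p m u : P) (h : H) :
    formCycle δ f (((p ⊗ₜ m) ⊗ₜ h) ⊗ₜ u) = (δ.formAct f (h ⊗ₜ u) ⊗ₜ p) ⊗ₜ m := rfl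

/-- For x = p ⊗ q and y = r ⊗ u both sides are f(r₁ ⊗ u₁) u₀ ⊗ p ⊗ q r₀. The right side is the left
member of axiom 2 seen in P ⊗ P ⊗ P; the left side depends only on the Galois image of x ⊗ y. -/
lemma formCycle_eq_outerMul (f : H ⊗[k] H →ₗ[k] k) (x y : P ⊗[k] P) :
    formCycle δ f (LinearMap.rTensor P (tensorMul P H ∘ₗ TensorProduct.mk k _ _ x ∘ₗ
        δ.coact.toLinearMap) y) =
      outerMul (unop.symm (δ.flipWith f y)) (tensorMul P P ((1 ⊗ₜ 1) ⊗ₜ x)) := by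
  induction x with
  | zero =>
    simp only [map_zero, TensorProduct.tmul_zero, LinearMap.zero_comp, LinearMap.comp_zero,
      LinearMap.rTensor_zero, LinearMap.zero_apply]
  | add y z hy hz =>
    simp only [map_add, TensorProduct.tmul_add, LinearMap.add_comp, LinearMap.comp_add,
      LinearMap.rTensor_add, LinearMap.add_apply, hy, hz]
  | tmul p q =>
    rw [tensorMul_tmul, one_mul, outerMul_tmul, unop_mul_tmul, LinearEquiv.apply_symm_apply,
      LinearMap.mulRight_one]
    induction y with
    | zero => simp
    | add y z hy hz => simp only [map_add, TensorProduct.add_tmul, hy, hz]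
    | tmul r u =>
      rw [flipWith_eq_formAct, LinearMap.rTensor_tmul, LinearMap.comp_apply, LinearMap.comp_apply,
        AlgHom.toLinearMap_apply, TensorProduct.mk_apply]
      generalize δ.coact r = s
      induction s with
      | zero => simp
      | add y z hy hz => simp only [map_add, TensorProduct.tmul_add, TensorProduct.add_tmul, hy, hz]
      | tmul r h => simp

lemma formCycle_coact₂_insertOne (f : H ⊗[k] H →ₗ[k] k) (x : P ⊗[k] P) :
    formCycle δ f (LinearMap.rTensor P δ.coact₂ (insertOne k P x)) =
      tensorMul P P (δ.flipWith f x ⊗ₜ (1 ⊗ₜ 1)) := by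
  induction x with
  | zero => simp
  | add y z hy hz => simp only [map_add, TensorProduct.add_tmul, hy, hz]
  | tmul p q =>
    rw [insertOne_tmul, LinearMap.rTensor_tmul, coact₂_eq, diagCoact_tmul_one,
      flipWith_eq_formAct, AlgHom.toLinearMap_apply]
    generalize δ.coact p = s
    induction s with
    | zero => simp
    | add y z hy hz => simp only [map_add, TensorProduct.add_tmul, hy, hz]
    | tmul r h => simp

/-- The map `(p ⊗ m) ⊗ h ↦ p ⊗ m₀ ⊗ m₁ S(h)`. -/
def coactAntipodeRight (δ : RightComoduleAlgebra k H P) :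
    (P ⊗[k] P) ⊗[k] H →ₗ[k] (P ⊗[k] P) ⊗[k] H :=
  (TensorProduct.assoc k P P H).symm.toLinearMap ∘ₗ LinearMap.lTensor P δ.coactAntipode ∘ₗ
    (TensorProduct.assoc k P P H).toLinearMap

/-- The map `((p ⊗ m) ⊗ h) ⊗ u ↦ (m ⊗ u) ⊗ p₀ f(h ⊗ p₁)`. -/
def formFlipRight (δ : RightComoduleAlgebra k H P) (f : H ⊗[k] H →ₗ[k] k) :
    ((P ⊗[k] P) ⊗[k] H) ⊗[k] P →ₗ[k] (P ⊗[k] P) ⊗[k] P :=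
  (TensorProduct.rightComm k P P P).toLinearMap ∘ₗ LinearMap.rTensor P (δ.formFlip f)

lemma coactAntipodeRight_tensorMul (p q r : P) :
    coactAntipodeRight δ (tensorMul P H ((p ⊗ₜ q) ⊗ₜ δ.coact r)) =
      (TensorProduct.assoc k P P H).symm (p ⊗ₜ (δ.coact q * (r ⊗ₜ 1))) := by
  rw [← coactAntipode_mul_coact, coactAntipodeRight]
  generalize δ.coact r = s
  induction s with
  | zero => simp
  | add y z hy hz => simp only [map_add, TensorProduct.tmul_add, mul_add, hy, hz]
  | tmul r h => simp

/-- The counterpart for axiom 3: for x = p ⊗ q and y = r ⊗ u both sides are f(q₁ ⊗ p₁) q₀r ⊗ u ⊗ p₀.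
Here `coactAntipodeRight` is needed first, to extract q₁ from the Galois image. -/
lemma formFlipRight_eq_outerMul (f : H ⊗[k] H →ₗ[k] k) (x y : P ⊗[k] P) :
    formFlipRight δ f (LinearMap.rTensor P (coactAntipodeRight δ)
        (LinearMap.rTensor P (tensorMul P H ∘ₗ TensorProduct.mk k _ _ x ∘ₗ
          δ.coact.toLinearMap) y)) =
      outerMul (unop.symm (δ.flipWith (f ∘ₗ (TensorProduct.comm k H H).toLinearMap) x))
        (tensorMul P P (y ⊗ₜ (1 ⊗ₜ 1))) := by
  induction y with
  | zero => simp
  | add y z hy hz => simp only [map_add, TensorProduct.add_tmul, hy, hz]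
  | tmul r u =>
    rw [tensorMul_tmul, mul_one, outerMul_tmul, unop_mul_tmul, LinearEquiv.apply_symm_apply,
      LinearMap.mulLeft_one, LinearMap.rTensor_tmul, LinearMap.rTensor_tmul,
      LinearMap.comp_apply, LinearMap.comp_apply, AlgHom.toLinearMap_apply,
      TensorProduct.mk_apply, flipWith_comm_eq_formFlip]
    induction x with
    | zero => simp
    | add y z hy hz => simp only [map_add, TensorProduct.add_tmul, hy, hz]
    | tmul p q =>
      simp only [coactAntipodeRight_tensorMul, coactRight, LinearMap.comp_apply,
        LinearMap.lTensor_tmul, AlgHom.toLinearMap_apply, formFlipRight, LinearMap.rTensor_tmul]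
      generalize δ.coact q = s
      induction s with
      | zero => simp
      | add y z hy hz =>
        simp only [map_add, TensorProduct.tmul_add, TensorProduct.add_tmul, add_mul, hy, hz]
      | tmul q h => simp

lemma formFlipRight_coact₂_insertOne (f : H ⊗[k] H →ₗ[k] k) (x : P ⊗[k] P) :
    formFlipRight δ f (LinearMap.rTensor P (coactAntipodeRight δ)
        (LinearMap.rTensor P δ.coact₂ (insertOne k P x))) =
      (TensorProduct.assoc k P P P).symm (1 ⊗ₜ δ.formFlip f (δ.antiCoactLeft x)) := by
  induction x with
  | zero => simp
  | add y z hy hz => simp only [map_add, TensorProduct.tmul_add, hy, hz]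
  | tmul p q =>
    simp only [insertOne_tmul, LinearMap.rTensor_tmul, coact₂_eq, diagCoact_tmul_one,
      AlgHom.toLinearMap_apply, antiCoactLeft, antiCoact, LinearMap.comp_apply]
    generalize δ.coact p = s
    induction s with
    | zero => simp
    | add y z hy hz =>
      simp only [map_add, TensorProduct.tmul_add, TensorProduct.add_tmul, hy, hz]
    | tmul r h =>
      simp [coactAntipodeRight, formFlipRight, Algebra.TensorProduct.one_def]

end

variable {k : Type u} {H : Type v} {P : Type w} [Field k] [Ring H] [HopfAlgebra k H] [Ring P]
  [Algebra k P] {δ : RightComoduleAlgebra k H P} {L : Type w} [Ring L] [Algebra k L]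
  (E : δ.EhresmannSchauenburg L)

lemma isLeftAntipode (hG : δ.IsHopfGalois) (hP : LeftFaithfullyFlat.{max u v w} k δ.base P)
    (𝓡 : CoquasitriangularStructure k H) :
    (E.bialgebroid hG hP).IsLeftAntipode (E.antipode 𝓡) where
  map_target_mul b X := by
    refine E.incl_injective ?_
    change E.incl (E.antipode 𝓡 (E.target (op b) * X)) = E.incl (E.antipode 𝓡 X * E.source b)
    rw [incl_antipode, incl_target_mul, incl_mul_source, incl_antipode]
    exact δ.flipWith_lTensor_mulRight _ b _
  symm_source_mul b X := by
    refine E.incl_injective ?_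
    change E.incl ((E.antipode 𝓡).symm (E.source b * X)) =
      E.incl ((E.antipode 𝓡).symm X * E.target (op b))
    rw [incl_antipode_symm, incl_source_mul, incl_mul_target, incl_antipode_symm]
    exact δ.flipWith_rTensor_mulLeft _ b _
  symm_comul X z hz := by
    refine E.pairMul_injective hG hP ?_
    refine Eq.trans ?_ (E.pairMul_tmul _ _).symm
    -- The right side is rewritten in terms of the Galois image of z. Both sides are then linear in
    -- z, which may be taken to be any pure tensor.
    rw [incl_one, incl_antipode_symm, braiding, ← formCycle_coact₂_insertOne,
      ← E.pairMul_proj_of_eq hG hP hz, ← rTensor_galois_tensorIncl]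
    clear hz
    induction z with
    | zero => simp only [map_zero]; exact map_zero E.pairMul
    | add y z hy hz =>
      simp only [map_add]
      exact (map_add E.pairMul _ _).trans (congrArg₂ (· + ·) hy hz)
    | tmul Y Z =>
      rw [rTensor_galois_tensorIncl_tmul, formCycle_eq_outerMul, ← incl_one E, ← pairMul_tmul,
        ← braiding, ← incl_antipode_symm]
      rw [incl_apply, LinearEquiv.symm_apply_apply]
      exact E.pairMul_rightMul_comul hG hP ((E.antipode 𝓡).symm Z) (1 ⊗ₜ Y)
  comul_map X z hz := by
    refine E.pairMul_injective hG hP ?_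
    refine Eq.trans ?_ (E.pairMul_tmul _ _).symm
    -- Ψ⁻¹(X) is computed from the coaction on the second leg of X, whereas the Galois image of Δ(X)
    -- yields the antipode of the coaction on the first. Coinvariance of X makes them equal.
    have h : tensorMul P P (E.incl 1 ⊗ₜ E.incl (E.antipode 𝓡 X)) =
        (TensorProduct.assoc k P P P).symm (1 ⊗ₜ δ.formFlip 𝓡.Rinv (δ.antiCoactLeft (E.incl X))) := by
      rw [incl_one, incl_antipode, braidingInv, flipWith_comm_eq_formFlip,
        δ.antiCoactLeft_eq_coactRight (E.coact₂_incl X)]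
      generalize δ.formFlip 𝓡.Rinv (δ.coactRight (E.incl X)) = y
      induction y with
      | zero => simp
      | add y z hy hz => simp only [map_add, TensorProduct.tmul_add, hy, hz]
      | tmul p q => simp
    rw [h, ← formFlipRight_coact₂_insertOne,
      ← E.pairMul_proj_of_eq hG hP hz, ← rTensor_galois_tensorIncl]
    clear hz h
    induction z with
    | zero => simp only [map_zero]; exact map_zero E.pairMul
    | add y z hy hz =>
      simp only [map_add]
      exact (map_add E.pairMul _ _).trans (congrArg₂ (· + ·) hy hz)
    | tmul Y Z =>
      rw [rTensor_galois_tensorIncl_tmul, formFlipRight_eq_outerMul, ← incl_one E, ← pairMul_tmul,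
        ← braidingInv, ← incl_antipode]
      rw [incl_apply, LinearEquiv.symm_apply_apply]
      exact E.pairMul_rightMul_comul hG hP (E.antipode 𝓡 Y) (Z ⊗ₜ 1)

end EhresmannSchauenburg

end RightComoduleAlgebra

end

theorem mainTheorem4 {k : Type u} {H : Type v} {P : Type w} [Field k]
    [Ring H] [HopfAlgebra k H] [Ring P] [Algebra k P]
    (δ : RightComoduleAlgebra k H P) (hG : δ.IsHopfGalois)
    (hP : LeftFaithfullyFlat.{max u v w} k δ.base P)
    (𝓡 : CoquasitriangularStructure k H) :
    (∃! 𝓛 : LeftBialgebroid k δ.base δ.esAlgebra, δ.IsEhresmannSchauenburg hG 𝓛) ∧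
    δ.braiding 𝓡 ∘ₗ δ.braidingInv 𝓡 = LinearMap.id ∧
    δ.braidingInv 𝓡 ∘ₗ δ.braiding 𝓡 = LinearMap.id ∧
    ∀ 𝓛 : LeftBialgebroid k δ.base δ.esAlgebra, δ.IsEhresmannSchauenburg hG 𝓛 →
      ∃ S : δ.esAlgebra ≃ₗ[k] δ.esAlgebra,
        (∀ X : δ.esAlgebra, RightComoduleAlgebra.unop (S X : P ⊗[k] Pᵐᵒᵖ) =
          δ.braidingInv 𝓡 (RightComoduleAlgebra.unop (X : P ⊗[k] Pᵐᵒᵖ))) ∧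
        𝓛.IsLeftAntipode S := by
  refine ⟨⟨_, δ.isEhresmannSchauenburg_bialgebroid hG hP, fun 𝓛 h => h.eq_bialgebroid hP⟩,
    δ.braiding_comp_braidingInv 𝓡, δ.braidingInv_comp_braiding 𝓡, fun 𝓛 h => ?_⟩
  obtain rfl := h.eq_bialgebroid hP
  exact ⟨δ.ehresmannSchauenburg.antipode 𝓡, δ.ehresmannSchauenburg.incl_antipode 𝓡,
    δ.ehresmannSchauenburg.isLeftAntipode hG hP 𝓡⟩
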